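/- **Setting.** Let $k$ be a perfect field of characteristic $p>0$, $R$ a complete discrete valuation ring which is a $k$-algebra, with maximal ideal $\mathfrak m$, uniformizer $\pi$, fraction field $K$, normalized valuation ${\tt v}$, and residue field $F$ finitely generated (as a field) over $k$. Write $S=\mathrm{Spec}(R)$, with closed point $s$ and generic point $\eta$; $\Omega^1_R=\Omega^1_{R/k}$, $\Omega^1_K=\Omega^1_{K/k}$; and $\Omega^1_R(\log)\subset\Omega^1_K$ for the $R$-module generated by $\Omega^1_R$ and the $d\log x=x^{-1}dx$, $x\in K^\times$. Let $X=\mathrm{Spec}(B)$ be an affine smooth $k$-scheme and $\xi\colon S\to X$ a $k$-morphism which induces an isomorphism from the completed local ring of $X$ at $x=\xi(s)$ onto $R$. Let $X_0$ be the closure of $x$ in $X$. **Swan conductors.** Let $\mathrm{fil}_nW_{m+1}(K)=\{(x_0,\dots,x_m): p^{m-i}{\tt v}(x_i)\ge -n\ \forall i\}$ and $\mathrm{fil}'_nW_{m+1}(K)=V^{m+1-m'}(\mathrm{fil}_{n+1}W_{m'}(K))+\mathrm{fil}_nW_{m+1}(K)$ with $m'=\min(\mathrm{ord}_p(n+1),m+1)$.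 Let $\delta_{m+1}\colon W_{m+1}(K)\to H^1(K,\mathbb Z/p^{m+1}\mathbb Z)$ be the Artin–Schreier–Witt connecting map (of $F-1$). In $H^1(K)=H^1(K,\mathbb Q/\mathbb Z)$ (into which $H^1(K,\mathbb Z/N\mathbb Z)$ is embedded by $j\mapsto j/N$), let $\mathrm{fil}_nH^1(K)$ (resp. $\mathrm{fil}'_nH^1(K)$) be the sum of the prime-to-$p$ torsion and of $\bigcup_m\delta_{m+1}(\mathrm{fil}_nW_{m+1}(K))$ (resp. $\bigcup_m\delta_{m+1}(\mathrm{fil}'_nW_{m+1}(K))$). Then $\mathrm{sw}(\chi)$ (resp. $\mathrm{sw}'(\chi)$) is the least $n\ge0$ with $\chi\in\mathrm{fil}_nH^1(K)$ (resp. $\mathrm{fil}'_nH^1(K)$). Put $\mathrm{fil}_n\Omega^1_K=\mathfrak m^{-n}\Omega^1_R(\log)$, $\mathrm{fil}'_n\Omega^1_K=\mathfrak m^{-n-1}\Omega^1_R$, with graded pieces $\mathrm{Gr}_n$, $\mathrm{Gr}'_n$. For $n=\mathrm{sw}(\chi)\ge1$ (resp. $n=\mathrm{sw}'(\chi)\ge2$),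 the refined conductor $\mathrm{rsw}(\chi)\in\mathrm{Gr}_n\Omega^1_K$ (resp. $\mathrm{rsw}'(\chi)\in\mathrm{Gr}'_n\Omega^1_K$) is the class of $-F^md(x)=-\sum_i x_i^{p^{m-i}-1}dx_i$, for any $x\in\mathrm{fil}_nW_{m+1}(K)$ (resp. $\mathrm{fil}'_nW_{m+1}(K)$) such that $\chi-\delta_{m+1}(x)$ has order prime to $p$. **Dilatations.** Let $D$ be the effective divisor of $S$ defined by $\mathfrak m^r$. In the non-logarithmic case let $P=X\times_kS$. In the logarithmic case let $P=X\times_k^{\log}S$ be the open subscheme of the blow-up of $X\times_kS$ along $X_0\times_k s$ obtained by removing the strict transforms of $X_0\times_kS$ and $X\times_ks$. In both cases the graph of $\xi$ is a section of $P\to S$, with ideal $I$. Let $P_{(D)}$ be the dilatation of $P$ along this section with thickness $D$, obtained locally by adjoining $\pi^{-r}I$ to the structure sheaf. Let $\kappa$ be the generic point of $P_{(D)}\times_SD$ (written $T_D$, resp. $\Theta_D$), $R_{\mathbb K}$ the completed local ring of $P_{(D)}$ at $\kappa$, $\mathbb K$ its fraction field, $\mathfrak m_{\mathbb K}$ its maximal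 ideal. The projections of $P_{(D)}$ to $S$ and to $X$ induce homomorphisms $u,v\colon R\to R_{\mathbb K}$, hence $u,v\colon K\to\mathbb K$. The conormal module $I/I^2$ is identified with $\Omega^1_R$ (resp. $\Omega^1_R(\log)$), the class of $b\otimes1-1\otimes\xi(b)$ corresponding to $d(\xi(b))$. The inclusion of $I$ in $\mathfrak m_{\mathbb K}^r$ thus induces a homomorphism $t$ from $\Omega^1_R$ (resp. $\Omega^1_R(\log)$) to $\mathfrak m_{\mathbb K}^r/\mathfrak m_{\mathbb K}^{r+1}$, and, by twisting, homomorphisms $t_n\colon\mathrm{Gr}'_n\Omega^1_K\to\mathfrak m_{\mathbb K}^{-n+r-1}/\mathfrak m_{\mathbb K}^{-n+r}$ (resp. $t_n\colon\mathrm{Gr}_n\Omega^1_K\to\mathfrak m_{\mathbb K}^{-n+r}/\mathfrak m_{\mathbb K}^{-n+r+1}$). **Proposition.** Let $n\ge1$ be an integer and $n'$ its largest divisor prime to $p$. Suppose that $K$ contains a primitive $n'$-th root of unity, and let $\chi\in H^1(K,\mathbb Z/n\mathbb Z)$. (1) If $\mathrm{sw}'(\chi)\ge2$, then $p$ divides $n$;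 and if $r=\mathrm{sw}'(\chi)+1$, then in the non-logarithmic case $v^*(\chi)-u^*(\chi)\in H^1(\mathbb K,\mathbb Z/n\mathbb Z)$ is the image of $-t_{\mathrm{sw}'(\chi)}(\mathrm{rsw}'(\chi))\in R_{\mathbb K}/\mathfrak m_{\mathbb K}$ under the composite $$R_{\mathbb K}/\mathfrak m_{\mathbb K}\to H^1_{\text{ét}}(\mathrm{Spec}(R_{\mathbb K}/\mathfrak m_{\mathbb K}),\mathbb Z/p\mathbb Z)\xleftarrow{\ \sim\ }H^1_{\text{ét}}(\mathrm{Spec}(R_{\mathbb K}),\mathbb Z/p\mathbb Z)\to H^1(\mathbb K,\mathbb Z/p\mathbb Z)\to H^1(\mathbb K,\mathbb Z/n\mathbb Z),$$ where the first map is the Artin–Schreier homomorphism, the isomorphism (given by reduction) is traversed backwards, and the last map is induced by multiplication by $n/p$ on coefficients. Equivalently, it is the image under the last map of the Artin–Schreier class of any lift $a\in R_{\mathbb K}$ of that element. (2) If $\mathrm{sw}(\chi)\ge1$, then $p$ divides $n$; and if $r=\mathrm{sw}(\chi)$, then in the logarithmic case $v^*(\chi)-u^*(\chi)$ is the image of $-t_{\mathrm{sw}(\chi)}(\mathrm{rsw}(\chi))\in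 R_{\mathbb K}/\mathfrak m_{\mathbb K}$ under the same composite. -/

import Mathlib

open scoped TensorProduct KaehlerDifferential WithZero

noncomputable section

namespace Ramif

/-! ### Galois cohomology in degree one with constant coefficients -/

section GaloisCohomology

/-- The absolute Galois group `Gal(K^sep/K)`, with its Krull topology. -/
abbrev GalSep (K : Type*) [Field K] := SeparableClosure K ≃ₐ[K] SeparableClosure K

lemma setOf_eq_ker {K M : Type*} [Field K] [AddCommGroup M] (θ : Additive (GalSep K) →+ M) :
    {σ : GalSep K | θ (Additive.ofMul σ) = 0} =
      (θ.toMultiplicativeRight.ker : Set (GalSep K)) := by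
  ext σ; simp [MonoidHom.mem_ker]

lemma isOpen_of_imp {K M N : Type*} [Field K] [AddCommGroup M] [AddCommGroup N]
    {θ : Additive (GalSep K) →+ M} {ψ : Additive (GalSep K) →+ N}
    (hθ : IsOpen {σ : GalSep K | θ (Additive.ofMul σ) = 0})
    (h : ∀ σ, θ σ = 0 → ψ σ = 0) : IsOpen {σ : GalSep K | ψ (Additive.ofMul σ) = 0} := by
  rw [setOf_eq_ker] at hθ ⊢
  refine Subgroup.isOpen_mono ?_ hθ
  intro σ hσ
  have h1 : θ (Additive.ofMul σ) = 0 := by simpa [MonoidHom.mem_ker] using hσ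
  simp [MonoidHom.mem_ker, h _ h1]

/-- `H¹(K, M)` for a discrete group `M` with trivial Galois action: the group of homomorphisms
`Gal(K^sep/K) → M` with open kernel, i.e. of continuous homomorphisms. -/
def H1 (K : Type*) [Field K] (M : Type*) [AddCommGroup M] :
    AddSubgroup (Additive (GalSep K) →+ M) where
  carrier := {χ | IsOpen {σ : GalSep K | χ (Additive.ofMul σ) = 0}}
  zero_mem' := by simp
  add_mem' := by
    intro χ ψ hχ hψ
    exact isOpen_of_imp (θ := χ.prod ψ) (by
      have : {σ : GalSep K | (χ.prod ψ) (Additive.ofMul σ) = 0} =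
          {σ | χ (Additive.ofMul σ) = 0} ∩ {σ | ψ (Additive.ofMul σ) = 0} := by
        ext σ; simp
      rw [this]; exact IsOpen.inter hχ hψ) (by
      intro σ h
      have h' : χ σ = 0 ∧ ψ σ = 0 := by simpa using h
      simp [h'.1, h'.2])
  neg_mem' := by
    intro χ hχ
    simpa using hχ

variable {K L : Type*} [Field K] [Field L]

/-- The map `H¹(K, M) → H¹(K, N)` induced by a homomorphism of coefficients. -/
def H1.mapCoeff {M N : Type*} [AddCommGroup M] [AddCommGroup N] (g : M →+ N) :
    H1 K M →+ H1 K N where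
  toFun χ := ⟨g.comp χ.1, isOpen_of_imp χ.2 (by intro σ h; simp [h])⟩
  map_zero' := by ext; simp
  map_add' := by intros; ext; simp

/-- An extension `K^sep → L^sep` of a field homomorphism `f : K → L`. -/
def sepLift (f : K →+* L) : SeparableClosure K →+* SeparableClosure L :=
  letI : Algebra K (SeparableClosure L) := ((algebraMap L (SeparableClosure L)).comp f).toAlgebra
  (IsSepClosed.lift : SeparableClosure K →ₐ[K] SeparableClosure L).toRingHom

lemma sepLift_algebraMap (f : K →+* L) (x : K) :
    sepLift f (algebraMap K _ x) = algebraMap L _ (f x) := by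
  let : Algebra K (SeparableClosure L) := ((algebraMap L (SeparableClosure L)).comp f).toAlgebra
  exact (IsSepClosed.lift : SeparableClosure K →ₐ[K] SeparableClosure L).commutes x

/-- The restriction homomorphism `Gal(L^sep/L) → Gal(K^sep/K)` along `f : K → L`. -/
def galRestrict (f : K →+* L) : GalSep L →* GalSep K :=
  letI : Algebra K (SeparableClosure L) := ((algebraMap L (SeparableClosure L)).comp f).toAlgebra
  letI : Algebra K L := f.toAlgebra
  letI : Algebra (SeparableClosure K) (SeparableClosure L) := (sepLift f).toAlgebra
  haveI : IsScalarTower K (SeparableClosure K) (SeparableClosure L) :=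
    IsScalarTower.of_algebraMap_eq fun x => (sepLift_algebraMap f x).symm
  haveI : IsScalarTower K L (SeparableClosure L) := IsScalarTower.of_algebraMap_eq fun _ => rfl
  (AlgEquiv.restrictNormalHom (F := K) (K₁ := SeparableClosure L) (SeparableClosure K)).comp
    { toFun := fun σ => σ.restrictScalars K
      map_one' := rfl
      map_mul' := fun _ _ => rfl }

lemma sepLift_galRestrict (f : K →+* L) (σ : GalSep L) (x : SeparableClosure K) :
    sepLift f (galRestrict f σ x) = σ (sepLift f x) := by
  let : Algebra K (SeparableClosure L) := ((algebraMap L (SeparableClosure L)).comp f).toAlgebra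
  let : Algebra K L := f.toAlgebra
  let : Algebra (SeparableClosure K) (SeparableClosure L) := (sepLift f).toAlgebra
  have : IsScalarTower K (SeparableClosure K) (SeparableClosure L) :=
    IsScalarTower.of_algebraMap_eq fun x => (sepLift_algebraMap f x).symm
  have : IsScalarTower K L (SeparableClosure L) := IsScalarTower.of_algebraMap_eq fun _ => rfl
  exact AlgEquiv.restrictNormal_commutes (σ.restrictScalars K) (SeparableClosure K) x

lemma galRestrict_continuous (f : K →+* L) : Continuous (galRestrict f) := by
  refine continuous_of_continuousAt_one _ ?_
  rw [ContinuousAt, map_one]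
  intro s hs
  rw [krullTopology_mem_nhds_one_iff] at hs
  obtain ⟨E, hE, hEs⟩ := hs
  obtain ⟨t, rfl⟩ : E.FG :=
    IntermediateField.fg_of_fg_toSubalgebra E
      (Subalgebra.fg_iff_finiteType _ |>.2 (inferInstanceAs (Algebra.FiniteType K E)))
  let T : Set (SeparableClosure L) := sepLift f '' (t : Set (SeparableClosure K))
  have : Finite T := ((Finset.finite_toSet t).image _).to_subtype
  have hfin : FiniteDimensional L (IntermediateField.adjoin L T) :=
    IntermediateField.finiteDimensional_adjoin fun x _ => Algebra.IsIntegral.isIntegral x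
  rw [Filter.mem_map, krullTopology_mem_nhds_one_iff]
  refine ⟨IntermediateField.adjoin L T, hfin, fun σ hσ => hEs ?_⟩
  simp only [SetLike.mem_coe] at hσ ⊢
  rw [IntermediateField.mem_fixingSubgroup_iff] at hσ ⊢
  intro x hx
  induction hx using IntermediateField.adjoin_induction with
  | mem x hx =>
    apply (sepLift f).injective
    rw [sepLift_galRestrict]
    exact hσ _ (IntermediateField.subset_adjoin L T ⟨x, hx, rfl⟩)
  | algebraMap x => exact (galRestrict f σ).commutes x
  | add x y _ _ hx hy => rw [map_add, hx, hy]
  | inv x _ hx => rw [map_inv₀, hx]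
  | mul x y _ _ hx hy => rw [map_mul, hx, hy]

/-- The pull-back `f^* : H¹(K, M) → H¹(L, M)` along a field homomorphism `f : K → L`. -/
def H1.pullback {M : Type*} [AddCommGroup M] (f : K →+* L) : H1 K M →+ H1 L M where
  toFun χ := ⟨χ.1.comp (galRestrict f).toAdditive,
    (show IsOpen {σ : GalSep K | χ.1 (Additive.ofMul σ) = 0} from χ.2).preimage
      (galRestrict_continuous f)⟩
  map_zero' := by ext; simp
  map_add' := by intros; ext; simp

/-- `ℚ/ℤ`. -/
abbrev QZ := AddCircle (1 : ℚ)

/-- The embedding `ℤ/n → ℚ/ℤ`, `j ↦ j/n`. -/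
def zmodToQZ (n : ℕ) : ZMod n →+ QZ :=
  ZMod.lift n ⟨zmultiplesHom QZ ((1 / n : ℚ) : QZ), by
    rcases eq_or_ne n 0 with rfl | hn
    · simp
    · have : (n : ℚ) ≠ 0 := by exact_mod_cast hn
      rw [zmultiplesHom_apply, natCast_zsmul, ← AddCircle.coe_nsmul, nsmul_eq_mul]
      rw [mul_one_div_cancel this]
      exact AddCircle.coe_period 1⟩

/-- The homomorphism `ℤ/p → ℤ/n`, `j ↦ (n/p) j`, for `p` dividing `n`. -/
def mulCoeff {p n : ℕ} (h : p ∣ n) : ZMod p →+ ZMod n :=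
  ZMod.lift p ⟨zmultiplesHom (ZMod n) ((n / p : ℕ) : ZMod n), by
    rw [zmultiplesHom_apply, natCast_zsmul, nsmul_eq_mul, ← Nat.cast_mul, Nat.mul_div_cancel' h]
    exact ZMod.natCast_self n⟩

/-- `χ ∈ H¹(L, ℤ/p)` is the image of `a ∈ L` under the Artin-Schreier homomorphism, i.e. under the
connecting map of `0 → ℤ/p → 𝔾ₐ → 𝔾ₐ → 0`, where the last map is `y ↦ y ^ p - y`. -/
def IsArtinSchreierClass {p : ℕ} (a : L) (χ : H1 L (ZMod p)) : Prop :=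
  ∃ y : SeparableClosure L, y ^ p - y = algebraMap L _ a ∧
    ∀ σ : GalSep L, σ y - y = ((χ.1 (Additive.ofMul σ)).val : SeparableClosure L)

end GaloisCohomology

/-! ### Filtrations on Witt vectors, characters and differential forms -/

section Filtrations

variable (k R K : Type*) [Field k] [CommRing R] [IsDomain R] [IsDiscreteValuationRing R]
  [Algebra k R] [Field K] [Algebra R K] [IsFractionRing R K] [Algebra k K] [IsScalarTower k R K]
variable (p : ℕ) [Fact p.Prime]

/-- The valuation of `K`, written multiplicatively: `val R K x ≤ exp n` means `v(x) ≥ -n`. -/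
abbrev val : Valuation K ℤᵐ⁰ := (IsDiscreteValuationRing.maximalIdeal R).valuation K

/-- `fil_n W_{m+1}(K)`: the Witt vectors `(x_0, …, x_m)` with `p^{m-i} v(x_i) ≥ -n` for all `i`. -/
def filW (m : ℕ) (n : ℤ) : Set (TruncatedWittVector p (m + 1) K) :=
  {x | ∀ i : Fin (m + 1), val R K (x.coeff i) ^ p ^ (m - (i : ℕ)) ≤ WithZero.exp n}

/-- `fil'_n W_{m+1}(K) = V^{m+1-m'}(fil_{n+1} W_{m'}(K)) + fil_n W_{m+1}(K)`, where
`m' = min(ord_p(n+1), m+1)`. The elements of `V^{m+1-m'}(fil_{n+1} W_{m'}(K))` are the elements of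
`fil_{n+1} W_{m+1}(K)` whose first `m+1-m'` components vanish. -/
def filWMod (m n : ℕ) : Set (TruncatedWittVector p (m + 1) K) :=
  {x | ∃ y z : TruncatedWittVector p (m + 1) K,
    y ∈ filW R K p m n ∧ z ∈ filW R K p m (n + 1) ∧
    (∀ i : Fin (m + 1), (i : ℕ) < m + 1 - min (padicValNat p (n + 1)) (m + 1) → z.coeff i = 0) ∧
    x = z + y}

variable {K p} in
/-- `χ = δ_{m+1}(x)`, where `δ_{m+1} : W_{m+1}(K) → H¹(K, ℤ/p^{m+1})` is the connecting map of
`0 → ℤ/p^{m+1} → W_{m+1} → W_{m+1} → 0`, the last map being `F - 1`. In characteristic `p`, the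
Frobenius `F` raises the components to the power `p`; the Galois group acts on components. -/
def IsWittClass {m : ℕ} (x : TruncatedWittVector p (m + 1) K) (χ : H1 K (ZMod (p ^ (m + 1)))) :
    Prop :=
  ∃ y : TruncatedWittVector p (m + 1) (SeparableClosure K),
    TruncatedWittVector.mk p (fun i => y.coeff i ^ p) - y =
      TruncatedWittVector.mk p (fun i => algebraMap K (SeparableClosure K) (x.coeff i)) ∧
    ∀ σ : GalSep K, TruncatedWittVector.mk p (fun i => σ (y.coeff i)) - y =
      ((χ.1 (Additive.ofMul σ)).val : TruncatedWittVector p (m + 1) (SeparableClosure K))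

/-- `H¹(K)[p']`: the characters coming from `H¹(K, ℤ/N)` for some `N` prime to `p`. -/
def primeToP : Set (H1 K QZ) :=
  {χ | ∃ N : ℕ, N.Coprime p ∧ ∃ ψ : H1 K (ZMod N), χ = H1.mapCoeff (zmodToQZ N) ψ}

/-- `fil_n H¹(K) = H¹(K)[p'] + ⋃_m δ_{m+1}(fil_n W_{m+1}(K))` in `H¹(K) = H¹(K, ℚ/ℤ)`. -/
def filH (n : ℕ) : Set (H1 K QZ) :=
  {χ | ∃ ψ ∈ primeToP K p, ∃ (m : ℕ) (x : TruncatedWittVector p (m + 1) K)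
    (θ : H1 K (ZMod (p ^ (m + 1)))), x ∈ filW R K p m n ∧ IsWittClass x θ ∧
    χ = ψ + H1.mapCoeff (zmodToQZ _) θ}

/-- `fil'_n H¹(K) = H¹(K)[p'] + ⋃_m δ_{m+1}(fil'_n W_{m+1}(K))` in `H¹(K) = H¹(K, ℚ/ℤ)`. -/
def filHMod (n : ℕ) : Set (H1 K QZ) :=
  {χ | ∃ ψ ∈ primeToP K p, ∃ (m : ℕ) (x : TruncatedWittVector p (m + 1) K)
    (θ : H1 K (ZMod (p ^ (m + 1)))), x ∈ filWMod R K p m n ∧ IsWittClass x θ ∧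
    χ = ψ + H1.mapCoeff (zmodToQZ _) θ}

variable {K}

/-- The Swan conductor `sw(χ)`. -/
def sw (χ : H1 K QZ) : ℕ := sInf {n | χ ∈ filH R K p n}

/-- The modified Swan conductor `sw'(χ)`. -/
def swMod (χ : H1 K QZ) : ℕ := sInf {n | χ ∈ filHMod R K p n}

variable {p} in
/-- `F^m d : W_{m+1}(K) → Ω¹_K`, `(x_0, …, x_m) ↦ ∑ x_i^{p^{m-i}-1} dx_i`. -/
def wittD {m : ℕ} (x : TruncatedWittVector p (m + 1) K) : Ω[K⁄k] :=
  ∑ i : Fin (m + 1), x.coeff i ^ (p ^ (m - (i : ℕ)) - 1) • KaehlerDifferential.D k K (x.coeff i)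

variable (K)

/-- `fil'_n Ω¹_K`: the image of `Ω¹_R ⊗ 𝔪^{-n-1} → Ω¹_K`. -/
def filOmegaMod (n : ℤ) : Submodule R Ω[K⁄k] :=
  Submodule.span R {ω | ∃ c : K, val R K c ≤ WithZero.exp (n + 1) ∧
    ∃ η : Ω[R⁄k], ω = c • KaehlerDifferential.map k k R K η}

/-- `fil_n Ω¹_K`: the image of `Ω¹_R(log) ⊗ 𝔪^{-n} → Ω¹_K`, where `Ω¹_R(log)` is generated by
`Ω¹_R` and the logarithmic differentials `d log x = x⁻¹ dx`, for `x` in `K^×`. -/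
def filOmega (n : ℤ) : Submodule R Ω[K⁄k] :=
  Submodule.span R {ω | ∃ c : K, val R K c ≤ WithZero.exp n ∧
    ((∃ η : Ω[R⁄k], ω = c • KaehlerDifferential.map k k R K η) ∨
      ∃ x : K, x ≠ 0 ∧ ω = c • x⁻¹ • KaehlerDifferential.D k K x)}

variable {K}

/-- The refined Swan conductor `rsw(χ)` for `n = sw(χ) ≥ 1`, in
`Gr_n Ω¹_K = fil_n Ω¹_K / fil_{n-1} Ω¹_K ⊆ Ω¹_K / fil_{n-1} Ω¹_K`: the class of `-F^m d(x)`
for any `x ∈ fil_n W_{m+1}(K)` such that `χ - δ_{m+1}(x)` has order prime to `p`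
(it does not depend on `x`). -/
def rsw (χ : H1 K QZ) : Ω[K⁄k] ⧸ filOmega k R K (sw R p χ - 1) :=
  Classical.epsilon fun c => ∃ ψ ∈ primeToP K p, ∃ (m : ℕ) (x : TruncatedWittVector p (m + 1) K)
    (θ : H1 K (ZMod (p ^ (m + 1)))), x ∈ filW R K p m (sw R p χ) ∧ IsWittClass x θ ∧
    χ = ψ + H1.mapCoeff (zmodToQZ _) θ ∧ c = Submodule.Quotient.mk (-wittD k x)

/-- The refined modified Swan conductor `rsw'(χ)` for `n = sw'(χ) ≥ 2`, in
`Gr'_n Ω¹_K = fil'_n Ω¹_K / fil'_{n-1} Ω¹_K ⊆ Ω¹_K / fil'_{n-1} Ω¹_K`: the class of `-F^m d(x)`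
for any `x ∈ fil'_n W_{m+1}(K)` such that `χ - δ_{m+1}(x)` has order prime to `p`
(it does not depend on `x`). -/
def rswMod (χ : H1 K QZ) : Ω[K⁄k] ⧸ filOmegaMod k R K (swMod R p χ - 1) :=
  Classical.epsilon fun c => ∃ ψ ∈ primeToP K p, ∃ (m : ℕ) (x : TruncatedWittVector p (m + 1) K)
    (θ : H1 K (ZMod (p ^ (m + 1)))), x ∈ filWMod R K p m (swMod R p χ) ∧ IsWittClass x θ ∧
    χ = ψ + H1.mapCoeff (zmodToQZ _) θ ∧ c = Submodule.Quotient.mk (-wittD k x)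

end Filtrations

/-! ### Algebraization and dilatations -/

section Dilatation

variable {k R : Type*} (K : Type*) {B : Type*} [Field k] [CommRing R] [IsDomain R]
  [IsDiscreteValuationRing R] [Algebra k R] [Field K] [Algebra R K] [IsFractionRing R K]
  [Algebra k K] [IsScalarTower k R K] [CommRing B] [Algebra k B] (ξ : B →ₐ[k] R)

/-- The point `x = ξ(s)` of `X = Spec B`, the image of the closed point `s` of `S = Spec R`. -/
abbrev centre : Ideal B := (IsLocalRing.maximalIdeal R).comap (ξ : B →+* R)

/-- The local ring `A` of `X` at `x`. -/
abbrev LocRing := Localization.AtPrime (centre ξ)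

/-- The homomorphism `A → R` induced by `ξ`. -/
def locHom : LocRing ξ →+* R :=
  IsLocalization.lift (M := (centre ξ).primeCompl) (g := (ξ : B →+* R)) (fun y => by
    by_contra h
    exact y.2 ((IsLocalRing.mem_maximalIdeal _).2 h))

lemma maximalIdeal_le_comap_locHom :
    IsLocalRing.maximalIdeal (LocRing ξ) ≤ (IsLocalRing.maximalIdeal R).comap (locHom ξ) := by
  rw [← Localization.AtPrime.map_eq_maximalIdeal, Ideal.map_le_iff_le_comap]
  intro b hb
  simpa [locHom] using hb

lemma pow_le_comap {A₁ A₂ : Type*} [CommRing A₁] [CommRing A₂] {I : Ideal A₁} {J : Ideal A₂}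
    {f : A₁ →+* A₂} (h : I ≤ J.comap f) (n : ℕ) : I ^ n ≤ (J ^ n).comap f :=
  (Ideal.pow_right_mono h n).trans (Ideal.le_comap_pow f n)

/-- The homomorphism `A / 𝔪_A^n → R / 𝔪^n` induced by `ξ`. -/
def locHomLevel (n : ℕ) : LocRing ξ ⧸ IsLocalRing.maximalIdeal (LocRing ξ) ^ n →+*
    R ⧸ IsLocalRing.maximalIdeal R ^ n :=
  Ideal.quotientMap _ (locHom ξ) (pow_le_comap (maximalIdeal_le_comap_locHom ξ) n)

/-- `ξ` induces an isomorphism between the completed local rings of `X` at `x` and of `S` at `s`. -/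
def InducesIsoOnCompletions : Prop := ∀ n, Function.Bijective (locHomLevel ξ n)

/-- The section `γ` of `X ×_k η → η` given by the graph of `ξ`, as a homomorphism
`K ⊗_k B → K`. -/
def graphHom : K ⊗[k] B →ₐ[K] K :=
  Algebra.TensorProduct.lift (Algebra.ofId K K) ((IsScalarTower.toAlgHom k R K).comp ξ)
    (fun _ _ => Commute.all _ _)

/-- The coordinate ring `R ⊗_k B` of `X ×_k S`, as a subring of the coordinate ring `K ⊗_k B` of
its generic fibre `X ×_k η`. -/
def prodAlg (_ξ : B →ₐ[k] R) : Subalgebra R (K ⊗[k] B) :=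
  Algebra.adjoin R (Set.range fun b : B => (1 : K) ⊗ₜ[k] b)

/-- The coordinate ring of the dilatation of `X_0 ×_k s` in `X ×_k S` with respect to `s`, where
`X_0` is the closure of `x`: it is generated over `R ⊗_k B` by the elements `π^{-1} ⊗ f` for
`f` in the ideal of `X_0`. The logarithmic product `X ×_k^log S` is an open subscheme of its
spectrum; see `logLocus`. -/
def logProdAlg : Subalgebra R (K ⊗[k] B) :=
  prodAlg K ξ ⊔ Algebra.adjoin R
    {z | ∃ c : K, val R K c ≤ WithZero.exp (1 : ℤ) ∧ ∃ f ∈ centre ξ, z = c ⊗ₜ[k] f}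

lemma prodAlg_le_logProdAlg : prodAlg K ξ ≤ logProdAlg K ξ := le_sup_left

variable {K}

/-- Let `C ⊆ K ⊗_k B` be an `R`-subalgebra which is a model of (an open part of) `X ×_k η`, such
that the graph of `ξ` extends to a section of `Spec C` over `S`. These are the elements
`c y` for `c ∈ 𝔪^{-r}` and `y` in the ideal of this section. -/
def conormalTwist (C : Subalgebra R (K ⊗[k] B)) (r : ℕ) : Set (K ⊗[k] B) :=
  {z | ∃ c : K, val R K c ≤ WithZero.exp (r : ℤ) ∧ ∃ y ∈ C, graphHom K ξ y = 0 ∧ z = c • y}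

/-- The coordinate ring of the dilatation of `Spec C` along the graph of `ξ` with thickness the
divisor `D` of `S` of valuation `r`: it is obtained from `C` by dividing by `π^r` the elements of
the ideal of the graph. -/
def dilatation (C : Subalgebra R (K ⊗[k] B)) (r : ℕ) : Subalgebra R (K ⊗[k] B) :=
  C ⊔ Algebra.adjoin R (conormalTwist ξ C r)

lemma conormalTwist_subset (C : Subalgebra R (K ⊗[k] B)) (r : ℕ) :
    conormalTwist ξ C r ⊆ dilatation ξ C r :=
  Algebra.subset_adjoin.trans (show Algebra.adjoin R (conormalTwist ξ C r) ≤ _ from le_sup_right)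

/-- The ring underlying `dilatation ξ C r`. -/
def DilRing (C : Subalgebra R (K ⊗[k] B)) (r : ℕ) : Type _ := dilatation ξ C r

instance (C : Subalgebra R (K ⊗[k] B)) (r : ℕ) : CommRing (DilRing ξ C r) :=
  inferInstanceAs (CommRing (dilatation ξ C r))

instance (C : Subalgebra R (K ⊗[k] B)) (r : ℕ) : Algebra R (DilRing ξ C r) :=
  inferInstanceAs (Algebra R (dilatation ξ C r))

/-- The inclusion of the dilatation algebra in `K ⊗_k B`. -/
def DilRing.incl (C : Subalgebra R (K ⊗[k] B)) (r : ℕ) : DilRing ξ C r →ₐ[R] K ⊗[k] B :=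
  (dilatation ξ C r).val

lemma DilRing.incl_injective (C : Subalgebra R (K ⊗[k] B)) (r : ℕ) :
    Function.Injective (DilRing.incl ξ C r) :=
  Subtype.val_injective

lemma DilRing.exists_incl_eq (C : Subalgebra R (K ⊗[k] B)) (r : ℕ) {z : K ⊗[k] B}
    (hz : z ∈ dilatation ξ C r) : ∃ w : DilRing ξ C r, DilRing.incl ξ C r w = z :=
  ⟨⟨z, hz⟩, rfl⟩

/-- The inverse image of `D`, the divisor of `S` of valuation `r`, in the dilatation.
For `C = R ⊗_k B` this is `T_D`. -/
def fibreOverD (C : Subalgebra R (K ⊗[k] B)) (r : ℕ) : Set (PrimeSpectrum (DilRing ξ C r)) :=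
  {q | ∀ a ∈ IsLocalRing.maximalIdeal R ^ r, algebraMap R (DilRing ξ C r) a ∈ q.asIdeal}

/-- The points of the dilatation of `Spec (logProdAlg K ξ)` that lie over its open subscheme
`X ×_k^log S`, i.e. where the ideal of the `π^{-1} ⊗ f`, `f` in the ideal of `X_0`, is the unit
ideal. As dilatations commute with open immersions, this is `(X ×_k^log S)_(D)`. -/
def logLocus (r : ℕ) : Set (PrimeSpectrum (DilRing ξ (logProdAlg K ξ) r)) :=
  {q | ∃ c : K, val R K c ≤ WithZero.exp (1 : ℤ) ∧ ∃ f ∈ centre ξ,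
    ∃ z : DilRing ξ (logProdAlg K ξ) r, DilRing.incl ξ _ r z = c ⊗ₜ[k] f ∧ z ∉ q.asIdeal}

/-- `Θ_D`, the inverse image of `D` in `(X ×_k^log S)_(D)`. -/
def logFibreOverD (r : ℕ) : Set (PrimeSpectrum (DilRing ξ (logProdAlg K ξ) r)) :=
  fibreOverD ξ (logProdAlg K ξ) r ∩ logLocus ξ r

section LocalField

variable {ξ} {C : Subalgebra R (K ⊗[k] B)} {r : ℕ} (κ : PrimeSpectrum (DilRing ξ C r))

/-- The local ring of the dilatation at `κ`. -/
abbrev DilLocRing := Localization.AtPrime κ.asIdeal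

/-- The completed local ring `R_𝕂` of the dilatation at `κ`. -/
abbrev RKK := AdicCompletion (IsLocalRing.maximalIdeal (DilLocRing κ)) (DilLocRing κ)

/-- The homomorphism `u : R → R_𝕂` given by the projection of the dilatation to `S`. -/
def uHom : R →+* RKK κ :=
  (algebraMap (DilLocRing κ) (RKK κ)).comp
    ((algebraMap (DilRing ξ C r) (DilLocRing κ)).comp (algebraMap R (DilRing ξ C r)))

/-- The residue map `R_𝕂 → R_𝕂 / 𝔪_𝕂`, the target being the residue field of `κ`. -/
def resHom : RKK κ →+* IsLocalRing.ResidueField (DilLocRing κ) :=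
  (AdicCompletion.evalOneₐ (IsLocalRing.maximalIdeal (DilLocRing κ))).toRingHom

lemma one_tmul_mem (hC : prodAlg K ξ ≤ C) (b : B) : (1 : K) ⊗ₜ[k] b ∈ dilatation ξ C r :=
  le_sup_left (a := C) (hC (Algebra.subset_adjoin ⟨b, rfl⟩))

variable (r) in
/-- The homomorphism from `B` to the dilatation algebra given by the projection to `X`. -/
def prDil (hC : prodAlg K ξ ≤ C) : B →+* DilRing ξ C r :=
  (Algebra.TensorProduct.includeRight : B →ₐ[k] K ⊗[k] B).toRingHom.codRestrict
    (dilatation ξ C r) (one_tmul_mem hC)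

lemma incl_prDil (hC : prodAlg K ξ ≤ C) (b : B) :
    DilRing.incl ξ C r (prDil r hC b) = (1 : K) ⊗ₜ[k] b := rfl

/-- The homomorphism `B → O_κ` given by the projection of the dilatation to `X`. -/
def prHom (hC : prodAlg K ξ ≤ C) : B →+* DilLocRing κ :=
  (algebraMap (DilRing ξ C r) (DilLocRing κ)).comp (prDil r hC)

lemma prHom_sub_mem (hC : prodAlg K ξ ≤ C) (hκ : κ ∈ fibreOverD ξ C r) (b : B) :
    prHom κ hC b - algebraMap (DilRing ξ C r) (DilLocRing κ) (algebraMap R _ (ξ b)) ∈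
      IsLocalRing.maximalIdeal (DilLocRing κ) := by
  obtain ⟨ϖ, hϖ⟩ := (IsDiscreteValuationRing.maximalIdeal R).intValuation_exists_uniformizer
  have hmem : ϖ ∈ IsLocalRing.maximalIdeal R :=
    ((IsDiscreteValuationRing.maximalIdeal R).intValuation_lt_one_iff_mem ϖ).1 (by
      rw [hϖ]; exact WithZero.exp_lt_exp.2 (by norm_num))
  have hval : val R K (algebraMap R K ϖ) = WithZero.exp (-1 : ℤ) := by
    rw [IsDedekindDomain.HeightOneSpectrum.valuation_of_algebraMap, hϖ]
  have hne : algebraMap R K ϖ ≠ 0 := by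
    intro h
    rw [h, map_zero] at hval
    exact WithZero.exp_ne_zero hval.symm
  obtain ⟨w, hw⟩ := DilRing.exists_incl_eq ξ C r (conormalTwist_subset ξ C r
    ⟨(algebraMap R K ϖ ^ r)⁻¹, by
      rw [map_inv₀, map_pow, hval, ← WithZero.exp_nsmul, ← WithZero.exp_neg]; simp,
      (1 : K) ⊗ₜ[k] b - algebraMap R _ (ξ b),
      sub_mem (hC (Algebra.subset_adjoin ⟨b, rfl⟩)) (C.algebraMap_mem _), by
      rw [map_sub, IsScalarTower.algebraMap_apply R K (K ⊗[k] B), AlgHom.commutes]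
      simp [graphHom], rfl⟩)
  have key : prDil r hC b - algebraMap R _ (ξ b) = algebraMap R _ (ϖ ^ r) * w := by
    apply DilRing.incl_injective
    rw [map_sub, incl_prDil, AlgHom.commutes, map_mul, AlgHom.commutes, hw,
      IsScalarTower.algebraMap_apply R K (K ⊗[k] B) (ϖ ^ r), ← Algebra.smul_def, smul_smul,
      map_pow, mul_inv_cancel₀ (pow_ne_zero _ hne), one_smul]
  have : prDil r hC b - algebraMap R _ (ξ b) ∈ κ.asIdeal := by
    rw [key]
    exact Ideal.mul_mem_right _ _ (hκ _ (Ideal.pow_mem_pow hmem r))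
  rw [prHom, RingHom.comp_apply, ← map_sub]
  exact (IsLocalization.AtPrime.to_map_mem_maximal_iff (DilLocRing κ) κ.asIdeal _).2 this

lemma algebraMap_mem_iff (hκ : κ ∈ fibreOverD ξ C r) (a : R) :
    algebraMap (DilRing ξ C r) (DilLocRing κ) (algebraMap R _ a) ∈
      IsLocalRing.maximalIdeal (DilLocRing κ) ↔ a ∈ IsLocalRing.maximalIdeal R := by
  rw [IsLocalization.AtPrime.to_map_mem_maximal_iff (DilLocRing κ) κ.asIdeal]
  constructor
  · intro h
    rw [IsLocalRing.mem_maximalIdeal, mem_nonunits_iff]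
    intro hu
    exact κ.isPrime.ne_top (Ideal.eq_top_of_isUnit_mem _ h (hu.map _))
  · intro h
    refine κ.isPrime.mem_of_pow_mem r ?_
    rw [← map_pow]
    exact hκ _ (Ideal.pow_mem_pow h r)

lemma prHom_mem_iff (hC : prodAlg K ξ ≤ C) (hκ : κ ∈ fibreOverD ξ C r) (b : B) :
    prHom κ hC b ∈ IsLocalRing.maximalIdeal (DilLocRing κ) ↔ b ∈ centre ξ := by
  have h := prHom_sub_mem κ hC hκ b
  rw [centre, Ideal.mem_comap, RingHom.coe_coe, ← algebraMap_mem_iff κ hκ]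
  constructor
  · intro h1
    simpa using Ideal.sub_mem _ h1 h
  · intro h1
    simpa using Ideal.add_mem _ h h1

/-- The homomorphism `A → O_κ` given by the projection of the dilatation to `X`, which
maps `κ` to `x`. -/
def prLocHom (hC : prodAlg K ξ ≤ C) (hκ : κ ∈ fibreOverD ξ C r) :
    LocRing ξ →+* DilLocRing κ :=
  IsLocalization.lift (M := (centre ξ).primeCompl) (g := prHom κ hC) (fun y => by
    by_contra h
    exact y.2 ((prHom_mem_iff κ hC hκ _).1 ((IsLocalRing.mem_maximalIdeal _).2 h)))

lemma maximalIdeal_le_comap_prLocHom (hC : prodAlg K ξ ≤ C) (hκ : κ ∈ fibreOverD ξ C r) :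
    IsLocalRing.maximalIdeal (LocRing ξ) ≤
      (IsLocalRing.maximalIdeal (DilLocRing κ)).comap (prLocHom κ hC hκ) := by
  rw [← Localization.AtPrime.map_eq_maximalIdeal, Ideal.map_le_iff_le_comap]
  intro b hb
  simp only [Ideal.mem_comap, prLocHom, IsLocalization.lift_eq]
  exact (prHom_mem_iff κ hC hκ b).2 hb

/-- The composite `R → R / 𝔪^n ≅ A / 𝔪_A^n → O_κ / 𝔪_κ^n`. -/
def vLevel (hξ : InducesIsoOnCompletions ξ) (hC : prodAlg K ξ ≤ C) (hκ : κ ∈ fibreOverD ξ C r)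
    (n : ℕ) : R →+* DilLocRing κ ⧸ IsLocalRing.maximalIdeal (DilLocRing κ) ^ n :=
  (Ideal.quotientMap _ (prLocHom κ hC hκ)
      (pow_le_comap (maximalIdeal_le_comap_prLocHom κ hC hκ) n)).comp
    (((RingEquiv.ofBijective _ (hξ n)).symm : _ →+* _).comp
      (Ideal.Quotient.mk (IsLocalRing.maximalIdeal R ^ n)))

lemma factorPow_comp_vLevel (hξ : InducesIsoOnCompletions ξ) (hC : prodAlg K ξ ≤ C)
    (hκ : κ ∈ fibreOverD ξ C r) {m n : ℕ} (h : m ≤ n) :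
    (Ideal.Quotient.factorPow (IsLocalRing.maximalIdeal (DilLocRing κ)) h).comp
      (vLevel κ hξ hC hκ n) = vLevel κ hξ hC hκ m := by
  have key : ∀ (l : ℕ) (α : LocRing ξ) (a : R),
      locHom ξ α - a ∈ IsLocalRing.maximalIdeal R ^ l →
      vLevel κ hξ hC hκ l a = Ideal.Quotient.mk _ (prLocHom κ hC hκ α) := by
    intro l α a hl
    have h1 : (RingEquiv.ofBijective _ (hξ l)).symm (Ideal.Quotient.mk _ a) =
        Ideal.Quotient.mk _ α := by
      rw [RingEquiv.symm_apply_eq]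
      exact (Ideal.Quotient.eq.2 hl).symm
    simp only [vLevel, RingHom.comp_apply, RingHom.coe_coe]
    rw [h1, Ideal.quotientMap_mk]
  ext a
  obtain ⟨α', hα⟩ := (hξ n).2 (Ideal.Quotient.mk _ a)
  obtain ⟨α, rfl⟩ := Ideal.Quotient.mk_surjective α'
  have hα' : locHom ξ α - a ∈ IsLocalRing.maximalIdeal R ^ n := Ideal.Quotient.eq.1 hα
  rw [RingHom.comp_apply, key n α a hα', key m α a (Ideal.pow_le_pow_right h hα')]
  rfl

/-- The homomorphism `v : R → R_𝕂` given by the projection of the dilatation to `X`: it is the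
homomorphism from `R`, identified by `ξ` with the completion of `A`, to `R_𝕂` induced on
completions by `A → O_κ`. -/
def vHom (hξ : InducesIsoOnCompletions ξ) (hC : prodAlg K ξ ≤ C) (hκ : κ ∈ fibreOverD ξ C r) :
    R →+* RKK κ :=
  AdicCompletion.liftRingHom _ (vLevel κ hξ hC hκ) (factorPow_comp_vLevel κ hξ hC hκ)

/-- The map `K ⊗_k B → Ω¹_K`, `c ⊗ b ↦ c d(ξ(b))`. It identifies the conormal module `I / I²` of
the graph of `ξ` in `X ×_k S` (resp. in `X ×_k^log S`) with `Ω¹_R` (resp. with `Ω¹_R(log)`). -/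
def conormalToOmega (ξ : B →ₐ[k] R) : K ⊗[k] B →ₗ[K] Ω[K⁄k] :=
  LinearMap.liftBaseChange K ((KaehlerDifferential.D k K).toLinearMap ∘ₗ
    (IsScalarTower.toAlgHom k R K).toLinearMap ∘ₗ ξ.toLinearMap)

/-- The value at a class `c ∈ Ω¹_K / N` of the homomorphism `t_n` to the residue field of `κ`.
The modular interpretation of `T_D` (resp. `Θ_D`) as the vector bundle of `(I / I²) ⊗ O_D(D)`, `I`
the ideal of the graph, attaches to `κ` the map sending `z ∈ 𝔪^{-r} I` to its value at `κ`;
so `t_n` sends the class of the differential form attached to `z` to the value of `z` at `κ`. -/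
def tMap (N : Submodule R Ω[K⁄k]) (c : Ω[K⁄k] ⧸ N) : IsLocalRing.ResidueField (DilLocRing κ) :=
  Classical.epsilon fun e => ∃ z : DilRing ξ C r, DilRing.incl ξ C r z ∈ conormalTwist ξ C r ∧
    Submodule.Quotient.mk (conormalToOmega ξ (DilRing.incl ξ C r z)) = c ∧
    e = IsLocalRing.residue _ (algebraMap (DilRing ξ C r) (DilLocRing κ) z)

end LocalField

end Dilatation

end Ramif

end

/-!
Write the character as `χ = ψ + δ(x)`, with `ψ` tame and `x` a Witt vector realizing the (modified)
Swan conductor, so that the refined conductor is the class of `-F^m d(x)`. The two homomorphisms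
`u` and `v` agree up to factors in `1 + 𝔪_𝕂`. These are `n'`-th powers by Hensel's lemma, so Kummer
theory shows that `ψ` does not contribute to `v^* χ - u^* χ` (`pullback_eq_pullback_of_tame`).
The contribution of `δ(x)` is the Artin-Schreier-Witt class of `v(x) - u(x)`.

Consider a component `y = x_i` and put `q = p ^ (m - i)`. If `v(y) / u(y) = 1 + u(π)^b ε`, where
`y ^ q` has a pole of order at most `b`, then `[v(y)] - [u(y)]` has integral components which vanish
modulo `𝔪_𝕂` up to the last one, whose residue is that of `u(y)^q u(π)^b ε`
(`hasTopResidue_of_isOneUnit`). The last component is the only one to survive since the components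
of `[1 + ε] - [1]` are congruent to `ε` modulo `ε²`. Summing over `i`, the Witt vector `v(x) - u(x)`
reduces to `V^m [e]` modulo `𝔪_𝕂`, and since `F - 1` is surjective on Witt vectors over `𝔪_𝕂`, its
class is the image under `V^m` of the Artin-Schreier class of any lift of `e`
(`HasTopResidue.exists_frobenius_sub`, `pullback_sub_pullback_of_isWittClass`).

The residue of `ε` is the value at the generic point `κ` of the element of `𝔪^{-b} I` whose
differential form is `π^{-b} d log y` (`LogCompatible`). Therefore `e` is a value of the map `t` at
the class of `F^m d(x)`. The remaining case is that of a component whose pole exceeds by one the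
modified conductor; then `p` divides the valuation of `y`, and the contribution of `π` to
`v(y) / u(y)` is a `p`-th power, hence of higher order (`exists_logCompatible_of_dvd`).

It remains to see that `t` is well defined: an element of `𝔪^{-r} I` whose differential form has
a smaller pole vanishes at `κ` (`resDil_eq_zero_of_mem_filOmegaMod`,
`resDil_eq_zero_of_mem_filOmega`). The values at `κ` factor through the projective module
`R ⊗ Ω¹_B`, in which an element is tested by derivations from `B` to `R`. Such a derivation extends
by continuity to the completion `R`, hence to a linear form on `Ω¹_K`
(`IsDerivationAlong.exists_linearMap`), and this linear form is compatible with the filtration by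
the order of the pole. In the logarithmic case one only has the derivations which preserve `𝔪`, and
one uses in addition that `dπ` is part of a basis, because the residue field is formally smooth
over `k`.
-/

noncomputable section

namespace Ramif


/-! ### Witt vectors with prescribed residues -/

section WittComputations

open WittVector

variable {p : ℕ} [Fact p.Prime]

lemma truncate_eq_truncate_iff {S : Type*} [CommRing S] {n : ℕ} {x y : WittVector p S} :
    truncate n x = truncate n y ↔ ∀ i < n, x.coeff i = y.coeff i := by
  constructor
  · intro h i hi
    have := congrArg (TruncatedWittVector.coeff ⟨i, hi⟩) h
    simpa using this
  · intro h
    ext i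
    simpa using h i i.2

lemma eq_teichmuller_add_verschiebung {S : Type*} [CommRing S] (x : WittVector p S) :
    x = teichmuller p (x.coeff 0) + verschiebung (WittVector.mk p fun i => x.coeff (i + 1)) := by
  ext n
  rw [coeff_add_of_disjoint]
  · cases n with
    | zero => simp
    | succ n => simp [teichmuller_coeff_pos]
  · intro n
    cases n with
    | zero => right; simp
    | succ n => left; simp [teichmuller_coeff_pos]

lemma exists_eq_verschiebung {S : Type*} [CommRing S] {x : WittVector p S}
    (h : x.coeff 0 = 0) : ∃ y, x = verschiebung y ∧ ∀ i, y.coeff i = x.coeff (i + 1) := by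
  refine ⟨WittVector.mk p fun i => x.coeff (i + 1), ?_, fun i => rfl⟩
  conv_lhs => rw [eq_teichmuller_add_verschiebung x, h]
  simp

lemma sub_coeff_zero {S : Type*} [CommRing S] (x y : WittVector p S) :
    (x - y).coeff 0 = x.coeff 0 - y.coeff 0 :=
  map_sub (constantCoeff : WittVector p S →+* S) x y

lemma frobenius_teichmuller {S : Type*} [CommRing S] [CharP S p] (t : S) :
    frobenius (teichmuller p t) = teichmuller p (t ^ p) := by
  ext n
  rw [coeff_frobenius_charP]
  cases n with
  | zero => rw [teichmuller_coeff_zero, teichmuller_coeff_zero]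
  | succ n =>
    rw [teichmuller_coeff_pos _ _ _ n.succ_pos, teichmuller_coeff_pos _ _ _ n.succ_pos,
      zero_pow (Fact.out : p.Prime).ne_zero]

/-- Multiplication by a Teichmüller representative, componentwise. -/
lemma coeff_teichmuller_mul {S : Type*} [CommRing S] [CharP S p] (j : ℕ) (t : S)
    (w : WittVector p S) : (teichmuller p t * w).coeff j = t ^ p ^ j * w.coeff j := by
  induction j generalizing t w with
  | zero => simp [mul_coeff_zero]
  | succ j ih =>
    have h : teichmuller p t * w = teichmuller p (t * w.coeff 0) +
        verschiebung (teichmuller p (t ^ p) * WittVector.mk p fun i => w.coeff (i + 1)) := by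
      conv_lhs => rw [eq_teichmuller_add_verschiebung w]
      rw [mul_add, ← map_mul, ← frobenius_teichmuller, mul_comm (WittVector.frobenius _),
        verschiebung_mul_frobenius, mul_comm (teichmuller p t) (verschiebung _)]
    rw [h, coeff_add_of_disjoint]
    · rw [teichmuller_coeff_pos _ _ _ j.succ_pos, verschiebung_coeff_succ, ih, zero_add, ← pow_mul,
        pow_succ', WittVector.coeff_mk]
    · intro n
      cases n with
      | zero => right; simp
      | succ n => left; exact teichmuller_coeff_pos _ _ _ n.succ_pos

open Polynomial in
/-- The components of `[1 + X] - [1]` over `ℤ[X]` are congruent to `X` modulo `X²`. This is read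
off from the ghost components, whose linear terms are those of `(1 + X) ^ p ^ l - 1`. -/
lemma coeff_teichmuller_one_add_X (l : ℕ) :
    X ^ 2 ∣ (teichmuller p (1 + X : ℤ[X]) - 1).coeff l - X := by
  set w := teichmuller p (1 + X : ℤ[X]) - 1 with hw
  have h0 : ∀ i, X ∣ w.coeff i := by
    intro i
    rw [X_dvd_iff, ← Polynomial.constantCoeff_apply, ← map_coeff, hw]
    simp
  have hg : ghostComponent l w = (1 + X) ^ p ^ l - 1 := by
    rw [hw, map_sub, ghostComponent_teichmuller, map_one]
  rw [ghostComponent_apply, aeval_wittPolynomial, Finset.sum_range_succ] at hg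
  have h1 := congrArg (fun f => Polynomial.coeff f 1) hg
  have h2 : Polynomial.coeff (∑ i ∈ Finset.range l, (p : ℤ[X]) ^ i * w.coeff i ^ p ^ (l - i)) 1
      = 0 := by
    rw [finsetSum_coeff]
    refine Finset.sum_eq_zero fun i hi => ?_
    have hli : 2 ≤ p ^ (l - i) := (Fact.out : p.Prime).two_le.trans
      (Nat.le_self_pow (Nat.sub_ne_zero_of_lt (Finset.mem_range.1 hi)) p)
    have : X ^ 2 ∣ (p : ℤ[X]) ^ i * w.coeff i ^ p ^ (l - i) :=
      ((pow_dvd_pow_of_dvd (h0 i) 2).trans (pow_dvd_pow _ hli)).mul_left _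
    exact X_pow_dvd_iff.1 this 1 (by norm_num)
  simp only [coeff_add, h2, zero_add, Nat.sub_self, pow_zero, pow_one, coeff_sub] at h1
  rw [← Nat.cast_pow, ← C_eq_natCast, coeff_C_mul, coeff_one_add_X_pow, coeff_one] at h1
  have h3 : (w.coeff l).coeff 1 = 1 := by
    have hp : ((p ^ l : ℕ) : ℤ) ≠ 0 := by
      exact_mod_cast pow_ne_zero l (Fact.out : p.Prime).ne_zero
    refine mul_left_cancel₀ hp ?_
    simpa using h1
  rw [X_pow_dvd_iff]
  intro d hd
  interval_cases d
  · simpa using X_dvd_iff.1 (h0 l)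
  · simp [h3]

lemma coeff_teichmuller_one_add_sub_one {S : Type*} [CommRing S] (ε : S) (l : ℕ) :
    ∃ q, (teichmuller p (1 + ε) - 1).coeff l = ε + ε ^ 2 * q := by
  obtain ⟨q, hq⟩ := coeff_teichmuller_one_add_X (p := p) l
  refine ⟨q.eval₂ (Int.castRingHom S) ε, ?_⟩
  have h := congrArg (Polynomial.eval₂RingHom (Int.castRingHom S) ε) (sub_eq_iff_eq_add.1 hq)
  rw [← map_coeff] at h
  simpa [add_comm] using h

section TopResidue

variable {Λ 𝕂 E : Type*} [CommRing Λ] [Field 𝕂] [Field E] (ι : Λ →+* 𝕂) (res : Λ →+* E)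

/-- Up to `V^{m+1}`, the Witt vector `w` over `𝕂` has components in `Λ`, and its reduction to a
Witt vector over `E` is `V^m [e]`. -/
def HasTopResidue (m : ℕ) (w : WittVector p 𝕂) (e : E) : Prop :=
  ∃ w' : WittVector p Λ, (∀ i ≤ m, ι (w'.coeff i) = w.coeff i) ∧
    (∀ i < m, res (w'.coeff i) = 0) ∧ res (w'.coeff m) = e

variable {ι res}

lemma coeff_add_of_coeff_eq_zero {S : Type*} [CommRing S] [CharP S p] {m : ℕ}
    {x y : WittVector p S} (hx : ∀ i < m, x.coeff i = 0) (hy : ∀ i < m, y.coeff i = 0) :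
    (∀ i < m, (x + y).coeff i = 0) ∧ (x + y).coeff m = x.coeff m + y.coeff m := by
  have key : x + y = verschiebung^[m] (x.shift m + y.shift m) := by
    conv_lhs => rw [eq_iterate_verschiebung hx, eq_iterate_verschiebung hy]
    rw [← iterate_map_add]
  rw [key]
  constructor
  · intro i hi
    exact iterate_verschiebung_coeff_eq_zero _ hi
  · have := iterate_verschiebung_coeff (x.shift m + y.shift m) m 0
    rw [zero_add] at this
    rw [this]
    simp [add_coeff_zero, shift_coeff]

lemma HasTopResidue.add [CharP E p] {m : ℕ} {w₁ w₂ : WittVector p 𝕂} {e₁ e₂ : E}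
    (h₁ : HasTopResidue ι res m w₁ e₁) (h₂ : HasTopResidue ι res m w₂ e₂) :
    HasTopResidue ι res m (w₁ + w₂) (e₁ + e₂) := by
  obtain ⟨v₁, a₁, b₁, c₁⟩ := h₁
  obtain ⟨v₂, a₂, b₂, c₂⟩ := h₂
  have h := coeff_add_of_coeff_eq_zero (p := p) (m := m) (x := map res v₁) (y := map res v₂)
    (by simpa using b₁) (by simpa using b₂)
  simp only [← map_add, map_coeff] at h
  refine ⟨v₁ + v₂, ?_, h.1, by rw [h.2, map_add, c₁, c₂]⟩
  have ht : truncate (m + 1) (map ι (v₁ + v₂)) = truncate (m + 1) (w₁ + w₂) := by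
    simp only [map_add]
    congr 1
    · exact truncate_eq_truncate_iff.2 fun i hi => by simpa using a₁ i (Nat.lt_succ_iff.1 hi)
    · exact truncate_eq_truncate_iff.2 fun i hi => by simpa using a₂ i (Nat.lt_succ_iff.1 hi)
  intro i hi
  rw [← map_coeff]
  exact truncate_eq_truncate_iff.1 ht i (Nat.lt_succ_of_le hi)

lemma HasTopResidue.verschiebung {m : ℕ} {w : WittVector p 𝕂} {e : E}
    (h : HasTopResidue ι res m w e) : HasTopResidue ι res (m + 1) (verschiebung w) e := by
  obtain ⟨v, a, b, c⟩ := h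
  refine ⟨WittVector.verschiebung v, ?_, ?_, by simpa using c⟩
  · intro i hi
    cases i with
    | zero => simp
    | succ i => simpa using a i (by omega)
  · intro i hi
    cases i with
    | zero => simp
    | succ i => simpa using b i (by omega)

/-- The difference of the Teichmüller representatives of `f (1 + ε)` and `f`, when `ε` is small
enough compared with the pole of `f`. The multiplier `c` bounds `ε`, and kills the poles of the
`f ^ p ^ j`. -/
lemma hasTopResidue_teichmuller_sub [CharP 𝕂 p] {l : ℕ} {f f' : 𝕂} {c ε g : Λ}
    (hf' : f' = f * (1 + ι (c * ε))) (hc : res c = 0)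
    (hlow : ∀ j < l, ∃ h : Λ, res h = 0 ∧ f ^ p ^ j * ι c = ι h)
    (htop : f ^ p ^ l * ι c = ι g) :
    HasTopResidue ι res l (teichmuller p f' - teichmuller p f) (res (g * ε)) := by
  choose! h hh0 hh using hlow
  choose q hq using fun j => coeff_teichmuller_one_add_sub_one (p := p) (c * ε) j
  have hco : ∀ j, (teichmuller p f' - teichmuller p f).coeff j =
      f ^ p ^ j * ι c * ι (ε * (1 + c * ε * q j)) := by
    intro j
    have h1 : teichmuller p f' - teichmuller p f =
        teichmuller p f * map ι (teichmuller p (1 + c * ε) - 1) := by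
      rw [hf', map_mul, map_sub, map_teichmuller, map_one, mul_sub, mul_one, map_add ι, map_one ι]
    rw [h1, coeff_teichmuller_mul, map_coeff, hq, mul_assoc, ← map_mul]
    congr 2
    ring
  refine ⟨WittVector.mk p fun j => (if j = l then g else h j) * (ε * (1 + c * ε * q j)), ?_, ?_, ?_⟩
  · intro i hi
    rw [hco]
    by_cases hil : i = l
    · subst hil
      simp [htop]
    · simp [hil, hh i (lt_of_le_of_ne hi hil)]
  · intro i hi
    simp [hi.ne, hh0 i hi]
  · simp [hc]

/-- The Witt vector version of a lifting property for Artin-Schreier equations: if `y ^ p - y = w`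
can be solved in the kernel of `res`, then so can `F y - y = w` for Witt vectors, up to
`V^{m+1}`. -/
lemma exists_frobenius_sub_eq [CharP Λ p] [CharP E p]
    (hAS : ∀ w : Λ, res w = 0 → ∃ y, res y = 0 ∧ y ^ p - y = w)
    (m : ℕ) (w : WittVector p Λ) (hw : ∀ i ≤ m, res (w.coeff i) = 0) :
    ∃ y : WittVector p Λ, ∀ i ≤ m, (frobenius y - y).coeff i = w.coeff i := by
  induction m generalizing w with
  | zero =>
    obtain ⟨y, -, hy⟩ := hAS _ (hw 0 le_rfl)
    refine ⟨teichmuller p y, fun i hi => ?_⟩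
    obtain rfl : i = 0 := by omega
    rw [sub_coeff_zero, coeff_frobenius_charP, teichmuller_coeff_zero, hy]
  | succ m ih =>
    obtain ⟨y₀, hy₀, hy⟩ := hAS _ (hw 0 (by omega))
    set z := w - (frobenius (teichmuller p y₀) - teichmuller p y₀) with hz
    have hz0 : z.coeff 0 = 0 := by
      rw [hz, sub_coeff_zero, sub_coeff_zero, coeff_frobenius_charP, teichmuller_coeff_zero, hy,
        sub_self]
    obtain ⟨z', hz', hzc⟩ := exists_eq_verschiebung hz0
    have hmap : map res z = map res w := by
      rw [hz, map_sub, map_sub, frobenius_teichmuller, map_teichmuller, map_teichmuller, map_pow,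
        hy₀, zero_pow (Fact.out : p.Prime).ne_zero]
      simp
    obtain ⟨y', hy'⟩ := ih z' (fun i hi => by
      rw [hzc, ← map_coeff, hmap, map_coeff]
      exact hw _ (by omega))
    refine ⟨teichmuller p y₀ + verschiebung y', ?_⟩
    have hFV : frobenius (verschiebung y') = verschiebung (frobenius y') :=
      (verschiebung_frobenius_comm y').symm
    have h1 : frobenius (teichmuller p y₀ + verschiebung y') -
        (teichmuller p y₀ + verschiebung y') =
        (frobenius (teichmuller p y₀) - teichmuller p y₀) +
          verschiebung (frobenius y' - y') := by
      rw [map_add, hFV, map_sub]; ring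
    have h2 : w = (frobenius (teichmuller p y₀) - teichmuller p y₀) + verschiebung z' := by
      rw [← hz', hz]; ring
    have ht : truncate (m + 2) (verschiebung (frobenius y' - y')) =
        truncate (m + 2) (verschiebung z') := by
      refine truncate_eq_truncate_iff.2 fun i hi => ?_
      cases i with
      | zero => rw [verschiebung_coeff_zero, verschiebung_coeff_zero]
      | succ i => simpa only [verschiebung_coeff_succ] using hy' i (by omega)
    intro i hi
    refine (truncate_eq_truncate_iff (n := m + 2)).1 ?_ i (by omega)
    rw [h1, map_add, ht, ← map_add, ← h2]

/-- If the reduction of `w` is `V^m [res a]`, then `w` and `V^m [a]` differ by `F y - y` for a Witt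
vector `y` over `Λ`, up to `V^{m+1}`. -/
lemma HasTopResidue.exists_frobenius_sub [CharP Λ p] [CharP E p] [CharP 𝕂 p]
    (hAS : ∀ w : Λ, res w = 0 → ∃ y, res y = 0 ∧ y ^ p - y = w) {m : ℕ} {w : WittVector p 𝕂}
    {a : Λ} (h : HasTopResidue ι res m w (res a)) :
    ∃ y : WittVector p Λ, truncate (m + 1) w = truncate (m + 1)
      (WittVector.verschiebung^[m] (teichmuller p (ι a)) +
        (frobenius (map ι y) - map ι y)) := by
  obtain ⟨w', h1, h2, h3⟩ := h
  have hV : map res (WittVector.verschiebung^[m] (teichmuller p a)) =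
      WittVector.verschiebung^[m] (teichmuller p (res a)) := by
    rw [← map_teichmuller]
    exact Function.Semiconj.iterate_right (f := map res) (fun x => map_verschiebung res x) m _
  have hVι : map ι (WittVector.verschiebung^[m] (teichmuller p a)) =
      WittVector.verschiebung^[m] (teichmuller p (ι a)) := by
    rw [← map_teichmuller]
    exact Function.Semiconj.iterate_right (f := map ι) (fun x => map_verschiebung ι x) m _
  obtain ⟨y, hy⟩ := exists_frobenius_sub_eq hAS m
    (w' - WittVector.verschiebung^[m] (teichmuller p a)) (by
      have : truncate (m + 1) (map res w') =
          truncate (m + 1) (WittVector.verschiebung^[m] (teichmuller p (res a))) := by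
        refine truncate_eq_truncate_iff.2 fun i hi => ?_
        rw [map_coeff]
        rcases Nat.lt_or_ge i m with him | him
        · rw [h2 i him, iterate_verschiebung_coeff_eq_zero _ him]
        · obtain rfl : i = m := by omega
          have := iterate_verschiebung_coeff (teichmuller p (res a)) i 0
          rw [zero_add] at this
          rw [h3, this, teichmuller_coeff_zero]
      intro i hi
      rw [← map_coeff, map_sub, hV]
      have h0 : truncate (m + 1) (map res w' -
          WittVector.verschiebung^[m] (teichmuller p (res a))) = truncate (m + 1) 0 := by
        rw [map_sub, this, sub_self, map_zero]
      simpa using truncate_eq_truncate_iff.1 h0 i (by omega))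
  refine ⟨y, ?_⟩
  have hw : truncate (m + 1) w = truncate (m + 1) (map ι w') :=
    truncate_eq_truncate_iff.2 fun i hi => by simpa using (h1 i (by omega)).symm
  have hy' : truncate (m + 1) (frobenius (map ι y) - map ι y) = truncate (m + 1)
      (map ι (w' - WittVector.verschiebung^[m] (teichmuller p a))) := by
    refine truncate_eq_truncate_iff.2 fun i hi => ?_
    have hF : frobenius (map ι y) = map ι (frobenius y) := by
      ext n; simp [coeff_frobenius_charP]
    rw [hF, ← map_sub, map_coeff, map_coeff, hy i (by omega)]
  rw [hw, map_add, hy', ← map_add, map_sub, hVι]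
  congr 1
  ring

/-- Summation over the components: the difference of the images of a Witt vector under two
homomorphisms `u`, `v`. -/
lemma hasTopResidue_map_sub_map [CharP E p] {K : Type*} [Field K] (u v : K →+* 𝕂) (m : ℕ)
    (x : WittVector p K) (e : ℕ → E)
    (h : ∀ i ≤ m, HasTopResidue ι res (m - i)
      (teichmuller p (v (x.coeff i)) - teichmuller p (u (x.coeff i))) (e i)) :
    HasTopResidue ι res m (map v x - map u x) (∑ i ∈ Finset.range (m + 1), e i) := by
  induction m generalizing x e with
  | zero =>
    obtain ⟨w', h1, h2, h3⟩ := h 0 le_rfl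
    refine ⟨w', ?_, by simp, by simpa using h3⟩
    intro i hi
    obtain rfl : i = 0 := by omega
    rw [h1 0 le_rfl, sub_coeff_zero, sub_coeff_zero]
    simp
  | succ m ih =>
    have := ih (WittVector.mk p fun i => x.coeff (i + 1)) (fun i => e (i + 1)) (fun i hi => by
      simpa using h (i + 1) (by omega))
    have key : map v x - map u x = (teichmuller p (v (x.coeff 0)) - teichmuller p (u (x.coeff 0)))
        + WittVector.verschiebung (map v (WittVector.mk p fun i => x.coeff (i + 1)) -
          map u (WittVector.mk p fun i => x.coeff (i + 1))) := by
      conv_lhs => rw [eq_teichmuller_add_verschiebung x]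
      simp only [map_add, map_teichmuller, map_verschiebung, map_sub]
      ring
    rw [key, Finset.sum_range_succ', add_comm (teichmuller p _ - _)]
    exact (this.verschiebung).add (by simpa using h 0 (by omega))

end TopResidue

end WittComputations


/-! ### Valuations and the filtrations of Witt vectors -/

section Filtration

variable {R K : Type*} [CommRing R] [IsDomain R] [IsDiscreteValuationRing R] [Field K]
  [Algebra R K] [IsFractionRing R K]

lemma val_uniformizer {ϖ : R} (hϖ : Irreducible ϖ) :
    val R K (algebraMap R K ϖ) = WithZero.exp (-1 : ℤ) := by
  rw [IsDedekindDomain.HeightOneSpectrum.valuation_of_algebraMap]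
  exact (IsDiscreteValuationRing.maximalIdeal R).intValuation_singleton hϖ.ne_zero
    hϖ.maximalIdeal_eq

lemma val_unit (g : Rˣ) : val R K (algebraMap R K g) = 1 := by
  rw [IsDedekindDomain.HeightOneSpectrum.valuation_eq_one_iff_notMem]
  intro h
  exact (IsLocalRing.mem_maximalIdeal _).1 h g.isUnit

lemma val_zpow_mul_unit {ϖ : R} (hϖ : Irreducible ϖ) (j : ℤ) (g : Rˣ) :
    val R K (algebraMap R K ϖ ^ j * algebraMap R K g) = WithZero.exp (-j) := by
  rw [map_mul, val_unit, mul_one, map_zpow₀, val_uniformizer hϖ, ← WithZero.exp_zsmul]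
  simp

lemma exists_eq_zpow_mul_unit {ϖ : R} (hϖ : Irreducible ϖ) {x : K} (hx : x ≠ 0) :
    ∃ (j : ℤ) (g : Rˣ), x = algebraMap R K ϖ ^ j * algebraMap R K g := by
  obtain ⟨j, g, h⟩ := IsDiscreteValuationRing.exists_units_eq_smul_zpow_of_irreducible (K := K) hϖ hx
  exact ⟨j, g, by rw [h, Units.smul_def, Algebra.smul_def, mul_comm]⟩

lemma val_le_one_iff {x : K} : val R K x ≤ 1 ↔ ∃ a : R, algebraMap R K a = x :=
  ⟨fun h => IsDiscreteValuationRing.exists_lift_of_le_one h, fun ⟨a, h⟩ =>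
    h ▸ IsDedekindDomain.HeightOneSpectrum.valuation_le_one _ a⟩

lemma val_le_exp_iff {ϖ : R} (hϖ : Irreducible ϖ) {x : K} (n : ℕ) :
    val R K x ≤ WithZero.exp (n : ℤ) ↔ ∃ a : R, algebraMap R K a = algebraMap R K ϖ ^ n * x := by
  rw [← val_le_one_iff, map_mul, map_pow, val_uniformizer hϖ, ← WithZero.exp_nsmul]
  have : (1 : ℤᵐ⁰) = WithZero.exp (n • (-1 : ℤ)) * WithZero.exp (n : ℤ) := by
    rw [← WithZero.exp_add]; simp
  rw [this]
  exact (mul_le_mul_iff_right₀ (WithZero.exp_pos)).symm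

lemma filW_mono {p m : ℕ} {n n' : ℤ} (h : n ≤ n') : filW R K p m n ⊆ filW R K p m n' :=
  fun _ hx i => (hx i).trans (WithZero.exp_le_exp.2 h)

open WittVector

variable {p : ℕ} [Fact p.Prime]

/-- A Witt vector over `K` has integral components in the image of `W(R)`. -/
lemma exists_map_eq {x : WittVector p K} (h : ∀ i, val R K (x.coeff i) ≤ 1) :
    ∃ y : WittVector p R, map (algebraMap R K) y = x := by
  choose a ha using fun i => val_le_one_iff.1 (h i)
  exact ⟨WittVector.mk p a, by ext i; simp [ha]⟩

/-- Membership in `fil_n` is integrality of `[ϖ^n] F^m x`. -/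
lemma val_coeff_pow_le_iff [CharP K p] {ϖ : R} (hϖ : Irreducible ϖ) (m n i : ℕ) (hi : i ≤ m)
    (x : WittVector p K) :
    val R K (x.coeff i) ^ p ^ (m - i) ≤ WithZero.exp (n : ℤ) ↔
      val R K ((teichmuller p (algebraMap R K ϖ ^ n) *
        WittVector.frobenius^[m] x).coeff i) ≤ 1 := by
  rw [coeff_teichmuller_mul, iterate_frobenius_coeff, map_mul, map_pow, map_pow, map_pow,
    val_uniformizer hϖ, ← WithZero.exp_nsmul, ← WithZero.exp_nsmul]
  have hp : p ^ m = p ^ (m - i) * p ^ i := by rw [← pow_add, Nat.sub_add_cancel hi]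
  rcases eq_or_ne (x.coeff i) 0 with h0 | h0
  · simp [h0, (Fact.out : p.Prime).ne_zero]
  obtain ⟨j, g, hj⟩ := exists_eq_zpow_mul_unit hϖ h0
  have hppos : (0 : ℤ) < (p : ℤ) ^ i := by
    exact_mod_cast pow_pos (Fact.out : p.Prime).pos i
  rw [hj, val_zpow_mul_unit hϖ, ← WithZero.exp_nsmul, ← WithZero.exp_nsmul, ← WithZero.exp_add,
    ← WithZero.exp_zero, WithZero.exp_le_exp, WithZero.exp_le_exp, hp]
  simp only [smul_neg, nsmul_eq_mul, mul_one]
  push_cast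
  constructor
  · intro h
    nlinarith
  · intro h
    have : (p : ℤ) ^ i * (-((p : ℤ) ^ (m - i) * j)) ≤ (p : ℤ) ^ i * n := by nlinarith
    exact le_of_mul_le_mul_left this hppos

lemma filW_add [CharP K p] {m n : ℕ} {x y : TruncatedWittVector p (m + 1) K}
    (hx : x ∈ filW R K p m n) (hy : y ∈ filW R K p m n) : x + y ∈ filW R K p m n := by
  obtain ⟨ϖ, hϖ⟩ := IsDiscreteValuationRing.exists_irreducible R
  have key : ∀ z : TruncatedWittVector p (m + 1) K, z ∈ filW R K p m n →
      ∃ w : WittVector p R, map (algebraMap R K) w =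
        teichmuller p (algebraMap R K ϖ ^ n) * WittVector.frobenius^[m] z.out := by
    intro z hz
    refine exists_map_eq fun i => ?_
    rcases Nat.lt_or_ge m i with him | him
    · have : z.out.coeff i = 0 := dif_neg (by omega)
      rw [coeff_teichmuller_mul, iterate_frobenius_coeff, this,
        zero_pow (pow_ne_zero _ (Fact.out : p.Prime).ne_zero)]
      simp
    · rw [← val_coeff_pow_le_iff hϖ m n i him]
      have := hz ⟨i, by omega⟩
      rwa [← TruncatedWittVector.coeff_out] at this
  obtain ⟨a, ha⟩ := key x hx
  obtain ⟨b, hb⟩ := key y hy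
  intro i
  have hxy : x + y = truncate (m + 1) (x.out + y.out) := by
    rw [map_add]
    congr 1
    · exact (TruncatedWittVector.truncateFun_out x).symm
    · exact (TruncatedWittVector.truncateFun_out y).symm
  rw [hxy, coeff_truncate, val_coeff_pow_le_iff hϖ m n i (by omega), iterate_map_add, mul_add,
    ← ha, ← hb, ← map_add, map_coeff]
  exact val_le_one_iff.2 ⟨_, rfl⟩

/-- The components of an element of `fil'_n`. -/
lemma val_coeff_of_mem_filWMod [CharP K p] {m n : ℕ} {x : TruncatedWittVector p (m + 1) K}
    (hx : x ∈ filWMod R K p m n) (i : Fin (m + 1)) :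
    val R K (x.coeff i) ^ p ^ (m - (i : ℕ)) ≤ WithZero.exp (n : ℤ) ∨
      (val R K (x.coeff i) ^ p ^ (m - (i : ℕ)) ≤ WithZero.exp (n + 1 : ℤ) ∧
        p ^ (m - (i : ℕ) + 1) ∣ n + 1) := by
  obtain ⟨y, z, hy, hz, h0, rfl⟩ := hx
  rcases Nat.lt_or_ge i (m + 1 - min (padicValNat p (n + 1)) (m + 1)) with hi | hi
  · left
    set M := m + 1 - min (padicValNat p (n + 1)) (m + 1) with hM
    have hz0 : truncate M z.out = 0 := by
      rw [← map_zero (truncate M)]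
      refine truncate_eq_truncate_iff.2 fun j hj => ?_
      have := h0 ⟨j, by omega⟩ hj
      rw [← TruncatedWittVector.coeff_out] at this
      simpa using this
    have hzy : truncate (m + 1) (z.out + y.out) = z + y := by
      rw [map_add]
      congr 1
      · exact TruncatedWittVector.truncateFun_out z
      · exact TruncatedWittVector.truncateFun_out y
    have h1 : truncate M (z.out + y.out) = truncate M y.out := by
      rw [map_add, hz0, zero_add]
    have h2 := truncate_eq_truncate_iff.1 h1 i hi
    rw [← hzy, coeff_truncate, h2, TruncatedWittVector.coeff_out]
    exact hy i
  · right
    constructor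
    · have hy' : y ∈ filW R K p m ((n + 1 : ℕ) : ℤ) := filW_mono (by push_cast; omega) hy
      have hz' : z ∈ filW R K p m ((n + 1 : ℕ) : ℤ) := by exact_mod_cast hz
      exact_mod_cast filW_add hz' hy' i
    · refine (pow_dvd_pow p ?_).trans (pow_padicValNat_dvd (p := p) (n := n + 1))
      omega

end Filtration


/-! ### Artin-Schreier and Artin-Schreier-Witt characters -/

section Characters

variable {K L : Type*} [Field K] [Field L]

lemma H1.mapCoeff_apply {M N : Type*} [AddCommGroup M] [AddCommGroup N] (g : M →+ N)
    (χ : H1 K M) (σ : Additive (GalSep K)) : (H1.mapCoeff g χ).1 σ = g (χ.1 σ) := rfl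

lemma H1.pullback_apply {M : Type*} [AddCommGroup M] (f : K →+* L) (χ : H1 K M) (σ : GalSep L) :
    (H1.pullback f χ).1 (Additive.ofMul σ) = χ.1 (Additive.ofMul (galRestrict f σ)) := rfl

lemma H1.ext_apply {M : Type*} [AddCommGroup M] {χ ψ : H1 K M}
    (h : ∀ σ : GalSep K, χ.1 (Additive.ofMul σ) = ψ.1 (Additive.ofMul σ)) : χ = ψ :=
  Subtype.ext (AddMonoidHom.ext fun σ => h σ.toMul)

lemma zmodToQZ_natCast (n j : ℕ) : zmodToQZ n (j : ZMod n) = ((j / n : ℚ) : QZ) := by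
  have : ((j : ℤ) : ZMod n) = (j : ZMod n) := by simp
  rw [← this, zmodToQZ, ZMod.lift_coe]
  simp only [zmultiplesHom_apply, natCast_zsmul]
  rw [← AddCircle.coe_nsmul, nsmul_eq_mul, mul_one_div]

lemma zmodToQZ_injective {n : ℕ} (hn : n ≠ 0) : Function.Injective (zmodToQZ n) := by
  have : NeZero n := ⟨hn⟩
  rw [injective_iff_map_eq_zero]
  intro j hj
  rw [← ZMod.natCast_zmod_val j, zmodToQZ_natCast, AddCircle.coe_eq_zero_iff] at hj
  obtain ⟨z, hz⟩ := hj
  have hn' : (n : ℚ) ≠ 0 := by exact_mod_cast hn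
  have h1 : (z : ℚ) * n = j.val := by
    rw [← (eq_div_iff hn')]
    simpa using hz
  have h2 : z * (n : ℤ) = j.val := by exact_mod_cast h1
  rw [← ZMod.natCast_zmod_val j, ZMod.natCast_eq_zero_iff]
  exact_mod_cast (Dvd.intro_left z h2 : (n : ℤ) ∣ j.val)

lemma exists_zmodToQZ_eq {n : ℕ} (hn : n ≠ 0) {q : QZ} (hq : n • q = 0) :
    ∃ j, zmodToQZ n j = q := by
  have : Fact ((0 : ℚ) < 1) := ⟨one_pos⟩
  obtain ⟨m, -, hm⟩ := (AddCircle.nsmul_eq_zero_iff (Nat.pos_of_ne_zero hn)).1 hq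
  exact ⟨m, by rw [zmodToQZ_natCast, ← hm, mul_one]⟩

lemma mulCoeff_natCast {p n : ℕ} (h : p ∣ n) (j : ℕ) :
    mulCoeff h (j : ZMod p) = ((j * (n / p) : ℕ) : ZMod n) := by
  have : ((j : ℤ) : ZMod p) = (j : ZMod p) := by simp
  rw [← this, mulCoeff, ZMod.lift_coe]
  simp [zmultiplesHom_apply]

lemma zmodToQZ_mulCoeff {p n : ℕ} (hp : p ≠ 0) (hn : n ≠ 0) (h : p ∣ n) (j : ZMod p) :
    zmodToQZ n (mulCoeff h j) = zmodToQZ p j := by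
  have : NeZero p := ⟨hp⟩
  rw [← ZMod.natCast_zmod_val j, mulCoeff_natCast, zmodToQZ_natCast, zmodToQZ_natCast]
  congr 1
  have hp' : (p : ℚ) ≠ 0 := by exact_mod_cast hp
  have hn' : (n : ℚ) ≠ 0 := by exact_mod_cast hn
  rw [Nat.cast_mul, Nat.cast_div h hp']
  field_simp

section ArtinSchreier

variable {p : ℕ} [Fact p.Prime] [CharP L p]

lemma exists_zmod_eq_of_pow_eq_self {c : L} (h : c ^ p = c) :
    ∃ j : ZMod p, ZMod.castHom dvd_rfl L j = c := by
  obtain ⟨z, hz⟩ := (mem_bot_iff_intCast p L).1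
    ((Subfield.mem_bot_iff_pow_eq_self L p).2 h)
  exact ⟨z, by simpa using hz⟩

lemma castHom_eq_natCast_val (j : ZMod p) : ZMod.castHom dvd_rfl L j = ((j.val : ℕ) : L) := by
  simp

instance charP_separableClosure : CharP (SeparableClosure L) p :=
  charP_of_injective_algebraMap (algebraMap L _).injective p

lemma exists_isArtinSchreierClass (a : L) :
    ∃ θ : H1 L (ZMod p), IsArtinSchreierClass a θ := by
  obtain ⟨y, hy⟩ := IsSepClosed.exists_root_C_mul_X_pow_add_C_mul_X_add_C
    (1 : SeparableClosure L) (-1) (-algebraMap L _ a) (CharP.cast_eq_zero _ p)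
    (Fact.out : p.Prime).two_le (by simp)
  have hy' : y ^ p - y = algebraMap L _ a := by linear_combination hy
  have hj : ∀ σ : GalSep L, ∃ j : ZMod p,
      ZMod.castHom dvd_rfl (SeparableClosure L) j = σ y - y := by
    intro σ
    apply exists_zmod_eq_of_pow_eq_self
    rw [sub_pow_char]
    have := congrArg σ hy'
    rw [map_sub, map_pow, AlgEquiv.commutes] at this
    linear_combination this - hy'
  choose j hj using hj
  have hinj : Function.Injective (ZMod.castHom (dvd_refl p) (SeparableClosure L)) :=
    RingHom.injective _
  let θ : Additive (GalSep L) →+ ZMod p :=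
    AddMonoidHom.mk' (fun σ => j σ.toMul) (fun σ τ => hinj (by
      change ZMod.castHom dvd_rfl _ (j (σ.toMul * τ.toMul)) = _
      rw [map_add, hj, hj, hj]
      have h2 := congrArg σ.toMul (hj τ.toMul)
      rw [castHom_eq_natCast_val, map_natCast, ← castHom_eq_natCast_val (L := SeparableClosure L),
        hj] at h2
      rw [AlgEquiv.mul_apply]
      rw [map_sub] at h2
      linear_combination -h2))
  refine ⟨⟨θ, ?_⟩, y, hy', fun σ => ?_⟩
  · have h1 := stabilizer_isOpen_of_isIntegral (K := L) y
    show IsOpen {σ : GalSep L | θ (Additive.ofMul σ) = 0}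
    convert h1 using 1
    ext σ
    have : j σ = 0 ↔ σ y - y = 0 := by
      rw [← hj σ, map_eq_zero_iff _ hinj]
    simpa [θ, sub_eq_zero] using this
  · rw [← castHom_eq_natCast_val]
    exact (hj σ).symm

end ArtinSchreier

section WittClasses

open WittVector

variable {p : ℕ} [Fact p.Prime]

lemma mk_coeff_eq_truncate_map {S T : Type*} [CommRing S] [CommRing T] {n : ℕ} (f : S →+* T)
    (x : TruncatedWittVector p n S) :
    TruncatedWittVector.mk p (fun i => f (x.coeff i)) = truncate n (map f x.out) := by
  ext i
  simp

lemma truncate_map_congr {S T : Type*} [CommRing S] [CommRing T] {n : ℕ} (f : S →+* T)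
    {x y : WittVector p S} (h : truncate n x = truncate n y) :
    truncate n (map f x) = truncate n (map f y) := by
  rw [truncate_eq_truncate_iff] at h ⊢
  intro i hi
  rw [map_coeff, map_coeff, h i hi]

lemma truncate_iterate_verschiebung_congr {S : Type*} [CommRing S] {m : ℕ}
    {x y : WittVector p S} (h : x.coeff 0 = y.coeff 0) :
    truncate (m + 1) (verschiebung^[m] x) = truncate (m + 1) (verschiebung^[m] y) := by
  refine truncate_eq_truncate_iff.2 fun i hi => ?_
  rcases Nat.lt_or_ge i m with him | him
  · rw [iterate_verschiebung_coeff_eq_zero _ him, iterate_verschiebung_coeff_eq_zero _ him]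
  · obtain rfl : i = m := by omega
    have h1 := iterate_verschiebung_coeff x i 0
    have h2 := iterate_verschiebung_coeff y i 0
    rw [zero_add] at h1 h2
    rw [h1, h2, h]

lemma dvd_of_truncate_intCast_eq_zero [CharP L p] {n : ℕ} {z : ℤ}
    (h : ((z : ℤ) : TruncatedWittVector p n L) = 0) : ((p ^ n : ℕ) : ℤ) ∣ z := by
  have h1 : truncate n (map (ZMod.castHom dvd_rfl L) (z : WittVector p (ZMod p))) =
      truncate n (0 : WittVector p L) := by
    rw [map_intCast, map_intCast, h, map_zero]
  rw [truncate_eq_truncate_iff] at h1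
  have h2 : ((z : ℤ) : TruncatedWittVector p n (ZMod p)) = 0 := by
    rw [← map_intCast (truncate (p := p) (R := ZMod p) n), ← map_zero (truncate n),
      truncate_eq_truncate_iff]
    intro i hi
    have := h1 i hi
    rw [map_coeff, zero_coeff] at this
    exact (ZMod.castHom dvd_rfl L).injective (by simpa using this)
  have := TruncatedWittVector.charP_zmod p n
  exact (CharP.intCast_eq_zero_iff _ (p ^ n) z).1 h2

lemma truncate_natCast_mul_pow [CharP L p] (m j : ℕ) :
    truncate (m + 1) (verschiebung^[m] (teichmuller p (j : L))) =
      ((j * p ^ m : ℕ) : TruncatedWittVector p (m + 1) L) := by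
  have h1 : truncate (m + 1) (verschiebung^[m] (teichmuller p (j : L))) =
      truncate (m + 1) (verschiebung^[m] (j : WittVector p L)) := by
    refine truncate_iterate_verschiebung_congr ?_
    rw [teichmuller_coeff_zero]
    exact (map_natCast (constantCoeff : WittVector p L →+* L) j).symm
  have h2 : WittVector.frobenius^[m] (j : WittVector p L) = j :=
    Function.iterate_fixed (map_natCast _ _) m
  have h3 := iterate_verschiebung_iterate_frobenius (j : WittVector p L) m
  rw [h2] at h3
  rw [h1, h3, ← map_natCast (truncate (m + 1))]
  push_cast
  rfl

lemma map_frobenius_charP {S T : Type*} [CommRing S] [CommRing T] [CharP S p] [CharP T p]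
    (f : S →+* T) (z : WittVector p S) :
    map f (WittVector.frobenius z) = WittVector.frobenius (map f z) := by
  refine WittVector.ext fun i => ?_
  simp [coeff_frobenius_charP]

/-- If the images of `x` under `v` and `u` differ by `V^m [a]` up to the image of `F - 1`, then the
pull-backs of the Artin-Schreier-Witt character of `x` differ by `p ^ m` times the Artin-Schreier
character of `a`. -/
lemma pullback_sub_pullback_of_isWittClass [CharP L p] {m : ℕ}
    {x : TruncatedWittVector p (m + 1) K} {θ : H1 K (ZMod (p ^ (m + 1)))} (hθ : IsWittClass x θ)
    (u v : K →+* L) (a : L) (Y : WittVector p L)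
    (h : truncate (m + 1) (map v x.out - map u x.out) = truncate (m + 1)
      (verschiebung^[m] (teichmuller p a) + (WittVector.frobenius Y - Y)))
    {η : H1 L (ZMod p)} (hη : IsArtinSchreierClass a η) :
    H1.pullback v θ - H1.pullback u θ =
      H1.mapCoeff (mulCoeff (dvd_pow_self (n := m + 1) p m.succ_ne_zero)) η := by
  obtain ⟨y, hy1, hy2⟩ := hθ
  obtain ⟨b, hb1, hb2⟩ := hη
  have hKp : CharP K p := (RingHom.charP_iff u u.injective p).2 ‹_›
  have hFr : ∀ {M : Type _} [Field M] [CharP M p] (z : TruncatedWittVector p (m + 1) M),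
      TruncatedWittVector.mk p (fun i => z.coeff i ^ p) =
        truncate (m + 1) (WittVector.frobenius z.out) := by
    intro M _ _ z
    ext i
    simp [coeff_frobenius_charP]
  have hout : ∀ {M : Type _} [Field M] (z : TruncatedWittVector p (m + 1) M),
      truncate (m + 1) z.out = z := fun z => TruncatedWittVector.truncateFun_out z
  rw [hFr, mk_coeff_eq_truncate_map] at hy1
  have hy2' : ∀ σ : GalSep K, truncate (m + 1) (map (σ : SeparableClosure K →+* _) y.out - y.out) =
      truncate (m + 1) (((θ.1 (Additive.ofMul σ)).val : ℕ) : WittVector p (SeparableClosure K)) := by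
    intro σ
    rw [map_sub, ← mk_coeff_eq_truncate_map, map_natCast, hout]
    exact hy2 σ
  have hy1' : truncate (m + 1) (WittVector.frobenius y.out - y.out) =
      truncate (m + 1) (map (algebraMap K (SeparableClosure K)) x.out) := by
    rw [map_sub, hout, hy1]
  -- the solutions of the Artin-Schreier-Witt equation transported by `u` and `v`
  have hA1 : ∀ f : K →+* L, truncate (m + 1)
      (WittVector.frobenius (map (sepLift f) y.out) - map (sepLift f) y.out) =
      truncate (m + 1) (map (algebraMap L (SeparableClosure L)) (map f x.out)) := by
    intro f
    have h1 := truncate_map_congr (sepLift f) hy1'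
    rw [map_sub (map (sepLift f)), map_frobenius_charP] at h1
    rw [h1]
    congr 1
    refine WittVector.ext fun i => ?_
    simp only [map_coeff]
    exact sepLift_algebraMap f _
  have hA2 : ∀ (f : K →+* L) (σ : GalSep L), truncate (m + 1)
      (map (σ : SeparableClosure L →+* _) (map (sepLift f) y.out) - map (sepLift f) y.out) =
      (((H1.pullback f θ).1 (Additive.ofMul σ)).val :
        TruncatedWittVector p (m + 1) (SeparableClosure L)) := by
    intro f σ
    have h1 := truncate_map_congr (sepLift f) (hy2' (galRestrict f σ))
    rw [map_sub (map (sepLift f)), map_natCast (map (sepLift f)),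
      map_natCast (truncate (m + 1))] at h1
    rw [H1.pullback_apply, ← h1]
    congr 2
    refine WittVector.ext fun i => ?_
    simp only [map_coeff]
    exact (sepLift_galRestrict f σ _).symm
  set Z : WittVector p (SeparableClosure L) := map (sepLift v) y.out - map (sepLift u) y.out -
    map (algebraMap L (SeparableClosure L)) Y - verschiebung^[m] (teichmuller p b) with hZ
  have hVF : ∀ z : WittVector p (SeparableClosure L), WittVector.frobenius (verschiebung^[m] z) =
      verschiebung^[m] (WittVector.frobenius z) := fun z =>
    (Function.Commute.iterate_right (f := WittVector.frobenius) (g := verschiebung)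
      (fun z => (verschiebung_frobenius_comm z).symm) m z)
  have hVmap : ∀ (f : L →+* (SeparableClosure L)) (z : WittVector p L), map f (verschiebung^[m] z) =
      verschiebung^[m] (map f z) := fun f z =>
    Function.Semiconj.iterate_right (f := map f) (fun x => map_verschiebung f x) m _
  have hVmap' : ∀ (f : SeparableClosure L →+* SeparableClosure L)
      (z : WittVector p (SeparableClosure L)), map f (verschiebung^[m] z) =
      verschiebung^[m] (map f z) := fun f z =>
    Function.Semiconj.iterate_right (f := map f) (fun x => map_verschiebung f x) m _
  have hZF : truncate (m + 1) (WittVector.frobenius Z) = truncate (m + 1) Z := by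
    rw [← sub_eq_zero, ← map_sub]
    have h1 : WittVector.frobenius Z - Z =
        (WittVector.frobenius (map (sepLift v) y.out) - map (sepLift v) y.out) -
        (WittVector.frobenius (map (sepLift u) y.out) - map (sepLift u) y.out) -
        map (algebraMap L (SeparableClosure L)) (WittVector.frobenius Y - Y) -
        (verschiebung^[m] (WittVector.frobenius (teichmuller p b)) -
          verschiebung^[m] (teichmuller p b)) := by
      rw [hZ, map_sub, map_sub, map_sub, hVF,
        map_sub (map (algebraMap L (SeparableClosure L))), map_frobenius_charP]
      ring
    have h2 := truncate_map_congr (algebraMap L (SeparableClosure L)) h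
    have h3 : truncate (m + 1) (verschiebung^[m] (WittVector.frobenius (teichmuller p b)) -
        verschiebung^[m] (teichmuller p b)) =
        truncate (m + 1) (map (algebraMap L (SeparableClosure L)) (verschiebung^[m] (teichmuller p a))) := by
      rw [← iterate_map_sub, hVmap]
      refine truncate_iterate_verschiebung_congr ?_
      rw [sub_coeff_zero, coeff_frobenius_charP, teichmuller_coeff_zero, map_teichmuller,
        teichmuller_coeff_zero, hb1]
    rw [h1, map_sub, map_sub, map_sub, hA1, hA1, h3]
    simp only [map_sub, map_add] at h2 ⊢
    rw [h2]
    ring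
  have hZσ : ∀ σ : GalSep L, truncate (m + 1) (map (σ : SeparableClosure L →+* _) Z) =
      truncate (m + 1) Z := by
    intro σ
    rw [truncate_eq_truncate_iff] at hZF ⊢
    intro i hi
    have h1 := hZF i hi
    rw [coeff_frobenius_charP] at h1
    obtain ⟨j, hj⟩ := exists_zmod_eq_of_pow_eq_self h1
    rw [map_coeff, ← hj, castHom_eq_natCast_val, map_natCast]
  refine H1.ext_apply fun σ => ?_
  have h1 : truncate (m + 1) (map (σ : SeparableClosure L →+* _) Z - Z) = 0 := by
    rw [map_sub, hZσ, sub_self]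
  have h2 : map (σ : SeparableClosure L →+* _) Z - Z =
      (map (σ : SeparableClosure L →+* _) (map (sepLift v) y.out) - map (sepLift v) y.out) -
      (map (σ : SeparableClosure L →+* _) (map (sepLift u) y.out) - map (sepLift u) y.out) -
      (verschiebung^[m] (map (σ : SeparableClosure L →+* _) (teichmuller p b)) -
        verschiebung^[m] (teichmuller p b)) := by
    have hYσ : map (σ : SeparableClosure L →+* _) (map (algebraMap L (SeparableClosure L)) Y) =
        map (algebraMap L (SeparableClosure L)) Y := by
      refine WittVector.ext fun i => ?_
      simp only [map_coeff]
      exact σ.commutes _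
    rw [hZ, map_sub, map_sub, map_sub, hYσ, hVmap']
    ring
  have h3 : truncate (m + 1) (verschiebung^[m] (map (σ : SeparableClosure L →+* _) (teichmuller p b)) -
        verschiebung^[m] (teichmuller p b)) =
      (((η.1 (Additive.ofMul σ)).val * p ^ m : ℕ) : TruncatedWittVector p (m + 1) (SeparableClosure L)) := by
    rw [← truncate_natCast_mul_pow, ← iterate_map_sub]
    refine truncate_iterate_verschiebung_congr ?_
    rw [sub_coeff_zero, map_coeff, teichmuller_coeff_zero, teichmuller_coeff_zero]
    exact hb2 σ
  rw [h2, map_sub, map_sub, hA2, hA2, h3] at h1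
  have h4 := dvd_of_truncate_intCast_eq_zero (p := p) (L := (SeparableClosure L)) (n := m + 1)
    (z := ((((H1.pullback v θ).1 (Additive.ofMul σ)).val : ℕ) : ℤ) -
      (((H1.pullback u θ).1 (Additive.ofMul σ)).val : ℕ) -
      ((η.1 (Additive.ofMul σ)).val * p ^ m : ℕ)) (by
      rw [Int.cast_sub, Int.cast_sub, Int.cast_natCast, Int.cast_natCast, Int.cast_natCast]
      exact h1)
  rw [← ZMod.intCast_zmod_eq_zero_iff_dvd] at h4
  have hdiv : p ^ (m + 1) / p = p ^ m := by
    rw [pow_succ, Nat.mul_div_cancel _ (Fact.out : p.Prime).pos]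
  have : NeZero (p ^ (m + 1)) := ⟨pow_ne_zero _ (Fact.out : p.Prime).ne_zero⟩
  rw [H1.mapCoeff_apply, ← ZMod.natCast_zmod_val (η.1 (Additive.ofMul σ)), mulCoeff_natCast, hdiv]
  rw [Int.cast_sub, Int.cast_sub, Int.cast_natCast, Int.cast_natCast, Int.cast_natCast,
    ZMod.natCast_zmod_val, ZMod.natCast_zmod_val, sub_eq_zero] at h4
  exact h4

end WittClasses

end Characters


/-! ### Tame characters -/

section Tame

variable {K L : Type*} [Field K] [Field L]

lemma exists_mapCoeff_zmodToQZ_eq {n : ℕ} (hn : n ≠ 0) {ψ : H1 K QZ} (h : n • ψ = 0) :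
    ∃ ψ₀ : H1 K (ZMod n), H1.mapCoeff (zmodToQZ n) ψ₀ = ψ := by
  have h1 : ∀ σ, ∃ j, zmodToQZ n j = ψ.1 σ := fun σ => exists_zmodToQZ_eq hn (by
    have := DFunLike.congr_fun (congrArg Subtype.val h) σ
    simpa using this)
  choose j hj using h1
  have hj0 : ∀ σ, j σ = 0 ↔ ψ.1 σ = 0 := fun σ => by
    rw [← hj, map_eq_zero_iff _ (zmodToQZ_injective hn)]
  refine ⟨⟨AddMonoidHom.mk' j fun σ τ => zmodToQZ_injective hn (by
    rw [map_add, hj, hj, hj, map_add]), ?_⟩, ?_⟩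
  · exact isOpen_of_imp (θ := ψ.1) ψ.2 fun σ hσ => (hj0 σ).2 hσ
  · exact Subtype.ext (AddMonoidHom.ext fun σ => hj σ)

lemma pow_val_add {M : Type*} [Monoid M] {n : ℕ} {ζ : M} (hζ : ζ ^ n = 1) [NeZero n]
    (i j : ZMod n) : ζ ^ (i + j).val = ζ ^ i.val * ζ ^ j.val := by
  rw [ZMod.val_add, ← pow_eq_pow_mod _ hζ, pow_add]

/-- Kummer theory: in the presence of a primitive `n`-th root of unity `ζ`, a character with values
in `ℤ/n` is given by `σ ↦ σ y / y` for some `y`. -/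
lemma exists_kummer_generator {n : ℕ} [NeZero n] {ζ : K} (hζ : ζ ^ n = 1) (ψ : H1 K (ZMod n)) :
    ∃ y : SeparableClosure K, y ≠ 0 ∧ ∀ σ : GalSep K,
      σ y = algebraMap K _ (ζ ^ (ψ.1 (Additive.ofMul σ)).val) * y := by
  have hζ0 : ζ ≠ 0 := by
    rintro rfl
    rw [zero_pow (NeZero.ne n)] at hζ
    exact zero_ne_one hζ
  have hnhds : {σ : GalSep K | ψ.1 (Additive.ofMul σ) = 0} ∈ nhds 1 :=
    (show IsOpen {σ : GalSep K | ψ.1 (Additive.ofMul σ) = 0} from ψ.2).mem_nhds (by simp)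
  obtain ⟨E, hE1, hE2, hE⟩ := (krullTopology_mem_nhds_one_iff_of_normal _ _ _).1 hnhds
  let ρ : GalSep K →* (E ≃ₐ[K] E) := AlgEquiv.restrictNormalHom E
  have hρ : Function.Surjective ρ := AlgEquiv.restrictNormalHom_surjective _
  have hker : ∀ σ τ, ρ σ = ρ τ → ψ.1 (Additive.ofMul σ) = ψ.1 (Additive.ofMul τ) := by
    intro σ τ h
    have h1 : σ * τ⁻¹ ∈ E.fixingSubgroup := by
      rw [← IntermediateField.restrictNormalHom_ker, MonoidHom.mem_ker]
      show ρ (σ * τ⁻¹) = 1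
      rw [map_mul, map_inv, h, mul_inv_cancel]
    have h2 : ψ.1 (Additive.ofMul (σ * τ⁻¹)) = 0 := hE h1
    rw [ofMul_mul, ofMul_inv, map_add, map_neg, ← sub_eq_add_neg, sub_eq_zero] at h2
    exact h2
  let c : GalSep K → K := fun σ => ζ ^ (ψ.1 (Additive.ofMul σ)).val
  have hc0 : ∀ σ, algebraMap K E (c σ) ≠ 0 := fun σ => by
    rw [Ne, map_eq_zero]
    exact pow_ne_zero _ hζ0
  let f : (E ≃ₐ[K] E) → Eˣ := fun g => Units.mk0 _ (hc0 (Function.surjInv hρ g))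
  have hf : ∀ σ, (f (ρ σ) : E) = algebraMap K E (c σ) := by
    intro σ
    show algebraMap K E (c _) = _
    simp only [c]
    rw [hker _ σ (Function.surjInv_eq hρ (ρ σ))]
  obtain ⟨β, hβ⟩ := groupCohomology.isMulCoboundary₁_of_isMulCocycle₁_of_aut_to_units f (by
    intro g h
    obtain ⟨σ, rfl⟩ := hρ g
    obtain ⟨τ, rfl⟩ := hρ h
    rw [← map_mul]
    refine Units.ext ?_
    rw [Units.val_mul, hf, hf, AlgEquiv.smul_units_def, Units.coe_map, MonoidHom.coe_coe, hf]
    rw [AlgEquiv.commutes, ← map_mul]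
    congr 1
    simp only [c]
    rw [ofMul_mul, map_add, pow_val_add hζ, mul_comm])
  refine ⟨(β : E), by simp, fun σ => ?_⟩
  have h1 := hβ (ρ σ)
  rw [div_eq_iff_eq_mul, Units.ext_iff, Units.val_mul, hf] at h1
  have h2 := congrArg (algebraMap E (SeparableClosure K)) h1
  rw [map_mul, ← IsScalarTower.algebraMap_apply] at h2
  rw [← show algebraMap E (SeparableClosure K) β = ((β : E) : SeparableClosure K) from rfl, ← h2]
  exact (AlgEquiv.restrictNormal_commutes σ E (β : E)).symm

/-- A tame character has the same pull-backs by `u` and `v` if these homomorphisms only differ by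
`n`-th powers. -/
lemma pullback_eq_pullback_of_tame {n : ℕ} (hn : n ≠ 0) {ζ : K} (hζ : IsPrimitiveRoot ζ n)
    {ψ : H1 K QZ} (hψ : n • ψ = 0) (u v : K →+* L)
    (huv : ∀ a : K, a ≠ 0 → ∃ e : L, v a = u a * e ^ n) (hζuv : v ζ = u ζ) :
    H1.pullback v ψ = H1.pullback u ψ := by
  have : NeZero n := ⟨hn⟩
  obtain ⟨ψ, rfl⟩ := exists_mapCoeff_zmodToQZ_eq hn hψ
  suffices h : H1.pullback v ψ = H1.pullback u ψ by
    refine H1.ext_apply fun σ => ?_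
    have := DFunLike.congr_fun (congrArg Subtype.val h) (Additive.ofMul σ)
    rw [H1.pullback_apply, H1.pullback_apply] at this
    rw [H1.pullback_apply, H1.pullback_apply, H1.mapCoeff_apply, H1.mapCoeff_apply, this]
  obtain ⟨y, hy0, hy⟩ := exists_kummer_generator hζ.pow_eq_one ψ
  obtain ⟨a, ha⟩ : ∃ a, algebraMap K (SeparableClosure K) a = y ^ n := by
    refine (InfiniteGalois.mem_range_algebraMap_iff_fixed (k := K) (y ^ n)).2 fun σ => ?_
    rw [map_pow, hy σ, mul_pow, ← map_pow, ← pow_mul, mul_comm _ n, pow_mul, hζ.pow_eq_one,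
      one_pow, map_one, one_mul]
  have ha0 : a ≠ 0 := by
    rintro rfl
    rw [map_zero] at ha
    exact pow_ne_zero n hy0 ha.symm
  obtain ⟨e, he⟩ := huv a ha0
  have huζ : IsPrimitiveRoot (algebraMap L (SeparableClosure L) (u ζ)) n :=
    (hζ.map_of_injective u.injective).map_of_injective (algebraMap L _).injective
  have hyf : ∀ f : K →+* L, sepLift f y ^ n = algebraMap L _ (f a) := fun f => by
    rw [← map_pow, ← ha, sepLift_algebraMap]
  have he0 : e ≠ 0 := by
    rintro rfl
    rw [zero_pow hn, mul_zero, map_eq_zero] at he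
    exact ha0 he
  have hne : ∀ f : K →+* L, sepLift f y ≠ 0 := fun f => by simpa using hy0
  -- the quotient of the two Kummer generators lies in `L`
  obtain ⟨c, hc⟩ : ∃ c : L, sepLift v y = algebraMap L _ c * sepLift u y := by
    have hb : algebraMap L (SeparableClosure L) e * sepLift u y ≠ 0 :=
      mul_ne_zero (by simpa using he0) (hne u)
    have h1 : (sepLift v y / (algebraMap L _ e * sepLift u y)) ^ n = 1 := by
      rw [div_pow, mul_pow, hyf, hyf, he, map_mul, map_pow, mul_comm]
      refine div_self ?_
      rw [← map_pow, ← map_mul]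
      simpa [he0] using ha0
    obtain ⟨i, -, hi⟩ := huζ.eq_pow_of_pow_eq_one h1
    refine ⟨u ζ ^ i * e, ?_⟩
    rw [eq_div_iff hb] at hi
    rw [← hi, map_mul, map_pow, mul_assoc]
  have hσ : ∀ (f : K →+* L) (σ : GalSep L), σ (sepLift f y) =
      algebraMap L _ (f ζ) ^ ((H1.pullback f ψ).1 (Additive.ofMul σ)).val * sepLift f y := by
    intro f σ
    rw [← sepLift_galRestrict, hy, map_mul, sepLift_algebraMap, map_pow, map_pow,
      H1.pullback_apply]
  refine H1.ext_apply fun σ => ZMod.val_injective n ?_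
  refine huζ.pow_inj (ZMod.val_lt _) (ZMod.val_lt _) ?_
  have h1 := hσ v σ
  rw [hc, map_mul, AlgEquiv.commutes, hσ u σ, hζuv] at h1
  have hc0 : algebraMap L (SeparableClosure L) c ≠ 0 := by
    intro h0
    rw [h0, zero_mul] at hc
    exact hne v hc
  refine mul_right_cancel₀ (mul_ne_zero hc0 (hne u)) ?_
  linear_combination -h1

end Tame

section Decomposition

variable {K L : Type*} [Field K] [Field L] {p : ℕ} [Fact p.Prime]

/-- The tame part in a decomposition of a character killed by `n` is killed by the prime-to-`p` part
of `n`. -/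
lemma nsmul_eq_zero_of_mem_primeToP {p n m : ℕ} {χ ψ δ : H1 K QZ}
    (hχ : n • χ = 0) (hδ : p ^ m • δ = 0) (hψ : ψ ∈ primeToP K p) (h : χ = ψ + δ) :
    (n / p ^ padicValNat p n) • ψ = 0 := by
  obtain ⟨N, hN, ψ₀, rfl⟩ := hψ
  set ψ := H1.mapCoeff (zmodToQZ N) ψ₀ with hψdef
  have hN0 : N • ψ = 0 := by
    rw [hψdef, ← map_nsmul]
    have : N • ψ₀ = 0 := by
      refine Subtype.ext (AddMonoidHom.ext fun σ => ?_)
      simp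
    rw [this, map_zero]
  set n' := n / p ^ padicValNat p n with hn'
  have hnn : n = p ^ padicValNat p n * n' := (Nat.mul_div_cancel' pow_padicValNat_dvd).symm
  have h1 : (p ^ m * n) • ψ = 0 := by
    have : ψ = χ - δ := by rw [h]; abel
    rw [this, smul_sub, mul_smul, hχ, smul_zero, mul_comm, mul_smul, hδ, smul_zero, sub_zero]
  rw [← addOrderOf_dvd_iff_nsmul_eq_zero] at hN0 h1 ⊢
  have hcop : (addOrderOf ψ).Coprime (p ^ m * p ^ padicValNat p n) := by
    rw [← pow_add]
    exact Nat.Coprime.pow_right _ (hN.coprime_dvd_left hN0)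
  refine hcop.dvd_of_dvd_mul_left ?_
  rwa [mul_assoc, ← hnn]

lemma nsmul_mapCoeff_zmodToQZ (N : ℕ) (θ : H1 K (ZMod N)) : N • H1.mapCoeff (zmodToQZ N) θ = 0 := by
  rw [← map_nsmul]
  have : N • θ = 0 := by
    refine Subtype.ext (AddMonoidHom.ext fun σ => ?_)
    simp
  rw [this, map_zero]

lemma pullback_mapCoeff {M N : Type*} [AddCommGroup M] [AddCommGroup N] (g : M →+ N)
    (f : K →+* L) (χ : H1 K M) :
    H1.pullback f (H1.mapCoeff g χ) = H1.mapCoeff g (H1.pullback f χ) := rfl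

/-- The comparison of `v^* χ` and `u^* χ`, for a character `χ` with values in `ℤ/n` which is the sum
of a tame character and of the Artin-Schreier-Witt character of `x`. -/
lemma exists_artinSchreier_pullback_sub [CharP L p] {n : ℕ} (hn : n ≠ 0)
    (hp : p ∣ n) {ζ : K} (hζ : IsPrimitiveRoot ζ (n / p ^ padicValNat p n)) {χ : H1 K (ZMod n)}
    {ψ : H1 K QZ} (hψ : ψ ∈ primeToP K p) {m : ℕ} {x : TruncatedWittVector p (m + 1) K}
    {θ : H1 K (ZMod (p ^ (m + 1)))} (hθ : IsWittClass x θ)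
    (hχ : H1.mapCoeff (zmodToQZ n) χ = ψ + H1.mapCoeff (zmodToQZ _) θ) (u v : K →+* L)
    (huv : ∀ b : K, b ≠ 0 → ∃ e : L, v b = u b * e ^ (n / p ^ padicValNat p n))
    (hζuv : v ζ = u ζ) (a : L) (Y : WittVector p L)
    (h : WittVector.truncate (m + 1) (WittVector.map v x.out - WittVector.map u x.out) =
      WittVector.truncate (m + 1) (WittVector.verschiebung^[m] (WittVector.teichmuller p a) +
        (WittVector.frobenius Y - Y))) :
    ∃ η : H1 L (ZMod p), IsArtinSchreierClass a η ∧
      H1.pullback v χ - H1.pullback u χ = H1.mapCoeff (mulCoeff hp) η := by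
  obtain ⟨η, hη⟩ := exists_isArtinSchreierClass a (p := p)
  refine ⟨η, hη, ?_⟩
  have hpp : p ≠ 0 := (Fact.out : p.Prime).ne_zero
  have h1 := pullback_sub_pullback_of_isWittClass hθ u v a Y h hη
  have hn' : n / p ^ padicValNat p n ≠ 0 :=
    (Nat.div_pos (Nat.le_of_dvd (Nat.pos_of_ne_zero hn) pow_padicValNat_dvd)
      (pow_pos (Fact.out : p.Prime).pos _)).ne'
  have h2 := pullback_eq_pullback_of_tame hn' hζ (nsmul_eq_zero_of_mem_primeToP
    (nsmul_mapCoeff_zmodToQZ n χ) (nsmul_mapCoeff_zmodToQZ _ θ) hψ hχ) u v huv hζuv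
  have h3 : H1.mapCoeff (zmodToQZ n) (H1.pullback v χ - H1.pullback u χ) =
      H1.mapCoeff (zmodToQZ n) (H1.mapCoeff (mulCoeff hp) η) := by
    rw [map_sub, ← pullback_mapCoeff, ← pullback_mapCoeff, hχ, map_add, map_add, h2,
      add_sub_add_left_eq_sub, pullback_mapCoeff, pullback_mapCoeff, ← map_sub, h1]
    refine H1.ext_apply fun σ => ?_
    simp only [H1.mapCoeff_apply]
    rw [zmodToQZ_mulCoeff hpp hn, zmodToQZ_mulCoeff hpp (pow_ne_zero _ hpp)]
  refine H1.ext_apply fun σ => zmodToQZ_injective hn ?_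
  exact DFunLike.congr_fun (congrArg Subtype.val h3) (Additive.ofMul σ)

end Decomposition


/-! ### One-units -/

section OneUnits

variable {Λ 𝕂 E : Type*} [CommRing Λ] [Field 𝕂] [Field E]

/-- `y = 1 + c ε` for some `ε` in `Λ` with residue `e`. -/
def IsOneUnit (ι : Λ →+* 𝕂) (res : Λ →+* E) (c : Λ) (y : 𝕂) (e : E) : Prop :=
  ∃ ε : Λ, res ε = e ∧ y = ι (1 + c * ε)

variable {ι : Λ →+* 𝕂} {res : Λ →+* E} {c : Λ}

lemma IsOneUnit.one : IsOneUnit ι res c 1 0 := ⟨0, by simp, by simp⟩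

lemma IsOneUnit.mul (hc : res c = 0) {y₁ y₂ : 𝕂} {e₁ e₂ : E} (h₁ : IsOneUnit ι res c y₁ e₁)
    (h₂ : IsOneUnit ι res c y₂ e₂) : IsOneUnit ι res c (y₁ * y₂) (e₁ + e₂) := by
  obtain ⟨ε₁, rfl, rfl⟩ := h₁
  obtain ⟨ε₂, rfl, rfl⟩ := h₂
  exact ⟨ε₁ + ε₂ + c * ε₁ * ε₂, by simp [hc], by rw [← map_mul]; congr 1; ring⟩

lemma IsOneUnit.inv (hunit : ∀ x : Λ, res x ≠ 0 → IsUnit x) (hc : res c = 0) {y : 𝕂} {e : E}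
    (h : IsOneUnit ι res c y e) : IsOneUnit ι res c y⁻¹ (-e) := by
  obtain ⟨ε, rfl, rfl⟩ := h
  obtain ⟨i, hi⟩ := (hunit (1 + c * ε) (by simp [hc])).exists_right_inv
  refine ⟨-(ε * i), ?_, ?_⟩
  · have := congrArg res hi
    simp only [map_mul, map_add, map_one, hc, zero_mul, add_zero, one_mul] at this
    simp [this]
  · refine inv_eq_of_mul_eq_one_right ?_
    rw [← map_mul, ← map_one ι]
    congr 1
    linear_combination (1 - (1 + c * ε)) * hi

lemma IsOneUnit.pow (hc : res c = 0) {y : 𝕂} {e : E}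
    (h : IsOneUnit ι res c y e) (n : ℕ) : IsOneUnit ι res c (y ^ n) (n * e) := by
  induction n with
  | zero => simpa using IsOneUnit.one
  | succ n ih =>
    rw [pow_succ]
    have := ih.mul hc h
    rwa [← add_one_mul, ← Nat.cast_succ] at this

lemma IsOneUnit.zpow (hunit : ∀ x : Λ, res x ≠ 0 → IsUnit x) (hc : res c = 0) {y : 𝕂} {e : E}
    (h : IsOneUnit ι res c y e) (j : ℤ) : IsOneUnit ι res c (y ^ j) (j * e) := by
  cases j with
  | ofNat n => simpa using h.pow hc n
  | negSucc n =>
    have := (h.pow hc (n + 1)).inv hunit hc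
    rw [zpow_negSucc, Int.cast_negSucc, neg_mul]
    exact this

end OneUnits

section Expansion

variable {R K : Type*} [CommRing R] [IsDomain R] [IsDiscreteValuationRing R] [Field K]
  [Algebra R K] [IsFractionRing R K] {p : ℕ} [Fact p.Prime]
variable {Λ 𝕂 E : Type*} [CommRing Λ] [Field 𝕂] [Field E] {ι : Λ →+* 𝕂} {res : Λ →+* E}
  {u : R →+* Λ} {uK vK : K →+* 𝕂}

lemma hasTopResidue_of_isOneUnit [CharP 𝕂 p] {ϖ : R} (hϖ : Irreducible ϖ)
    (hu : ∀ a, uK (algebraMap R K a) = ι (u a))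
    (hres : ∀ a ∈ IsLocalRing.maximalIdeal R, res (u a) = 0)
    {x : K} (hx : x ≠ 0) {l a : ℕ} (ha : 1 ≤ a)
    (hval : val R K x ^ p ^ l ≤ WithZero.exp (a : ℤ)) {e : E}
    (he : IsOneUnit ι res (u ϖ ^ a) (vK x / uK x) e) {G : R}
    (hG : algebraMap R K G = algebraMap R K ϖ ^ a * x ^ p ^ l) :
    HasTopResidue ι res l (WittVector.teichmuller p (vK x) - WittVector.teichmuller p (uK x))
      (res (u G) * e) := by
  obtain ⟨ε, rfl, hε⟩ := he
  have hux : uK x ≠ 0 := by simpa using hx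
  rw [← map_mul]
  refine hasTopResidue_teichmuller_sub (c := u ϖ ^ a) ?_ ?_ ?_ ?_
  · rw [← map_one ι, ← map_add, ← hε, mul_div_cancel₀ _ hux]
  · rw [map_pow, hres _ ((IsLocalRing.mem_maximalIdeal _).2 hϖ.not_isUnit), zero_pow (by omega)]
  · intro i hi
    obtain ⟨j, g, hj⟩ := exists_eq_zpow_mul_unit hϖ hx
    have hv : val R K (algebraMap R K ϖ ^ a * x ^ p ^ i) < 1 := by
      rw [hj, val_zpow_mul_unit hϖ, ← WithZero.exp_nsmul, WithZero.exp_le_exp] at hval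
      rw [map_mul, map_pow, map_pow, hj, val_zpow_mul_unit hϖ, val_uniformizer hϖ,
        ← WithZero.exp_nsmul, ← WithZero.exp_nsmul, ← WithZero.exp_add, ← WithZero.exp_zero,
        WithZero.exp_lt_exp]
      have hlt : (p : ℤ) ^ i < (p : ℤ) ^ l :=
        pow_lt_pow_right₀ (by exact_mod_cast (Fact.out : p.Prime).one_lt) hi
      simp only [smul_neg, nsmul_eq_mul, mul_one] at hval ⊢
      push_cast at hval ⊢
      have hpos : (0 : ℤ) < (p : ℤ) ^ i := by
        exact_mod_cast pow_pos (Fact.out : p.Prime).pos i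
      rcases le_or_gt 0 j with h0 | h0
      · nlinarith
      · nlinarith
    obtain ⟨H, hH⟩ := val_le_one_iff.1 hv.le
    refine ⟨u H, hres _ ?_, ?_⟩
    · rw [← hH] at hv
      exact (IsDedekindDomain.HeightOneSpectrum.valuation_lt_one_iff_mem _ H).1 hv
    · rw [← hu, hH, map_mul, map_pow, map_pow, hu, map_pow, mul_comm]
  · rw [← hu, hG, map_mul, map_pow, map_pow, hu, map_pow, mul_comm]

end Expansion

section Differentials

variable {k R K : Type*} [Field k] [CommRing R] [Algebra k R] [Field K] [Algebra R K] [Algebra k K]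
  [IsScalarTower k R K]

/-- Logarithmic differentiation of `x = ϖ^j g`, applied to `x ^ (q - 1) dx`. -/
lemma pow_sub_one_smul_D_zpow_mul {ϖ g x : K} (hϖ : ϖ ≠ 0) (hg : g ≠ 0) (j : ℤ)
    (hx : x = ϖ ^ j * g) {q : ℕ} (hq : 1 ≤ q) :
    x ^ (q - 1) • KaehlerDifferential.D k K x =
      (j * x ^ q) • ϖ⁻¹ • KaehlerDifferential.D k K ϖ +
        x ^ q • g⁻¹ • KaehlerDifferential.D k K g := by
  have h1 : KaehlerDifferential.D k K x =
      (j * x) • ϖ⁻¹ • KaehlerDifferential.D k K ϖ + x • g⁻¹ • KaehlerDifferential.D k K g := by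
    rw [hx, Derivation.leibniz, Derivation.leibniz_zpow, add_comm]
    congr 1
    · simp only [smul_smul, ← Int.cast_smul_eq_zsmul K]
      congr 1
      rw [zpow_sub_one₀ hϖ]
      ring
    · simp only [smul_smul]
      congr 1
      field_simp
  obtain ⟨q, rfl⟩ : ∃ n, q = n + 1 := ⟨q - 1, by omega⟩
  rw [h1, Nat.add_sub_cancel]
  simp only [smul_add, smul_smul]
  congr 2 <;> ring

end Differentials


/-! ### Hensel's lemma in the completed local ring -/

section Hensel

open Polynomial

variable {Λ E : Type*} [CommRing Λ] [IsLocalRing Λ] [Field E] {res : Λ →+* E}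

lemma ker_eq_maximalIdeal (hres : Function.Surjective res) :
    RingHom.ker res = IsLocalRing.maximalIdeal Λ :=
  IsLocalRing.eq_maximalIdeal (RingHom.ker_isMaximal_of_surjective res hres)

lemma isUnit_of_res_ne_zero (hres : Function.Surjective res) {x : Λ} (hx : res x ≠ 0) :
    IsUnit x := by
  by_contra h
  rw [← mem_nonunits_iff, ← IsLocalRing.mem_maximalIdeal, ← ker_eq_maximalIdeal hres] at h
  exact hx h

/-- Roots of unity of order prime to the residue characteristic are determined by their residues. -/
lemma eq_of_pow_eq_one_of_res_eq (hres : Function.Surjective res) {n : ℕ} (hn : (n : E) ≠ 0)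
    {x y : Λ} (hx : x ^ n = 1) (hy : y ^ n = 1) (hxy : res x = res y) : x = y := by
  have hn0 : n ≠ 0 := by
    rintro rfl
    simp at hn
  have h1 : (∑ i ∈ Finset.range n, x ^ i * y ^ (n - 1 - i)) * (x - y) = 0 := by
    rw [(Commute.all x y).geom_sum₂_mul, hx, hy, sub_self]
  have h2 : IsUnit (∑ i ∈ Finset.range n, x ^ i * y ^ (n - 1 - i)) := by
    refine isUnit_of_res_ne_zero hres ?_
    have hyn : res y ^ n = 1 := by rw [← map_pow, hy, map_one]
    have hy0 : res y ≠ 0 := by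
      intro h
      rw [h, zero_pow hn0] at hyn
      exact zero_ne_one hyn
    rw [map_sum, Finset.sum_congr rfl (g := fun _ => res y ^ (n - 1))]
    · simp [hn, hy0]
    · intro i hi
      rw [map_mul, map_pow, map_pow, hxy, ← pow_add]
      congr 1
      have := Finset.mem_range.1 hi
      omega
  exact sub_eq_zero.1 ((h2.mul_right_eq_zero).1 h1)

variable [IsAdicComplete (IsLocalRing.maximalIdeal Λ) Λ]

lemma exists_pow_sub_self_eq (hres : Function.Surjective res) {p : ℕ} (hp : 2 ≤ p) {w : Λ}
    (hw : res w = 0) : ∃ y, res y = 0 ∧ y ^ p - y = w := by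
  have hker := ker_eq_maximalIdeal hres
  have hdeg : (X + C w : Λ[X]).degree < p := by
    rw [degree_X_add_C]
    exact_mod_cast hp
  have heq : (X ^ p - X - C w : Λ[X]) = X ^ p - (X + C w) := by ring
  obtain ⟨y, hy, hy0⟩ := HenselianRing.is_henselian (I := IsLocalRing.maximalIdeal Λ)
    (X ^ p - X - C w : Λ[X]) (by rw [heq]; exact monic_X_pow_sub hdeg) 0 (by
      rw [← hker, RingHom.mem_ker]
      simp [hw, show p ≠ 0 by omega]) (by
      have : p - 1 ≠ 0 := by omega
      rw [derivative_sub, derivative_sub, derivative_C, derivative_X, derivative_X_pow]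
      simp [this])
  rw [sub_zero, ← hker] at hy0
  refine ⟨y, hy0, ?_⟩
  have : y ^ p - y - w = 0 := by simpa [IsRoot] using hy
  linear_combination this

lemma exists_pow_eq_of_res_eq_one (hres : Function.Surjective res) {n : ℕ} (hn : (n : E) ≠ 0)
    {x : Λ} (hx : res x = 1) : ∃ y, y ^ n = x := by
  have hker := ker_eq_maximalIdeal hres
  have hn0 : n ≠ 0 := by
    rintro rfl
    simp at hn
  obtain ⟨y, hy, -⟩ := HenselianRing.is_henselian (I := IsLocalRing.maximalIdeal Λ)
    (X ^ n - C x : Λ[X]) (monic_X_pow_sub_C x hn0) 1 (by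
      rw [← hker, RingHom.mem_ker]
      simp [hx]) (by
      refine IsUnit.map _ ?_
      rw [derivative_sub, derivative_C, derivative_X_pow, sub_zero]
      simp only [eval_mul, eval_C, eval_pow, eval_X, one_pow, mul_one]
      exact isUnit_of_res_ne_zero hres (by simpa using hn))
  exact ⟨y, by simpa [IsRoot, sub_eq_zero] using hy⟩

end Hensel

/-! ### Finiteness of the dilatation -/

section Noetherian

lemma prodAlg_fg {k R K B : Type*} [Field k] [CommRing R] [Algebra k R] [Field K] [Algebra R K]
    [Algebra k K] [IsScalarTower k R K] [CommRing B] [Algebra k B] (ξ : B →ₐ[k] R)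
    [Algebra.FiniteType k B] : (prodAlg K ξ).FG := by
  obtain ⟨s, hs⟩ := (Algebra.FiniteType.out : (⊤ : Subalgebra k B).FG)
  rw [Subalgebra.fg_def]
  refine ⟨(fun b : B => (1 : K) ⊗ₜ[k] b) '' s, s.finite_toSet.image _, ?_⟩
  refine le_antisymm (Algebra.adjoin_mono (Set.image_subset_range _ _)) (Algebra.adjoin_le ?_)
  rintro _ ⟨b, rfl⟩
  have hb : b ∈ Algebra.adjoin k (s : Set B) := hs ▸ Algebra.mem_top
  show (1 : K) ⊗ₜ[k] b ∈ _
  induction hb using Algebra.adjoin_induction with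
  | mem b hb => exact Algebra.subset_adjoin ⟨b, hb, rfl⟩
  | algebraMap c =>
    have : (1 : K) ⊗ₜ[k] algebraMap k B c = algebraMap R (K ⊗[k] B) (algebraMap k R c) := by
      rw [← IsScalarTower.algebraMap_apply]
      exact ((Algebra.TensorProduct.includeRight : B →ₐ[k] K ⊗[k] B).commutes c)
    rw [this]
    exact Subalgebra.algebraMap_mem _ _
  | add b b' _ _ h h' =>
    rw [TensorProduct.tmul_add]
    exact Subalgebra.add_mem _ h h'
  | mul b b' _ _ h h' =>
    have := Subalgebra.mul_mem _ h h'
    rwa [Algebra.TensorProduct.tmul_mul_tmul, one_mul] at this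

variable {k R : Type*} {K : Type*} {B : Type*} [Field k] [CommRing R] [IsDomain R]
  [IsDiscreteValuationRing R] [Algebra k R] [Field K] [Algebra R K] [IsFractionRing R K]
  [Algebra k K] [IsScalarTower k R K] [CommRing B] [Algebra k B] (ξ : B →ₐ[k] R)

lemma val_mul_pow_le {ϖ : R} (hϖ : Irreducible ϖ) {c : K} {n : ℕ}
    (hc : val R K c ≤ WithZero.exp (n : ℤ)) :
    ∃ a : R, c = algebraMap R K a * (algebraMap R K ϖ ^ n)⁻¹ := by
  obtain ⟨a, ha⟩ := (val_le_exp_iff hϖ n).1 hc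
  have : algebraMap R K ϖ ≠ 0 := by simpa using hϖ.ne_zero
  exact ⟨a, by rw [ha]; field_simp⟩

lemma val_inv_pow_le {ϖ : R} (hϖ : Irreducible ϖ) (n : ℕ) :
    val R K (algebraMap R K ϖ ^ n)⁻¹ ≤ WithZero.exp (n : ℤ) := by
  have := val_zpow_mul_unit (K := K) hϖ (-(n : ℤ)) 1
  simp only [zpow_neg, zpow_natCast, Units.val_one, map_one, mul_one, neg_neg] at this
  exact this.le

/-- Adjoining to a subalgebra `C` of finite type the quotients by `π^n` of the elements of a subset
of `C` gives a subalgebra of finite type, since `C` is noetherian. -/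
lemma fg_sup_adjoin {C : Subalgebra R (K ⊗[k] B)} (hC : C.FG) (T : Set C) (n : ℕ) :
    (C ⊔ Algebra.adjoin R {z : K ⊗[k] B | ∃ c : K, val R K c ≤ WithZero.exp (n : ℤ) ∧
      ∃ y ∈ T, z = c • (y : K ⊗[k] B)}).FG := by
  obtain ⟨ϖ, hϖ⟩ := IsDiscreteValuationRing.exists_irreducible R
  have : Algebra.FiniteType R C := (Subalgebra.fg_iff_finiteType C).1 hC
  have : IsNoetherianRing C := Algebra.FiniteType.isNoetherianRing R C
  obtain ⟨T₀, hT₀, hspan⟩ := (Submodule.fg_span_iff_fg_span_finset_subset T).1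
    (IsNoetherian.noetherian (Ideal.span T))
  obtain ⟨s, hs, rfl⟩ := Subalgebra.fg_def.1 hC
  rw [Subalgebra.fg_def]
  let c₀ : K := (algebraMap R K ϖ ^ n)⁻¹
  refine ⟨s ∪ (fun y : Algebra.adjoin R s => c₀ • (y : K ⊗[k] B)) '' T₀,
    hs.union (T₀.finite_toSet.image _), ?_⟩
  rw [Algebra.adjoin_union]
  refine le_antisymm (sup_le_sup_left (Algebra.adjoin_mono ?_) _) (sup_le le_sup_left ?_)
  · rintro _ ⟨y, hy, rfl⟩
    exact ⟨c₀, val_inv_pow_le hϖ n, y, hT₀ hy, rfl⟩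
  · refine Algebra.adjoin_le ?_
    rintro _ ⟨c, hc, y, hy, rfl⟩
    obtain ⟨a, rfl⟩ := val_mul_pow_le hϖ hc
    rw [mul_smul, algebraMap_smul]
    refine Subalgebra.smul_mem _ ?_ a
    have hy' : y ∈ Submodule.span (Algebra.adjoin R s) (T₀ : Set (Algebra.adjoin R s)) := by
      rw [← hspan]
      exact Submodule.subset_span hy
    clear hy
    induction hy' using Submodule.span_induction with
    | mem y hy =>
      exact le_sup_right (a := Algebra.adjoin R s) (Algebra.subset_adjoin ⟨y, hy, rfl⟩)
    | zero =>
      rw [ZeroMemClass.coe_zero, smul_zero]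
      exact Subalgebra.zero_mem _
    | add y z _ _ hy hz =>
      rw [AddMemClass.coe_add, smul_add]
      exact Subalgebra.add_mem _ hy hz
    | smul b y _ hy =>
      rw [smul_eq_mul, MulMemClass.coe_mul, ← mul_smul_comm]
      exact Subalgebra.mul_mem _ (le_sup_left (b := Algebra.adjoin R _) b.2) hy

lemma logProdAlg_fg [Algebra.FiniteType k B] : (logProdAlg K ξ).FG := by
  have h := fg_sup_adjoin (prodAlg_fg (K := K) ξ)
    {y | ∃ f ∈ centre ξ, (y : K ⊗[k] B) = (1 : K) ⊗ₜ[k] f} 1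
  refine Eq.mpr (congrArg (fun s : Set (K ⊗[k] B) => (prodAlg K ξ ⊔ Algebra.adjoin R s).FG)
    (Set.ext fun z => ⟨?_, ?_⟩)) h
  · rintro ⟨c, hc, f, hf, rfl⟩
    refine ⟨c, hc, ⟨(1 : K) ⊗ₜ[k] f, Algebra.subset_adjoin ⟨f, rfl⟩⟩, ⟨f, hf, rfl⟩, ?_⟩
    rw [TensorProduct.smul_tmul', smul_eq_mul, mul_one]
  · rintro ⟨c, hc, y, ⟨f, hf, hy⟩, rfl⟩
    refine ⟨c, hc, f, hf, ?_⟩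
    rw [hy, TensorProduct.smul_tmul', smul_eq_mul, mul_one]

lemma dilatation_fg {C : Subalgebra R (K ⊗[k] B)} (hC : C.FG) (r : ℕ) :
    (dilatation ξ C r).FG := by
  have h := fg_sup_adjoin hC {y | graphHom K ξ y = 0} r
  refine Eq.mpr (congrArg (fun s : Set (K ⊗[k] B) => (C ⊔ Algebra.adjoin R s).FG)
    (Set.ext fun z => ⟨?_, ?_⟩)) h
  · rintro ⟨c, hc, y, hy, hy0, rfl⟩
    exact ⟨c, hc, ⟨y, hy⟩, hy0, rfl⟩
  · rintro ⟨c, hc, y, hy0, rfl⟩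
    exact ⟨c, hc, y, y.2, hy0, rfl⟩

variable {ξ}

lemma isNoetherianRing_dilLocRing {C : Subalgebra R (K ⊗[k] B)} (hC : C.FG) {r : ℕ}
    (κ : PrimeSpectrum (DilRing ξ C r)) : IsNoetherianRing (DilLocRing κ) := by
  have : Algebra.FiniteType R (DilRing ξ C r) :=
    (Subalgebra.fg_iff_finiteType _).1 (dilatation_fg ξ hC r)
  have : IsNoetherianRing (DilRing ξ C r) := Algebra.FiniteType.isNoetherianRing R _
  exact IsLocalization.isNoetherianRing κ.asIdeal.primeCompl _ inferInstance

lemma resHom_surjective {C : Subalgebra R (K ⊗[k] B)} {r : ℕ}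
    (κ : PrimeSpectrum (DilRing ξ C r)) : Function.Surjective (resHom κ) :=
  AdicCompletion.evalOneₐ_surjective _

lemma resHom_algebraMap {C : Subalgebra R (K ⊗[k] B)} {r : ℕ}
    (κ : PrimeSpectrum (DilRing ξ C r)) (x : DilLocRing κ) :
    resHom κ (algebraMap _ _ x) = IsLocalRing.residue _ x :=
  AdicCompletion.evalOneₐ_of _ x

end Noetherian


/-! ### Derivations of the completed local ring -/

section DerivationAlong

/-- `d` is a derivation with values in `Q`, regarded as an `A`-module through `f : A → Q`. -/
def IsDerivationAlong {A Q : Type*} [CommRing A] [CommRing Q] (f : A →+* Q) (d : A →+ Q) : Prop :=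
  ∀ a b, d (a * b) = f a * d b + f b * d a

/-- A derivation extends to a localization. -/
lemma IsDerivationAlong.exists_localization {A₀ A Q : Type*} [CommRing A₀] [CommRing A]
    [CommRing Q] [Algebra A₀ A] (M : Submonoid A₀) [IsLocalization M A] {f : A →+* Q}
    {d : A₀ →+ Q} (hd : IsDerivationAlong (f.comp (algebraMap A₀ A)) d) :
    ∃ d' : A →+ Q, IsDerivationAlong f d' ∧ ∀ a, d' (algebraMap A₀ A a) = d a := by
  have hd1 : d 1 = 0 := by
    have := hd 1 1
    simpa using this
  -- a derivation `d` along `f` is the same as the homomorphism `f + ε d` to the dual numbers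
  let φ : A₀ →+* TrivSqZeroExt Q Q :=
    { toFun := fun a => TrivSqZeroExt.inl (f (algebraMap A₀ A a)) + TrivSqZeroExt.inr (d a)
      map_one' := by ext <;> simp [hd1]
      map_mul' := fun a b => by
        ext
        · simp
        · have := hd a b
          simp only [RingHom.comp_apply] at this
          simp [this, mul_comm (d a)]
      map_zero' := by ext <;> simp
      map_add' := fun a b => by ext <;> simp }
  have hφ : ∀ y : M, IsUnit (φ y) := by
    intro y
    rw [TrivSqZeroExt.isUnit_iff_isUnit_fst]
    simpa [φ] using (IsLocalization.map_units A y).map f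
  let Φ : A →+* TrivSqZeroExt Q Q := IsLocalization.lift hφ
  have hΦ : ∀ a, Φ (algebraMap A₀ A a) = φ a := fun a => IsLocalization.lift_eq hφ a
  have hfst : ∀ a, (Φ a).fst = f a := by
    have : (TrivSqZeroExt.fstHom ℤ Q Q : TrivSqZeroExt Q Q →+* Q).comp Φ = f := by
      refine IsLocalization.ringHom_ext M (RingHom.ext fun a => ?_)
      simp [hΦ, φ]
    exact fun a => RingHom.congr_fun this a
  refine ⟨⟨⟨fun a => (Φ a).snd, by simp⟩, fun a b => by simp⟩, fun a b => ?_, fun a => ?_⟩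
  · simp [hfst, mul_comm (Φ a).snd]
  · simp [hΦ, φ]

lemma IsDerivationAlong.map_one {A Q : Type*} [CommRing A] [CommRing Q] {f : A →+* Q} {d : A →+ Q}
    (hd : IsDerivationAlong f d) : d 1 = 0 := by
  simpa using hd 1 1

lemma IsDerivationAlong.map_mem_pow {A Q : Type*} [CommRing A] [CommRing Q] {f : A →+* Q}
    {d : A →+ Q} (hd : IsDerivationAlong f d) {I : Ideal A} {J : Ideal Q} (h : I ≤ J.comap f)
    (n : ℕ) {a : A} (ha : a ∈ I ^ (n + 1)) : d a ∈ J ^ n := by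
  induction n generalizing a with
  | zero => simp
  | succ n ih =>
    rw [pow_succ] at ha
    induction ha using Submodule.mul_induction_on' with
    | mem_mul_mem x hx y hy =>
      rw [hd, pow_succ]
      refine Ideal.add_mem _ ?_ ?_
      · have := pow_le_comap h (n + 1) hx
        rw [Ideal.mem_comap, pow_succ] at this
        exact Ideal.mul_mem_right _ _ this
      · rw [mul_comm]
        exact Ideal.mul_mem_mul (Ideal.mem_comap.1 (h hy)) (ih hx)
    | add x _ y _ hx hy =>
      rw [map_add]
      exact add_mem hx hy

end DerivationAlong

section Completion

variable {k R : Type*} {K : Type*} {B : Type*} [Field k] [CommRing R] [IsDomain R]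
  [IsDiscreteValuationRing R] [Algebra k R]
  [Field K] [Algebra R K] [IsFractionRing R K]
  [Algebra k K] [IsScalarTower k R K] [CommRing B] [Algebra k B] {ξ : B →ₐ[k] R}

lemma locHom_algebraMap (b : B) : locHom ξ (algebraMap B (LocRing ξ) b) = ξ b := by
  simp [locHom]

lemma InducesIsoOnCompletions.exists_sub_mem (hξ : InducesIsoOnCompletions ξ) (n : ℕ) (a : R) :
    ∃ α, locHom ξ α - a ∈ IsLocalRing.maximalIdeal R ^ n := by
  obtain ⟨α', hα⟩ := (hξ n).2 (Ideal.Quotient.mk _ a)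
  obtain ⟨α, rfl⟩ := Ideal.Quotient.mk_surjective α'
  exact ⟨α, Ideal.Quotient.eq.1 hα⟩

lemma InducesIsoOnCompletions.mem_of_map_mem (hξ : InducesIsoOnCompletions ξ) {n : ℕ}
    {α : LocRing ξ} (hα : locHom ξ α ∈ IsLocalRing.maximalIdeal R ^ n) :
    α ∈ IsLocalRing.maximalIdeal (LocRing ξ) ^ n := by
  rw [← Ideal.Quotient.eq_zero_iff_mem]
  apply (hξ n).1
  rw [map_zero]
  exact Ideal.Quotient.eq_zero_iff_mem.2 hα

variable [IsAdicComplete (IsLocalRing.maximalIdeal R) R]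

/-- A derivation on `B` along `ξ` extends by continuity to `R`, the completion of the local ring
of `B` at the centre of `ξ`. -/
lemma IsDerivationAlong.exists_completion (hξ : InducesIsoOnCompletions ξ) {d : B →+ R}
    (hd : IsDerivationAlong (ξ : B →+* R) d) :
    ∃ d' : R →+ R, IsDerivationAlong (RingHom.id R) d' ∧ ∀ b, d' (ξ b) = d b := by
  have hcomp : (ξ : B →+* R) = (locHom ξ).comp (algebraMap B (LocRing ξ)) := by
    ext b
    exact (locHom_algebraMap b).symm
  rw [hcomp] at hd
  obtain ⟨e, he, hed⟩ := hd.exists_localization (centre ξ).primeCompl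
  have hle := maximalIdeal_le_comap_locHom ξ
  set 𝔪 := IsLocalRing.maximalIdeal R
  -- `P a c`: the value at `a` of the extension by continuity is `c`
  let P : R → R → Prop := fun a c =>
    ∀ n, ∃ α, locHom ξ α - a ∈ 𝔪 ^ (n + 1) ∧ e α - c ∈ 𝔪 ^ n
  have hPα : ∀ {a c}, P a c → ∀ {n α}, locHom ξ α - a ∈ 𝔪 ^ (n + 1) → e α - c ∈ 𝔪 ^ n := by
    intro a c h n α hα
    obtain ⟨β, hβ, hβc⟩ := h n
    have h1 : α - β ∈ IsLocalRing.maximalIdeal (LocRing ξ) ^ (n + 1) := by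
      apply hξ.mem_of_map_mem
      rw [map_sub]
      simpa using sub_mem hα hβ
    have h2 := he.map_mem_pow hle n h1
    rw [map_sub] at h2
    simpa using add_mem h2 hβc
  have huniq : ∀ {a c c'}, P a c → P a c' → c = c' := by
    intro a c c' h h'
    rw [← sub_eq_zero]
    refine IsHausdorff.haus' (I := 𝔪) _ fun n => ?_
    rw [SModEq.zero, smul_eq_mul, Ideal.mul_top]
    obtain ⟨α, hα, hαc⟩ := h n
    simpa using sub_mem (hPα h' hα) hαc
  have hex : ∀ a, ∃ c, P a c := by
    intro a
    choose α hα using fun n => hξ.exists_sub_mem (n + 1) a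
    have hstep : ∀ {m n}, m ≤ n → e (α m) - e (α n) ∈ 𝔪 ^ m := by
      intro m n hmn
      rw [← map_sub]
      refine he.map_mem_pow hle m (hξ.mem_of_map_mem ?_)
      rw [map_sub]
      simpa using sub_mem (hα m) (Ideal.pow_le_pow_right (by omega) (hα n))
    obtain ⟨c, hc⟩ := IsPrecomplete.prec' (I := 𝔪) (fun n => e (α n)) fun {m n} hmn => by
      rw [smul_eq_mul, Ideal.mul_top, SModEq.sub_mem]
      exact hstep hmn
    refine ⟨c, fun n => ⟨α n, hα n, ?_⟩⟩
    have := hc n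
    rwa [smul_eq_mul, Ideal.mul_top, SModEq.sub_mem] at this
  choose c hc using hex
  have hadd : ∀ a b, c (a + b) = c a + c b := by
    intro a b
    refine huniq (hc _) fun n => ?_
    obtain ⟨α, hα, hα'⟩ := hc a n
    obtain ⟨β, hβ, hβ'⟩ := hc b n
    refine ⟨α + β, ?_, ?_⟩
    · rw [map_add, add_sub_add_comm]
      exact add_mem hα hβ
    · rw [map_add, add_sub_add_comm]
      exact add_mem hα' hβ'
  have hmul : ∀ a b, c (a * b) = a * c b + b * c a := by
    intro a b
    refine huniq (hc _) fun n => ?_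
    obtain ⟨α, hα, hα'⟩ := hc a n
    obtain ⟨β, hβ, hβ'⟩ := hc b n
    refine ⟨α * β, ?_, ?_⟩
    · rw [map_mul, show locHom ξ α * locHom ξ β - a * b =
        locHom ξ α * (locHom ξ β - b) + b * (locHom ξ α - a) by ring]
      exact add_mem (Ideal.mul_mem_left _ _ hβ) (Ideal.mul_mem_left _ _ hα)
    · rw [he, show locHom ξ α * e β + locHom ξ β * e α - (a * c b + b * c a) =
        locHom ξ α * (e β - c b) + c b * (locHom ξ α - a) +
          (locHom ξ β * (e α - c a) + c a * (locHom ξ β - b)) by ring]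
      have h1 := Ideal.pow_le_pow_right (I := 𝔪) (Nat.le_succ n) hα
      have h2 := Ideal.pow_le_pow_right (I := 𝔪) (Nat.le_succ n) hβ
      exact add_mem (add_mem (Ideal.mul_mem_left _ _ hβ') (Ideal.mul_mem_left _ _ h1))
        (add_mem (Ideal.mul_mem_left _ _ hα') (Ideal.mul_mem_left _ _ h2))
  refine ⟨AddMonoidHom.mk' c hadd, hmul, fun b => huniq (hc _) fun n => ?_⟩
  exact ⟨algebraMap B _ b, by simp [locHom_algebraMap], by simp [hed]⟩

variable (K) in
/-- A `k`-derivation on `B` along `ξ` induces a linear form on `Ω¹_K`. -/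
lemma IsDerivationAlong.exists_linearMap (hξ : InducesIsoOnCompletions ξ) {d : B →+ R}
    (hd : IsDerivationAlong (ξ : B →+* R) d) (hk : ∀ c : k, d (algebraMap k B c) = 0) :
    ∃ (d' : R →+ R) (T : Ω[K⁄k] →ₗ[K] K), IsDerivationAlong (RingHom.id R) d' ∧
      (∀ b, d' (ξ b) = d b) ∧
      ∀ a, T (KaehlerDifferential.D k K (algebraMap R K a)) = algebraMap R K (d' a) := by
  obtain ⟨d', hd', hdd'⟩ := hd.exists_completion hξ
  obtain ⟨e, he, hed⟩ := IsDerivationAlong.exists_localization (A := K) (nonZeroDivisors R)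
    (f := RingHom.id K) (d := (algebraMap R K : R →+ K).comp d') (fun a b => by
      simp [hd' a b])
  have hek : ∀ c : k, e (algebraMap k K c) = 0 := by
    intro c
    have h0 : d' (algebraMap k R c) = 0 := by rw [← ξ.commutes, hdd', hk]
    rw [IsScalarTower.algebraMap_apply k R K, hed]
    simp [h0]
  let D : Derivation k K K :=
    { toFun := e
      map_add' := map_add e
      map_smul' := fun c x => by
        rw [Algebra.smul_def, he, hek, mul_zero, add_zero, RingHom.id_apply, RingHom.id_apply,
          Algebra.smul_def]
      map_one_eq_zero' := he.map_one
      leibniz' := fun x y => he x y }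
  refine ⟨d', D.liftKaehlerDifferential, hd', hdd', fun a => ?_⟩
  rw [Derivation.liftKaehlerDifferential_comp_D]
  exact hed a

end Completion

section Forms

variable {k R K : Type*} [Field k] [CommRing R] [IsDomain R]
  [IsDiscreteValuationRing R] [Algebra k R] [Field K] [Algebra R K] [IsFractionRing R K]
  [Algebra k K] [IsScalarTower k R K]

lemma val_map_le_of_mem_filOmegaMod {d : R →+ R} {T : Ω[K⁄k] →ₗ[K] K}
    (hT : ∀ a, T (KaehlerDifferential.D k K (algebraMap R K a)) = algebraMap R K (d a))
    {n : ℤ} {ω : Ω[K⁄k]} (hω : ω ∈ filOmegaMod k R K n) :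
    val R K (T ω) ≤ WithZero.exp (n + 1) := by
  have hη : ∀ η : Ω[R⁄k], ∃ a, T (KaehlerDifferential.map k k R K η) = algebraMap R K a := by
    intro η
    have : η ∈ Submodule.span R (Set.range (KaehlerDifferential.D k R)) := by
      rw [KaehlerDifferential.span_range_derivation]
      trivial
    induction this using Submodule.span_induction with
    | mem x h =>
      obtain ⟨a, rfl⟩ := h
      exact ⟨d a, by rw [KaehlerDifferential.map_D, hT]⟩
    | zero => exact ⟨0, by simp⟩
    | add x y _ _ hx hy =>
      obtain ⟨a, ha⟩ := hx
      obtain ⟨b, hb⟩ := hy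
      exact ⟨a + b, by simp [ha, hb]⟩
    | smul r x _ hx =>
      obtain ⟨a, ha⟩ := hx
      refine ⟨r * a, ?_⟩
      rw [map_smul, ← algebraMap_smul K r, map_smul, ha, smul_eq_mul, map_mul]
  induction hω using Submodule.span_induction with
  | mem x h =>
    obtain ⟨c, hc, η, rfl⟩ := h
    obtain ⟨a, ha⟩ := hη η
    rw [map_smul, ha, smul_eq_mul, map_mul]
    exact (mul_le_mul' hc (val_le_one_iff.2 ⟨a, rfl⟩)).trans_eq (mul_one _)
  | zero => simp
  | add x y _ _ hx hy =>
    rw [map_add]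
    exact Valuation.map_add_le _ hx hy
  | smul r x _ hx =>
    rw [← algebraMap_smul K r, map_smul, smul_eq_mul, map_mul]
    exact (mul_le_of_le_one_left' (val_le_one_iff.2 ⟨r, rfl⟩)).trans hx

/-- A derivation of `R` preserving the maximal ideal takes integral values on logarithmic
differential forms. -/
lemma val_map_le_of_mem_filOmega {ϖ : R} (hϖ : Irreducible ϖ) {d : R →+ R} {T : Ω[K⁄k] →ₗ[K] K}
    (hT : ∀ a, T (KaehlerDifferential.D k K (algebraMap R K a)) = algebraMap R K (d a))
    (hdϖ : d ϖ ∈ IsLocalRing.maximalIdeal R)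
    {n : ℤ} {ω : Ω[K⁄k]} (hω : ω ∈ filOmega k R K n) :
    val R K (T ω) ≤ WithZero.exp n := by
  have hϖK : algebraMap R K ϖ ≠ 0 := by simpa using hϖ.ne_zero
  induction hω using Submodule.span_induction with
  | mem x h =>
    obtain ⟨c, hc, ⟨η, rfl⟩ | ⟨x, hx, rfl⟩⟩ := h
    · rw [map_smul, smul_eq_mul, map_mul]
      refine (mul_le_mul' hc ?_).trans_eq (mul_one _)
      have := val_map_le_of_mem_filOmegaMod (n := -1) hT
        (ω := KaehlerDifferential.map k k R K η)
        (Submodule.subset_span ⟨1, by simp, η, by simp⟩)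
      simpa using this
    · rw [map_smul, smul_eq_mul, map_mul]
      refine (mul_le_mul' hc ?_).trans_eq (mul_one _)
      obtain ⟨j, g, hj⟩ := exists_eq_zpow_mul_unit hϖ hx
      have hg : algebraMap R K g ≠ 0 := by simp
      have h1 := pow_sub_one_smul_D_zpow_mul (k := k) hϖK hg j hj le_rfl
      simp only [Nat.sub_self, pow_zero, one_smul, pow_one] at h1
      rw [hϖ.maximalIdeal_eq, Ideal.mem_span_singleton] at hdϖ
      obtain ⟨a, ha⟩ := hdϖ
      rw [val_le_one_iff]
      refine ⟨j * a + ↑g⁻¹ * d g, ?_⟩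
      have hg' : algebraMap R K ↑g⁻¹ = (algebraMap R K g)⁻¹ :=
        eq_inv_of_mul_eq_one_left (by rw [← map_mul, Units.inv_mul, map_one])
      rw [h1, map_smul, map_add]
      simp only [map_smul, hT, ha, map_add, map_mul, map_intCast, smul_eq_mul, hg']
      field_simp
  | zero => simp
  | add x y _ _ hx hy =>
    rw [map_add]
    exact Valuation.map_add_le _ hx hy
  | smul r x _ hx =>
    rw [← algebraMap_smul K r, map_smul, smul_eq_mul, map_mul]
    exact (mul_le_of_le_one_left' (val_le_one_iff.2 ⟨r, rfl⟩)).trans hx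

end Forms


/-! ### The restriction of the differential forms of the model to the completed local ring -/

section RestrictedForms

variable {k R : Type*} {K : Type*} {B : Type*} [Field k] [CommRing R] [CommRing B] [Algebra k B]
  [Algebra B R]

lemma liftBaseChange_kaehlerDifferential_ext {M : Type*} [AddCommGroup M] [Module R M]
    {f g : R ⊗[B] Ω[B⁄k] →ₗ[R] M}
    (h : ∀ b, f (1 ⊗ₜ KaehlerDifferential.D k B b) = g (1 ⊗ₜ KaehlerDifferential.D k B b)) :
    f = g := by
  ext p
  induction p using TensorProduct.induction_on with
  | zero => simp
  | add x y hx hy => rw [map_add, map_add, hx, hy]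
  | tmul a ω =>
    have hω : ω ∈ Submodule.span B (Set.range (KaehlerDifferential.D k B)) := by
      rw [KaehlerDifferential.span_range_derivation]
      trivial
    induction hω using Submodule.span_induction generalizing a with
    | mem x hx =>
      obtain ⟨b, rfl⟩ := hx
      rw [← mul_one a, ← smul_eq_mul, ← TensorProduct.smul_tmul', map_smul, map_smul, h]
    | zero => simp
    | add x y _ _ hx hy => rw [TensorProduct.tmul_add, map_add, map_add, hx, hy]
    | smul b x _ hx =>
      rw [← TensorProduct.smul_tmul]
      exact hx _

/-- A `k`-derivation on `B` along `B → R` with values in an `R`-module factors through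
`R ⊗ Ω¹_B`. -/
lemma exists_liftBaseChange_kaehlerDifferential {E : Type*} [AddCommGroup E] [Module R E]
    (d : B →+ E)
    (hd : ∀ a b, d (a * b) = algebraMap B R a • d b + algebraMap B R b • d a)
    (hk : ∀ c : k, d (algebraMap k B c) = 0) :
    ∃ l : R ⊗[B] Ω[B⁄k] →ₗ[R] E, ∀ b, l (1 ⊗ₜ KaehlerDifferential.D k B b) = d b := by
  let : Module B E := Module.compHom E (algebraMap B R)
  let : Module k E := Module.compHom E (algebraMap k B)
  have : IsScalarTower B R E := ⟨fun b a e => by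
    rw [Algebra.smul_def, mul_smul]
    rfl⟩
  have : IsScalarTower k B E := ⟨fun c b e => by
    rw [Algebra.smul_def, mul_smul]
    rfl⟩
  let D : Derivation k B E :=
    { toFun := d
      map_add' := map_add d
      map_smul' := fun c x => by
        rw [Algebra.smul_def, hd, hk, smul_zero, add_zero]
        rfl
      map_one_eq_zero' := by simpa using hd 1 1
      leibniz' := fun x y => hd x y }
  refine ⟨LinearMap.liftBaseChange R D.liftKaehlerDifferential, fun b => ?_⟩
  rw [LinearMap.liftBaseChange_tmul, one_smul, Derivation.liftKaehlerDifferential_comp_D]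
  rfl

variable [Algebra k R] [Field K] [Algebra R K] [Algebra k K] [IsScalarTower k R K]

variable (k B K) in
/-- The map `R ⊗ Ω¹_B → Ω¹_K`. -/
def formToOmega [IsScalarTower k B R] : R ⊗[B] Ω[B⁄k] →ₗ[R] Ω[K⁄k] :=
  (KaehlerDifferential.map k k R K) ∘ₗ (KaehlerDifferential.mapBaseChange k B R)

lemma formToOmega_tmul_D [IsScalarTower k B R] (b : B) :
    formToOmega k K B ((1 : R) ⊗ₜ[B] KaehlerDifferential.D k B b) =
      KaehlerDifferential.D k K (algebraMap R K (algebraMap B R b)) := by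
  simp [formToOmega]

variable [IsDomain R] [IsDiscreteValuationRing R] [IsFractionRing R K]

/-- In a projective module over a local ring, an element on which all linear forms take values in
the maximal ideal vanishes modulo the maximal ideal. -/
lemma map_eq_zero_of_forall_mem {P E : Type*} [AddCommGroup P] [Module R P] [Module.Projective R P]
    [AddCommGroup E] [Module R E] {p : P}
    (hp : ∀ φ : P →ₗ[R] R, φ p ∈ IsLocalRing.maximalIdeal R) (l : P →ₗ[R] E)
    (hl : ∀ a ∈ IsLocalRing.maximalIdeal R, ∀ q, a • l q = 0) : l p = 0 := by
  obtain ⟨s, hs⟩ := Module.projective_def'.1 (inferInstance : Module.Projective R P)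
  have h1 : Finsupp.linearCombination R id (s p) = p := LinearMap.congr_fun hs p
  rw [← h1, Finsupp.linearCombination_apply, Finsupp.sum, map_sum]
  refine Finset.sum_eq_zero fun q _ => ?_
  rw [map_smul]
  exact hl _ (hp (Finsupp.lapply q ∘ₗ s)) _

lemma mem_maximalIdeal_of_val_le {ϖ : R} (hϖ : Irreducible ϖ) {r : ℕ} {a : R}
    (h : val R K ((algebraMap R K ϖ ^ r)⁻¹ * algebraMap R K a) ≤ WithZero.exp (r - 1 : ℤ)) :
    a ∈ IsLocalRing.maximalIdeal R := by
  have h1 : val R K (algebraMap R K a) ≤ WithZero.exp (-1 : ℤ) := by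
    have h2 : algebraMap R K a =
        algebraMap R K ϖ ^ r * ((algebraMap R K ϖ ^ r)⁻¹ * algebraMap R K a) := by
      have : algebraMap R K ϖ ≠ 0 := by simpa using hϖ.ne_zero
      field_simp
    rw [h2, map_mul, map_pow, val_uniformizer hϖ, ← WithZero.exp_nsmul]
    refine (mul_le_mul' le_rfl h).trans_eq ?_
    rw [← WithZero.exp_add]
    congr 1
    simp only [smul_neg, nsmul_eq_mul, mul_one]
    ring
  have h2 : val R K (algebraMap R K a) < 1 :=
    h1.trans_lt (by rw [← WithZero.exp_zero, WithZero.exp_lt_exp]; norm_num)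
  exact (IsDedekindDomain.HeightOneSpectrum.valuation_lt_one_iff_mem _ a).1 h2

variable {ξ : B →ₐ[k] R}

/-- As the residue field is formally smooth over `k`, the differential of a uniformizer is not
divisible by the uniformizer. -/
lemma exists_form_uniformizer [Module.Projective R (R ⊗[B] Ω[B⁄k])] [PerfectField k]
    [Algebra.EssFiniteType k (IsLocalRing.ResidueField R)]
    (hξB : ∀ b, algebraMap B R b = ξ b) {t : B} (ht : Irreducible (ξ t)) :
    ∃ φ : R ⊗[B] Ω[B⁄k] →ₗ[R] R, φ (1 ⊗ₜ KaehlerDifferential.D k B t) = 1 := by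
  set 𝔪 := IsLocalRing.maximalIdeal R with h𝔪
  suffices h : ∃ φ : R ⊗[B] Ω[B⁄k] →ₗ[R] R, φ (1 ⊗ₜ KaehlerDifferential.D k B t) ∉ 𝔪 by
    obtain ⟨φ, hφ⟩ := h
    obtain ⟨i, hi⟩ := (IsLocalRing.notMem_maximalIdeal.1 hφ).exists_left_inv
    exact ⟨i • φ, hi⟩
  by_contra! hcon
  let g : R ⧸ 𝔪 ^ 2 →ₐ[k] IsLocalRing.ResidueField R :=
    Ideal.Quotient.liftₐ (𝔪 ^ 2) (IsScalarTower.toAlgHom k R (IsLocalRing.ResidueField R))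
      (fun a ha => by
        have := Ideal.pow_le_self two_ne_zero ha
        exact (IsLocalRing.residue_eq_zero_iff a).2 this)
  have hg : ∀ a, g (Ideal.Quotient.mk _ a) = IsLocalRing.residue R a := fun a => rfl
  have hker : ∀ x y, g x = 0 → g y = 0 → x * y = 0 := by
    intro x y hx hy
    obtain ⟨a, rfl⟩ := Ideal.Quotient.mk_surjective x
    obtain ⟨b, rfl⟩ := Ideal.Quotient.mk_surjective y
    rw [hg, IsLocalRing.residue_eq_zero_iff] at hx hy
    rw [← map_mul, Ideal.Quotient.eq_zero_iff_mem, pow_two]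
    exact Ideal.mul_mem_mul hx hy
  let σ : IsLocalRing.ResidueField R →ₐ[k] R ⧸ 𝔪 ^ 2 :=
    Algebra.FormallySmooth.liftOfSurjective (AlgHom.id k _) g
      (fun x => by
        obtain ⟨a, rfl⟩ := IsLocalRing.residue_surjective x
        exact ⟨Ideal.Quotient.mk _ a, rfl⟩)
      ⟨2, by
        refine (pow_two _).trans (eq_bot_iff.2 (Ideal.mul_le.2 fun x hx y hy => ?_))
        exact hker x y hx hy⟩
  have hσ : ∀ x, g (σ x) = x := fun x =>
    Algebra.FormallySmooth.liftOfSurjective_apply _ _ _ _ _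
  let d : B →+ R ⧸ 𝔪 ^ 2 := AddMonoidHom.mk'
    (fun b => Ideal.Quotient.mk _ (ξ b) - σ (IsLocalRing.residue R (ξ b)))
    (fun a b => by simp only [map_add]; ring)
  have hgd : ∀ b, g (d b) = 0 := fun b => by
    simp only [d, AddMonoidHom.mk'_apply, map_sub, hσ, hg, sub_self]
  obtain ⟨l, hl⟩ := exists_liftBaseChange_kaehlerDifferential (k := k) d (fun a b => by
    have := hker _ _ (hgd a) (hgd b)
    simp only [d, AddMonoidHom.mk'_apply] at this ⊢
    rw [hξB, hξB, Algebra.smul_def, Algebra.smul_def]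
    simp only [map_mul, Ideal.Quotient.algebraMap_eq]
    linear_combination -this) (fun c => by
    simp only [d, AddMonoidHom.mk'_apply, ξ.commutes]
    have : IsLocalRing.residue R (algebraMap k R c) = algebraMap k _ c := rfl
    rw [this, σ.commutes]
    exact sub_self _)
  have hgl : ∀ q, g (l q) = 0 := by
    let f : R ⧸ 𝔪 ^ 2 →ₗ[R] IsLocalRing.ResidueField R :=
      { toFun := g
        map_add' := map_add g
        map_smul' := fun a x => by
          rw [Algebra.smul_def, map_mul, Algebra.smul_def]
          rfl }
    have : f ∘ₗ l = 0 := liftBaseChange_kaehlerDifferential_ext fun b => by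
      rw [LinearMap.comp_apply, hl]
      exact hgd b
    exact fun q => LinearMap.congr_fun this q
  have h := map_eq_zero_of_forall_mem hcon l (fun a ha q => by
    rw [Algebra.smul_def]
    refine hker _ _ ?_ (hgl q)
    rw [Ideal.Quotient.algebraMap_eq, hg]
    exact (IsLocalRing.residue_eq_zero_iff a).2 ha)
  have ht0 : IsLocalRing.residue R (ξ t) = 0 :=
    (IsLocalRing.residue_eq_zero_iff _).2 ((IsLocalRing.mem_maximalIdeal _).2 ht.not_isUnit)
  rw [hl] at h
  simp only [d, AddMonoidHom.mk'_apply, ht0, map_zero, sub_zero] at h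
  rw [Ideal.Quotient.eq_zero_iff_mem, h𝔪, ht.maximalIdeal_eq, Ideal.span_singleton_pow,
    Ideal.mem_span_singleton, pow_two] at h
  exact ht.not_isUnit (isUnit_of_dvd_unit ((mul_dvd_mul_iff_left ht.ne_zero).1 (by simpa using h))
    isUnit_one)

variable [IsScalarTower k B R] [IsAdicComplete (IsLocalRing.maximalIdeal R) R]

variable (K) in
lemma exists_linearMap_of_form (hξ : InducesIsoOnCompletions ξ) (hξB : ∀ b, algebraMap B R b = ξ b)
    (φ : R ⊗[B] Ω[B⁄k] →ₗ[R] R) :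
    ∃ (d : R →+ R) (T : Ω[K⁄k] →ₗ[K] K),
      (∀ b, d (ξ b) = φ (1 ⊗ₜ KaehlerDifferential.D k B b)) ∧
      (∀ a, T (KaehlerDifferential.D k K (algebraMap R K a)) = algebraMap R K (d a)) ∧
      ∀ q, T (formToOmega k K B q) = algebraMap R K (φ q) := by
  let d₀ : B →+ R := AddMonoidHom.mk' (fun b => φ (1 ⊗ₜ KaehlerDifferential.D k B b))
    (fun a b => by rw [map_add, TensorProduct.tmul_add, map_add])
  have hd₀ : IsDerivationAlong (ξ : B →+* R) d₀ := by
    intro a b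
    have h : ∀ (a : B) ω, φ (1 ⊗ₜ (a • ω)) = ξ a * φ (1 ⊗ₜ ω) := by
      intro a ω
      rw [← TensorProduct.smul_tmul, ← hξB, ← smul_eq_mul, ← map_smul, TensorProduct.smul_tmul',
        Algebra.smul_def, smul_eq_mul]
    simp only [d₀, AddMonoidHom.mk'_apply]
    rw [Derivation.leibniz, TensorProduct.tmul_add, map_add, h, h]
    rfl
  obtain ⟨d, T, -, hd, hT⟩ := hd₀.exists_linearMap K hξ (fun c => by simp [d₀])
  refine ⟨d, T, hd, hT, ?_⟩
  have : (T.restrictScalars R) ∘ₗ formToOmega k K B = (Algebra.linearMap R K) ∘ₗ φ := by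
    refine liftBaseChange_kaehlerDifferential_ext fun b => ?_
    simp only [LinearMap.comp_apply, LinearMap.restrictScalars_apply, formToOmega_tmul_D, hT,
      Algebra.linearMap_apply]
    rw [hξB, hd]
    rfl
  exact fun q => LinearMap.congr_fun this q

variable [Module.Projective R (R ⊗[B] Ω[B⁄k])]

/-- The reduction of a form in `R ⊗ Ω¹_B` is determined by the class of its image in `Ω¹_K`. -/
lemma map_eq_zero_of_mem_filOmegaMod (hξ : InducesIsoOnCompletions ξ)
    (hξB : ∀ b, algebraMap B R b = ξ b) {ϖ : R} (hϖ : Irreducible ϖ) {E : Type*}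
    [AddCommGroup E] [Module R E] (l : R ⊗[B] Ω[B⁄k] →ₗ[R] E)
    (hl : ∀ a ∈ IsLocalRing.maximalIdeal R, ∀ q, a • l q = 0) {r : ℕ} {q : R ⊗[B] Ω[B⁄k]}
    (hq : (algebraMap R K ϖ ^ r)⁻¹ • formToOmega k K B q ∈ filOmegaMod k R K (r - 2)) :
    l q = 0 := by
  refine map_eq_zero_of_forall_mem (fun φ => ?_) l hl
  obtain ⟨d, T, -, hT, hTφ⟩ := exists_linearMap_of_form K hξ hξB φ
  have h := val_map_le_of_mem_filOmegaMod hT hq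
  rw [map_smul, hTφ, smul_eq_mul, show (r - 2 + 1 : ℤ) = r - 1 by ring] at h
  exact mem_maximalIdeal_of_val_le hϖ h

/-- Logarithmic analogue of `map_eq_zero_of_mem_filOmegaMod`. -/
lemma map_eq_zero_of_mem_filOmega [PerfectField k]
    [Algebra.EssFiniteType k (IsLocalRing.ResidueField R)] (hξ : InducesIsoOnCompletions ξ)
    (hξB : ∀ b, algebraMap B R b = ξ b) {t : B} (ht : Irreducible (ξ t)) {E : Type*}
    [AddCommGroup E] [Module R E] (l : R ⊗[B] Ω[B⁄k] →ₗ[R] E)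
    (hl : ∀ a ∈ IsLocalRing.maximalIdeal R, ∀ q, a • l q = 0)
    (hlt : l (1 ⊗ₜ KaehlerDifferential.D k B t) = 0) {r : ℕ} {q : R ⊗[B] Ω[B⁄k]} {a : R}
    (hq : (algebraMap R K (ξ t) ^ r)⁻¹ • (formToOmega k K B q + algebraMap R K a •
      (algebraMap R K (ξ t))⁻¹ • KaehlerDifferential.D k K (algebraMap R K (ξ t))) ∈
        filOmega k R K (r - 1)) :
    l q = 0 ∧ a ∈ IsLocalRing.maximalIdeal R := by
  have hϖK : algebraMap R K (ξ t) ≠ 0 := by simpa using ht.ne_zero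
  obtain ⟨D₁, hD₁⟩ := exists_form_uniformizer hξB ht
  have key : ∀ φ : R ⊗[B] Ω[B⁄k] →ₗ[R] R, ∀ c, φ (1 ⊗ₜ KaehlerDifferential.D k B t) = ξ t * c →
      φ q + a * c ∈ IsLocalRing.maximalIdeal R := by
    intro φ c hφ
    obtain ⟨d, T, hd, hT, hTφ⟩ := exists_linearMap_of_form K hξ hξB φ
    have hdt : d (ξ t) = ξ t * c := by rw [hd, hφ]
    have h := val_map_le_of_mem_filOmega ht hT (by
      rw [hdt]
      exact Ideal.mul_mem_right _ _ ((IsLocalRing.mem_maximalIdeal _).2 ht.not_isUnit)) hq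
    refine mem_maximalIdeal_of_val_le (K := K) (r := r) ht ?_
    have h2 : T ((algebraMap R K (ξ t) ^ r)⁻¹ • (formToOmega k K B q + algebraMap R K a •
        (algebraMap R K (ξ t))⁻¹ • KaehlerDifferential.D k K (algebraMap R K (ξ t)))) =
        (algebraMap R K (ξ t) ^ r)⁻¹ * algebraMap R K (φ q + a * c) := by
      simp only [map_smul, map_add, hTφ, hT, hdt, smul_eq_mul, map_mul, inv_mul_cancel_left₀ hϖK]
    rwa [h2] at h
  refine ⟨?_, ?_⟩
  · have h := map_eq_zero_of_forall_mem
      (p := q - D₁ q • (1 ⊗ₜ[B] KaehlerDifferential.D k B t : R ⊗[B] Ω[B⁄k])) (fun φ => by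
        have := key (φ - φ (1 ⊗ₜ KaehlerDifferential.D k B t) • D₁) 0 (by simp [hD₁])
        simpa [mul_comm] using this) l hl
    rwa [map_sub, map_smul, hlt, smul_zero, sub_zero] at h
  · have := key (ξ t • D₁) 1 (by simp [hD₁])
    rw [mul_one, LinearMap.smul_apply, smul_eq_mul] at this
    have h2 : ξ t * D₁ q ∈ IsLocalRing.maximalIdeal R :=
      Ideal.mul_mem_right _ _ ((IsLocalRing.mem_maximalIdeal _).2 ht.not_isUnit)
    simpa using sub_mem this h2

end RestrictedForms


/-! ### Residues of the functions on the dilatation -/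

section Residues

variable {k R : Type*} {K : Type*} {B : Type*} [Field k] [CommRing R] [Algebra k R] [Field K]
  [Algebra R K] [Algebra k K] [IsScalarTower k R K] [CommRing B] [Algebra k B] {ξ : B →ₐ[k] R}

lemma graphHom_tmul (c : K) (b : B) :
    graphHom K ξ (c ⊗ₜ b) = c * algebraMap R K (ξ b) := by
  simp [graphHom]

lemma graphHom_algebraMap (a : R) : graphHom K ξ (algebraMap R _ a) = algebraMap R K a := by
  rw [IsScalarTower.algebraMap_apply R K (K ⊗[k] B), AlgHom.commutes]
  rfl

lemma conormalToOmega_tmul (c : K) (b : B) : conormalToOmega ξ (c ⊗ₜ b) =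
    c • KaehlerDifferential.D k K (algebraMap R K (ξ b)) := by
  simp [conormalToOmega]

lemma conormalToOmega_algebraMap (a : R) :
    conormalToOmega ξ (algebraMap R (K ⊗[k] B) a) = 0 := by
  rw [IsScalarTower.algebraMap_apply R K (K ⊗[k] B), Algebra.TensorProduct.algebraMap_apply,
    conormalToOmega_tmul]
  simp

lemma conormalToOmega_mul (y z : K ⊗[k] B) : conormalToOmega ξ (y * z) =
    graphHom K ξ y • conormalToOmega ξ z + graphHom K ξ z • conormalToOmega ξ y := by
  induction y using TensorProduct.induction_on with
  | zero => simp
  | add y y' hy hy' =>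
    rw [add_mul, map_add, hy, hy', map_add, map_add, add_smul, smul_add]
    abel
  | tmul c b =>
    induction z using TensorProduct.induction_on with
    | zero => simp
    | add z z' hz hz' =>
      rw [mul_add, map_add, hz, hz', map_add, map_add, add_smul, smul_add]
      abel
    | tmul c' b' =>
      rw [Algebra.TensorProduct.tmul_mul_tmul]
      simp only [conormalToOmega_tmul, graphHom_tmul, map_mul, Derivation.leibniz, smul_add,
        smul_smul]
      congr 2 <;> ring

variable [IsDomain R] [IsDiscreteValuationRing R] [IsFractionRing R K]
  {C : Subalgebra R (K ⊗[k] B)} {r : ℕ}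

lemma mem_conormalTwist_iff {ϖ : R} (hϖ : Irreducible ϖ) {z : K ⊗[k] B} :
    z ∈ conormalTwist ξ C r ↔
      ∃ y ∈ C, graphHom K ξ y = 0 ∧ z = (algebraMap R K ϖ ^ r)⁻¹ • y := by
  constructor
  · rintro ⟨c, hc, y, hy, hy0, rfl⟩
    obtain ⟨a, rfl⟩ := val_mul_pow_le hϖ hc
    refine ⟨a • y, C.smul_mem hy a, ?_, ?_⟩
    · rw [Algebra.smul_def, map_mul, hy0, mul_zero]
    · rw [mul_comm, mul_smul, algebraMap_smul]
  · rintro ⟨y, hy, hy0, rfl⟩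
    exact ⟨_, val_inv_pow_le hϖ r, y, hy, hy0, rfl⟩

/-- For `y ∈ C` with value `g` along the graph, `π^{-r} (y - g)` is a function on the
dilatation. -/
lemma exists_incl_eq_inv_pow_smul_sub {ϖ : R} (hϖ : Irreducible ϖ) {y : K ⊗[k] B} (hy : y ∈ C)
    {g : R} (hg : graphHom K ξ y = algebraMap R K g) :
    ∃ w : DilRing ξ C r, DilRing.incl ξ C r w =
      (algebraMap R K ϖ ^ r)⁻¹ • (y - algebraMap R (K ⊗[k] B) g) ∧
      DilRing.incl ξ C r w ∈ conormalTwist ξ C r := by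
  have h : (algebraMap R K ϖ ^ r)⁻¹ • (y - algebraMap R (K ⊗[k] B) g) ∈
      conormalTwist ξ C r := by
    rw [mem_conormalTwist_iff hϖ]
    exact ⟨_, sub_mem hy (C.algebraMap_mem g), by rw [map_sub, hg, graphHom_algebraMap, sub_self],
      rfl⟩
  obtain ⟨w, hw⟩ := DilRing.exists_incl_eq ξ C r (conormalTwist_subset ξ C r h)
  exact ⟨w, hw, hw ▸ h⟩

variable (κ : PrimeSpectrum (DilRing ξ C r))

/-- The value at `κ` of a function on the dilatation. -/
abbrev resDil : DilRing ξ C r →+* IsLocalRing.ResidueField (DilLocRing κ) :=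
  algebraMap (DilRing ξ C r) (IsLocalRing.ResidueField (DilLocRing κ))

lemma resDil_apply (z : DilRing ξ C r) :
    resDil κ z = IsLocalRing.residue _ (algebraMap (DilRing ξ C r) (DilLocRing κ) z) := rfl

lemma resDil_smul (a : R) (z : DilRing ξ C r) : resDil κ (a • z) = a • resDil κ z := by
  rw [Algebra.smul_def, map_mul, Algebra.smul_def,
    IsScalarTower.algebraMap_apply R (DilRing ξ C r) (IsLocalRing.ResidueField (DilLocRing κ))]

variable {κ}

lemma resDil_algebraMap_eq_zero (hκ : κ ∈ fibreOverD ξ C r) {a : R}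
    (ha : a ∈ IsLocalRing.maximalIdeal R) : resDil κ (algebraMap R _ a) = 0 := by
  rw [resDil_apply, IsLocalRing.residue_eq_zero_iff]
  exact (algebraMap_mem_iff κ hκ a).2 ha

lemma smul_residueField_eq_zero (hκ : κ ∈ fibreOverD ξ C r) {a : R}
    (ha : a ∈ IsLocalRing.maximalIdeal R) (e : IsLocalRing.ResidueField (DilLocRing κ)) :
    a • e = 0 := by
  rw [Algebra.smul_def, IsScalarTower.algebraMap_apply R (DilRing ξ C r)]
  have := resDil_algebraMap_eq_zero hκ ha
  rw [resDil] at this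
  rw [this, zero_mul]

lemma fibreOverD_pos (hκ : κ ∈ fibreOverD ξ C r) : r ≠ 0 := by
  rintro rfl
  have := hκ 1 (by simp)
  rw [map_one] at this
  exact κ.isPrime.ne_top ((Ideal.eq_top_iff_one _).2 this)

lemma eq_add_of_incl_eq {ϖ : R} (hϖ : Irreducible ϖ) {y w : DilRing ξ C r} {g : R}
    (hw : DilRing.incl ξ C r w = (algebraMap R K ϖ ^ r)⁻¹ •
      (DilRing.incl ξ C r y - algebraMap R (K ⊗[k] B) g)) :
    y = algebraMap R _ g + algebraMap R _ (ϖ ^ r) * w := by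
  have hϖK : algebraMap R K ϖ ≠ 0 := by simpa using hϖ.ne_zero
  apply DilRing.incl_injective
  rw [map_add, map_mul, AlgHom.commutes, AlgHom.commutes, hw,
    IsScalarTower.algebraMap_apply R K (K ⊗[k] B) (ϖ ^ r), ← Algebra.smul_def, smul_smul,
    map_pow, mul_inv_cancel₀ (pow_ne_zero _ hϖK), one_smul, add_sub_cancel]

/-- The value of `y ∈ C` at `κ` is that of its restriction to the graph. -/
lemma resDil_eq_of_incl_eq {ϖ : R} (hϖ : Irreducible ϖ) (hκ : κ ∈ fibreOverD ξ C r)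
    {y w : DilRing ξ C r} {g : R}
    (hw : DilRing.incl ξ C r w = (algebraMap R K ϖ ^ r)⁻¹ •
      (DilRing.incl ξ C r y - algebraMap R (K ⊗[k] B) g)) :
    resDil κ y = resDil κ (algebraMap R _ g) := by
  have h0 : ϖ ^ r ∈ IsLocalRing.maximalIdeal R :=
    Ideal.pow_mem_of_mem _ ((IsLocalRing.mem_maximalIdeal _).2 hϖ.not_isUnit) r
      (Nat.pos_of_ne_zero (fibreOverD_pos hκ))
  rw [eq_add_of_incl_eq hϖ hw, map_add, map_mul, resDil_algebraMap_eq_zero hκ h0, zero_mul,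
    add_zero]

/-- `y ∈ C` has a restriction `g ∈ R` to the graph, and the pair formed by its differential and
the value of `π^{-r} (y - g)` at `κ` belongs to `N`. -/
def HasResidueIn (κ : PrimeSpectrum (DilRing ξ C r)) (ϖ : R)
    (N : Submodule R (Ω[K⁄k] × IsLocalRing.ResidueField (DilLocRing κ))) (y : K ⊗[k] B) : Prop :=
  y ∈ C ∧ ∃ g : R, graphHom K ξ y = algebraMap R K g ∧ ∃ w : DilRing ξ C r,
    DilRing.incl ξ C r w = (algebraMap R K ϖ ^ r)⁻¹ • (y - algebraMap R (K ⊗[k] B) g) ∧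
    (conormalToOmega ξ y, resDil κ w) ∈ N

variable {N : Submodule R (Ω[K⁄k] × IsLocalRing.ResidueField (DilLocRing κ))} {ϖ : R}

lemma hasResidueIn_algebraMap (a : R) : HasResidueIn κ ϖ N (algebraMap R _ a) :=
  ⟨C.algebraMap_mem a, a, graphHom_algebraMap a, 0, by simp, by
    rw [conormalToOmega_algebraMap, map_zero]
    exact N.zero_mem⟩

lemma HasResidueIn.add {y z : K ⊗[k] B} (hy : HasResidueIn κ ϖ N y) (hz : HasResidueIn κ ϖ N z) :
    HasResidueIn κ ϖ N (y + z) := by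
  obtain ⟨hyC, g, hg, w, hw, hN⟩ := hy
  obtain ⟨hzC, g', hg', w', hw', hN'⟩ := hz
  refine ⟨add_mem hyC hzC, g + g', by rw [map_add, map_add, hg, hg'], w + w', ?_, ?_⟩
  · rw [map_add, hw, hw', map_add, ← smul_add, add_sub_add_comm]
  · rw [map_add, map_add]
    exact N.add_mem hN hN'

/-- The defect of multiplicativity of `y ↦ π^{-r} (y - g)`, together with its effect on the
values at `κ`. -/
lemma exists_incl_mul_eq (hϖ : Irreducible ϖ) (hκ : κ ∈ fibreOverD ξ C r) {y z : K ⊗[k] B}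
    (hy : y ∈ C) {g g' : R} {w w' : DilRing ξ C r}
    (hw : DilRing.incl ξ C r w = (algebraMap R K ϖ ^ r)⁻¹ • (y - algebraMap R (K ⊗[k] B) g))
    (hw' : DilRing.incl ξ C r w' = (algebraMap R K ϖ ^ r)⁻¹ • (z - algebraMap R (K ⊗[k] B) g')) :
    ∃ v : DilRing ξ C r,
      DilRing.incl ξ C r v =
        (algebraMap R K ϖ ^ r)⁻¹ • (y * z - algebraMap R (K ⊗[k] B) (g * g')) ∧
      resDil κ v = g • resDil κ w' + g' • resDil κ w := by
  obtain ⟨Y, hY⟩ := DilRing.exists_incl_eq ξ C r (le_sup_left (a := C) hy)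
  refine ⟨Y * w' + algebraMap R _ g' * w, ?_, ?_⟩
  · rw [map_add, map_mul, map_mul, hY, hw, hw', AlgHom.commutes, mul_smul_comm, mul_smul_comm,
      ← smul_add, map_mul]
    congr 1
    ring
  · rw [map_add, map_mul, resDil_eq_of_incl_eq (y := Y) hϖ hκ (by rw [hw, hY]), ← map_mul,
      ← Algebra.smul_def, ← Algebra.smul_def, resDil_smul, resDil_smul]

lemma HasResidueIn.mul (hϖ : Irreducible ϖ) (hκ : κ ∈ fibreOverD ξ C r) {y z : K ⊗[k] B}
    (hy : HasResidueIn κ ϖ N y) (hz : HasResidueIn κ ϖ N z) : HasResidueIn κ ϖ N (y * z) := by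
  obtain ⟨hyC, g, hg, w, hw, hN⟩ := hy
  obtain ⟨hzC, g', hg', w', hw', hN'⟩ := hz
  obtain ⟨v, hv, hv'⟩ := exists_incl_mul_eq hϖ hκ hyC hw hw'
  refine ⟨mul_mem hyC hzC, g * g', by rw [map_mul, map_mul, hg, hg'], v, hv, ?_⟩
  rw [hv', conormalToOmega_mul, hg, hg', algebraMap_smul, algebraMap_smul]
  exact N.add_mem (N.smul_mem g hN') (N.smul_mem g' hN)

lemma HasResidueIn.of_mem_adjoin (hϖ : Irreducible ϖ) (hκ : κ ∈ fibreOverD ξ C r)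
    {s : Set (K ⊗[k] B)} (hs : ∀ y ∈ s, HasResidueIn κ ϖ N y) {y : K ⊗[k] B}
    (hy : y ∈ Algebra.adjoin R s) : HasResidueIn κ ϖ N y := by
  induction hy using Algebra.adjoin_induction with
  | mem y hy => exact hs y hy
  | algebraMap a => exact hasResidueIn_algebraMap a
  | add y z _ _ hy hz => exact hy.add hz
  | mul y z _ _ hy hz => exact hy.mul hϖ hκ hz

/-- Division by a function which does not vanish at the centre. -/
lemma HasResidueIn.of_mul (hϖ : Irreducible ϖ) (hκ : κ ∈ fibreOverD ξ C r) {y z : K ⊗[k] B}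
    (hy : HasResidueIn κ ϖ N y) (hunit : ∀ g : R, graphHom K ξ y = algebraMap R K g → IsUnit g)
    (hz : z ∈ C) {g' : R} (hg' : graphHom K ξ z = algebraMap R K g')
    (hyz : HasResidueIn κ ϖ N (y * z)) : HasResidueIn κ ϖ N z := by
  obtain ⟨hyC, g, hg, w, hw, hN⟩ := hy
  obtain ⟨w', hw', -⟩ := exists_incl_eq_inv_pow_smul_sub (r := r) hϖ hz hg'
  obtain ⟨v, hv, hv'⟩ := exists_incl_mul_eq hϖ hκ hyC hw hw'
  obtain ⟨-, g'', hg'', v', hv'', hN''⟩ := hyz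
  have h1 : g'' = g * g' := by
    apply IsFractionRing.injective R K
    rw [← hg'', map_mul, map_mul, hg, hg']
  have h2 : v' = v := DilRing.incl_injective ξ C r (by rw [hv'', hv, h1])
  refine ⟨hz, g', hg', w', hw', ?_⟩
  rw [h2, hv', conormalToOmega_mul, hg, hg', algebraMap_smul, algebraMap_smul] at hN''
  have h3 : g • (conormalToOmega ξ z, resDil κ w') ∈ N := by
    have := N.sub_mem hN'' (N.smul_mem g' hN)
    simpa using this
  obtain ⟨i, hi⟩ := (hunit g hg).exists_left_inv
  have := N.smul_mem i h3
  rwa [smul_smul, hi, one_smul] at this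

/-- The pairs formed by a differential form and a value at `κ` that come from the elements of
`𝔪^{-r} I`. -/
lemma HasResidueIn.mem_of_conormalTwist (hϖ : Irreducible ϖ)
    (hC : ∀ y ∈ C, HasResidueIn κ ϖ N y) {z : DilRing ξ C r}
    (hz : DilRing.incl ξ C r z ∈ conormalTwist ξ C r) :
    ∃ x ∈ N, conormalToOmega ξ (DilRing.incl ξ C r z) = (algebraMap R K ϖ ^ r)⁻¹ • x.1 ∧
      resDil κ z = x.2 := by
  obtain ⟨y, hy, hy0, hzy⟩ := (mem_conormalTwist_iff hϖ).1 hz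
  obtain ⟨-, g, hg, w, hw, hN⟩ := hC y hy
  have hg0 : g = 0 := by
    apply IsFractionRing.injective R K
    rw [← hg, hy0, map_zero]
  have hzw : z = w := DilRing.incl_injective ξ C r (by rw [hzy, hw, hg0, map_zero, sub_zero])
  exact ⟨_, hN, by rw [hzy, map_smul], by rw [hzw]⟩

end Residues


/-! ### The value at the generic point determined by the differential form -/

section Uniformizers

variable {k R : Type*} {B : Type*} [Field k] [CommRing R] [IsDomain R]
  [IsDiscreteValuationRing R] [Algebra k R] [CommRing B] [Algebra k B] {ξ : B →ₐ[k] R}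

lemma InducesIsoOnCompletions.exists_mul_eq_add (hξ : InducesIsoOnCompletions ξ) {ϖ : R}
    (hϖ : Irreducible ϖ) (n : ℕ) (a : R) :
    ∃ b s : B, IsUnit (ξ s) ∧ ∃ h, ξ s * a = ξ b + ϖ ^ n * h := by
  obtain ⟨α, hα⟩ := hξ.exists_sub_mem n a
  obtain ⟨⟨b, s⟩, hs⟩ := IsLocalization.surj (centre ξ).primeCompl α
  rw [hϖ.maximalIdeal_eq, Ideal.span_singleton_pow, Ideal.mem_span_singleton] at hα
  obtain ⟨h, hh⟩ := hα
  refine ⟨b, s, ?_, -(ξ s * h), ?_⟩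
  · by_contra hu
    exact s.2 ((IsLocalRing.mem_maximalIdeal _).2 hu)
  · have h1 := congrArg (locHom ξ) hs
    rw [map_mul, locHom_algebraMap, locHom_algebraMap] at h1
    linear_combination h1 - ξ s * hh

lemma InducesIsoOnCompletions.exists_irreducible (hξ : InducesIsoOnCompletions ξ) :
    ∃ t : B, Irreducible (ξ t) := by
  obtain ⟨ϖ, hϖ⟩ := IsDiscreteValuationRing.exists_irreducible R
  obtain ⟨b, s, hs, h, hb⟩ := hξ.exists_mul_eq_add hϖ 2 ϖ
  have h1 : IsUnit (ξ s - ϖ * h) := by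
    by_contra hu
    have h2 : ϖ * h ∈ IsLocalRing.maximalIdeal R :=
      Ideal.mul_mem_right _ _ ((IsLocalRing.mem_maximalIdeal _).2 hϖ.not_isUnit)
    have := add_mem ((IsLocalRing.mem_maximalIdeal _).2 hu) h2
    rw [sub_add_cancel] at this
    exact (IsLocalRing.mem_maximalIdeal _).1 this hs
  refine ⟨b, ?_⟩
  have h3 : ξ b = (ξ s - ϖ * h) * ϖ := by linear_combination -hb
  rw [h3]
  exact (irreducible_isUnit_mul h1).2 hϖ

/-- Locally at the centre, an element mapping to a uniformizer of `R` generates the ideal of the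
centre. -/
lemma InducesIsoOnCompletions.exists_mul_eq_mul [IsNoetherianRing B]
    (hξ : InducesIsoOnCompletions ξ) {t : B} (ht : Irreducible (ξ t)) {f : B}
    (hf : f ∈ centre ξ) : ∃ s h : B, IsUnit (ξ s) ∧ s * f = h * t := by
  set A := LocRing ξ
  set 𝔪 := IsLocalRing.maximalIdeal A
  have : IsNoetherianRing A := IsLocalization.isNoetherianRing (centre ξ).primeCompl _ inferInstance
  have hle : 𝔪 ≤ Ideal.span {algebraMap B A t} := by
    refine Submodule.le_of_le_smul_of_le_jacobson_bot (I := 𝔪) (IsNoetherian.noetherian _)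
      (IsLocalRing.maximalIdeal_le_jacobson _) fun α hα => ?_
    have h1 := maximalIdeal_le_comap_locHom ξ hα
    rw [Ideal.mem_comap, ht.maximalIdeal_eq, Ideal.mem_span_singleton] at h1
    obtain ⟨c, hc⟩ := h1
    obtain ⟨γ, hγ⟩ := hξ.exists_sub_mem 1 c
    have h2 : α - algebraMap B A t * γ ∈ 𝔪 ^ 2 := by
      apply hξ.mem_of_map_mem
      rw [map_sub, map_mul, locHom_algebraMap, hc, ← mul_sub, pow_two]
      refine Ideal.mul_mem_mul ((IsLocalRing.mem_maximalIdeal _).2 ht.not_isUnit) ?_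
      rw [← neg_sub, pow_one] at hγ
      exact neg_mem_iff.1 hγ
    rw [Submodule.mem_sup]
    refine ⟨algebraMap B A t * γ, Ideal.mul_mem_right _ _ (Ideal.mem_span_singleton_self _),
      α - algebraMap B A t * γ, ?_, by ring⟩
    rwa [pow_two] at h2
  have h1 : algebraMap B A f ∈ Ideal.span {algebraMap B A t} :=
    hle (by
      have := Ideal.mem_map_of_mem (algebraMap B (LocRing ξ)) hf
      rwa [Localization.AtPrime.map_eq_maximalIdeal] at this)
  rw [Ideal.mem_span_singleton] at h1
  obtain ⟨α, hα⟩ := h1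
  obtain ⟨⟨h, s⟩, hs⟩ := IsLocalization.surj (centre ξ).primeCompl α
  have h2 : algebraMap B A (s * f) = algebraMap B A (h * t) := by
    rw [map_mul, map_mul, hα, ← hs]
    ring
  obtain ⟨c, hc⟩ := (IsLocalization.eq_iff_exists (centre ξ).primeCompl A).1 h2
  have hunit : ∀ s : (centre ξ).primeCompl, IsUnit (ξ s) := fun s => by
    by_contra hu
    exact s.2 ((IsLocalRing.mem_maximalIdeal _).2 hu)
  refine ⟨c * s, c * h, ?_, by linear_combination hc⟩
  rw [map_mul]
  exact (hunit c).mul (hunit s)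

end Uniformizers

section Values

variable {k R : Type*} {K : Type*} {B : Type*} [Field k] [CommRing R] [IsDomain R]
  [IsDiscreteValuationRing R] [Algebra k R] [Field K] [Algebra R K] [IsFractionRing R K]
  [Algebra k K] [IsScalarTower k R K] [CommRing B] [Algebra k B] {ξ : B →ₐ[k] R}
  {C : Subalgebra R (K ⊗[k] B)} {r : ℕ} {κ : PrimeSpectrum (DilRing ξ C r)}

/-- The values at `κ` of the `π^{-r} (1 ⊗ b - ξ(b))` define an `R`-linear form on `R ⊗ Ω¹_B`. -/
lemma exists_linearMap_resDil [Algebra B R] (hξB : ∀ b, algebraMap B R b = ξ b) {ϖ : R}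
    (hϖ : Irreducible ϖ) (hC : prodAlg K ξ ≤ C) (hκ : κ ∈ fibreOverD ξ C r) :
    ∃ l : R ⊗[B] Ω[B⁄k] →ₗ[R] IsLocalRing.ResidueField (DilLocRing κ),
      ∀ b, ∀ w : DilRing ξ C r, DilRing.incl ξ C r w =
          (algebraMap R K ϖ ^ r)⁻¹ • ((1 : K) ⊗ₜ[k] b - algebraMap R (K ⊗[k] B) (ξ b)) →
        l (1 ⊗ₜ KaehlerDifferential.D k B b) = resDil κ w := by
  have hCb : ∀ b : B, (1 : K) ⊗ₜ[k] b ∈ C := fun b => hC (Algebra.subset_adjoin ⟨b, rfl⟩)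
  choose w hw _ using fun b : B => exists_incl_eq_inv_pow_smul_sub (C := C) (ξ := ξ) (r := r) hϖ
    (hCb b) (g := ξ b) (by rw [graphHom_tmul, one_mul])
  have huniq : ∀ b (w' : DilRing ξ C r), DilRing.incl ξ C r w' =
      (algebraMap R K ϖ ^ r)⁻¹ • ((1 : K) ⊗ₜ[k] b - algebraMap R (K ⊗[k] B) (ξ b)) → w b = w' :=
    fun b w' h => DilRing.incl_injective ξ C r (by rw [hw, h])
  let d : B →+ IsLocalRing.ResidueField (DilLocRing κ) :=
    AddMonoidHom.mk' (fun b => resDil κ (w b)) (fun a b => by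
      rw [← map_add]
      congr 1
      refine huniq _ _ ?_
      rw [map_add, hw, hw, ← smul_add, TensorProduct.tmul_add, map_add, map_add,
        add_sub_add_comm])
  obtain ⟨l, hl⟩ := exists_liftBaseChange_kaehlerDifferential (k := k) d (fun a b => by
    obtain ⟨v, hv, hv'⟩ := exists_incl_mul_eq hϖ hκ (hCb a) (hw a) (hw b)
    rw [hξB, hξB]
    refine Eq.trans (congrArg (resDil κ) (huniq (a * b) v ?_)) hv'
    rw [hv, Algebra.TensorProduct.tmul_mul_tmul, one_mul, map_mul ξ]) (fun c => by
    refine Eq.trans (congrArg (resDil κ) (huniq (algebraMap k B c) 0 ?_)) (map_zero _)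
    have : (1 : K) ⊗ₜ[k] algebraMap k B c = algebraMap R (K ⊗[k] B) (algebraMap k R c) := by
      rw [← IsScalarTower.algebraMap_apply]
      exact ((Algebra.TensorProduct.includeRight : B →ₐ[k] K ⊗[k] B).commutes c)
    rw [map_zero, this, ξ.commutes, sub_self, smul_zero])
  refine ⟨l, fun b w' hw' => ?_⟩
  rw [hl, ← huniq b w' hw']
  rfl

/-- In the non-logarithmic case, an element of `𝔪^{-r} I` whose differential form has a smaller
pole vanishes at `κ`. -/
lemma resDil_eq_zero_of_mem_filOmegaMod [Algebra.FormallySmooth k B]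
    [IsAdicComplete (IsLocalRing.maximalIdeal R) R] (hξ : InducesIsoOnCompletions ξ)
    {κ : PrimeSpectrum (DilRing ξ (prodAlg K ξ) r)} (hκ : κ ∈ fibreOverD ξ (prodAlg K ξ) r)
    {z : DilRing ξ (prodAlg K ξ) r}
    (hz : DilRing.incl ξ _ r z ∈ conormalTwist ξ (prodAlg K ξ) r)
    (hω : conormalToOmega ξ (DilRing.incl ξ _ r z) ∈ filOmegaMod k R K (r - 2)) :
    resDil κ z = 0 := by
  obtain ⟨ϖ, hϖ⟩ := IsDiscreteValuationRing.exists_irreducible R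
  let : Algebra B R := ξ.toRingHom.toAlgebra
  have hξB : ∀ b, algebraMap B R b = ξ b := fun _ => rfl
  have : IsScalarTower k B R := IsScalarTower.of_algebraMap_eq fun c => (ξ.commutes c).symm
  obtain ⟨l, hl⟩ := exists_linearMap_resDil hξB hϖ le_rfl hκ
  obtain ⟨x, ⟨q, rfl⟩, hx1, hx2⟩ := HasResidueIn.mem_of_conormalTwist
    (N := LinearMap.range ((formToOmega k K B).prod l)) hϖ (fun y hy => by
      refine HasResidueIn.of_mem_adjoin hϖ hκ ?_ hy
      rintro _ ⟨b, rfl⟩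
      obtain ⟨w, hw, -⟩ := exists_incl_eq_inv_pow_smul_sub (C := prodAlg K ξ) (ξ := ξ) (r := r) hϖ
        (Algebra.subset_adjoin ⟨b, rfl⟩) (g := ξ b) (by rw [graphHom_tmul, one_mul])
      refine ⟨Algebra.subset_adjoin ⟨b, rfl⟩, ξ b, by rw [graphHom_tmul, one_mul], w, hw,
        1 ⊗ₜ KaehlerDifferential.D k B b, ?_⟩
      rw [LinearMap.prod_apply, Function.prod_apply, formToOmega_tmul_D,
        hl b w hw, conormalToOmega_tmul, one_smul, hξB]) hz
  rw [hx1] at hω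
  rw [hx2]
  exact map_eq_zero_of_mem_filOmegaMod hξ hξB hϖ l
    (fun a ha q => smul_residueField_eq_zero hκ ha _) hω

/-- In the logarithmic case, an element of `𝔪^{-r} I` whose differential form has a smaller
logarithmic pole vanishes at `κ`. -/
lemma resDil_eq_zero_of_mem_filOmega [PerfectField k] [Algebra.Smooth k B]
    [Algebra.EssFiniteType k (IsLocalRing.ResidueField R)]
    [IsAdicComplete (IsLocalRing.maximalIdeal R) R] (hξ : InducesIsoOnCompletions ξ)
    {κ : PrimeSpectrum (DilRing ξ (logProdAlg K ξ) r)}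
    (hκ : κ ∈ fibreOverD ξ (logProdAlg K ξ) r) {z : DilRing ξ (logProdAlg K ξ) r}
    (hz : DilRing.incl ξ _ r z ∈ conormalTwist ξ (logProdAlg K ξ) r)
    (hω : conormalToOmega ξ (DilRing.incl ξ _ r z) ∈ filOmega k R K (r - 1)) :
    resDil κ z = 0 := by
  have : IsNoetherianRing B := Algebra.FiniteType.isNoetherianRing k B
  obtain ⟨t, ht⟩ := hξ.exists_irreducible
  have htK : algebraMap R K (ξ t) ≠ 0 := by simpa using ht.ne_zero
  let : Algebra B R := ξ.toRingHom.toAlgebra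
  have hξB : ∀ b, algebraMap B R b = ξ b := fun _ => rfl
  have : IsScalarTower k B R := IsScalarTower.of_algebraMap_eq fun c => (ξ.commutes c).symm
  obtain ⟨l, hl⟩ := exists_linearMap_resDil hξB ht (prodAlg_le_logProdAlg K ξ) hκ
  -- the function `τ = π^{-1} ⊗ t`, of value `1` along the graph
  have hval : val R K (algebraMap R K (ξ t))⁻¹ ≤ WithZero.exp (1 : ℤ) := by
    simpa using val_inv_pow_le (K := K) ht 1
  have hCf : ∀ f ∈ centre ξ, (algebraMap R K (ξ t))⁻¹ ⊗ₜ[k] f ∈ logProdAlg K ξ := fun f hf =>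
    le_sup_right (a := prodAlg K ξ) (Algebra.subset_adjoin ⟨_, hval, f, hf, rfl⟩)
  have htc : t ∈ centre ξ := (IsLocalRing.mem_maximalIdeal _).2 ht.not_isUnit
  have hgτ : graphHom K ξ ((algebraMap R K (ξ t))⁻¹ ⊗ₜ[k] t) = algebraMap R K 1 := by
    rw [graphHom_tmul, inv_mul_cancel₀ htK, map_one]
  obtain ⟨wτ, hwτ, -⟩ := exists_incl_eq_inv_pow_smul_sub (r := r) ht (hCf t htc) hgτ
  let N := LinearMap.range (((formToOmega k K B).prod l).coprod
    (LinearMap.toSpanSingleton R (Ω[K⁄k] × IsLocalRing.ResidueField (DilLocRing κ))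
      ((algebraMap R K (ξ t))⁻¹ • KaehlerDifferential.D k K (algebraMap R K (ξ t)),
        resDil κ wτ)))
  have hNb : ∀ b : B, HasResidueIn κ (ξ t) N ((1 : K) ⊗ₜ[k] b) := by
    intro b
    have hb : (1 : K) ⊗ₜ[k] b ∈ logProdAlg K ξ :=
      prodAlg_le_logProdAlg K ξ (Algebra.subset_adjoin ⟨b, rfl⟩)
    obtain ⟨w, hw, -⟩ := exists_incl_eq_inv_pow_smul_sub (r := r) ht hb (g := ξ b)
      (by rw [graphHom_tmul, one_mul])
    refine ⟨hb, ξ b, by rw [graphHom_tmul, one_mul], w, hw,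
      (1 ⊗ₜ KaehlerDifferential.D k B b, 0), ?_⟩
    rw [LinearMap.coprod_apply, map_zero, add_zero, LinearMap.prod_apply, Function.prod_apply,
      formToOmega_tmul_D, hl b w hw, conormalToOmega_tmul, one_smul, hξB]
  have hNτ : HasResidueIn κ (ξ t) N ((algebraMap R K (ξ t))⁻¹ ⊗ₜ[k] t) := by
    refine ⟨hCf t htc, 1, hgτ, wτ, hwτ, (0, 1), ?_⟩
    rw [LinearMap.coprod_apply, map_zero, zero_add, LinearMap.toSpanSingleton_apply, one_smul,
      conormalToOmega_tmul]
  have hNf : ∀ f ∈ centre ξ, HasResidueIn κ (ξ t) N ((algebraMap R K (ξ t))⁻¹ ⊗ₜ[k] f) := by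
    intro f hf
    obtain ⟨s, h, hs, hsf⟩ := hξ.exists_mul_eq_mul ht hf
    obtain ⟨g, hg⟩ := Ideal.mem_span_singleton.1 (ht.maximalIdeal_eq ▸ Ideal.mem_comap.1 hf)
    refine (hNb s).of_mul ht hκ (fun g hg => ?_) (hCf f hf) (g' := g) ?_ ?_
    · rw [graphHom_tmul, one_mul] at hg
      rwa [← IsFractionRing.injective R K hg]
    · rw [graphHom_tmul, show ξ f = ξ t * g from hg, map_mul, inv_mul_cancel_left₀ htK]
    · have := (hNb h).mul ht hκ hNτ
      rw [Algebra.TensorProduct.tmul_mul_tmul, one_mul] at this ⊢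
      rwa [hsf]
  obtain ⟨x, ⟨⟨q, a⟩, rfl⟩, hx1, hx2⟩ := HasResidueIn.mem_of_conormalTwist (N := N) ht
    (fun y hy => by
      rw [logProdAlg, prodAlg, ← Algebra.adjoin_union] at hy
      refine HasResidueIn.of_mem_adjoin ht hκ ?_ hy
      rintro _ (⟨b, rfl⟩ | ⟨c, hc, f, hf, rfl⟩)
      · exact hNb b
      · obtain ⟨a, ha⟩ := val_mul_pow_le (n := 1) ht (by simpa using hc)
        have : c ⊗ₜ[k] f = algebraMap R (K ⊗[k] B) a * (algebraMap R K (ξ t))⁻¹ ⊗ₜ[k] f := by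
          rw [← Algebra.smul_def, TensorProduct.smul_tmul', ha, pow_one, Algebra.smul_def]
        rw [this]
        exact (hasResidueIn_algebraMap a).mul ht hκ (hNf f hf)) hz
  -- `1 ⊗ t - π = π (τ - 1)`, so the value attached to `t` vanishes
  have hlt : l (1 ⊗ₜ KaehlerDifferential.D k B t) = 0 := by
    rw [hl t (algebraMap R _ (ξ t) * wτ), map_mul, resDil_algebraMap_eq_zero (a := ξ t) hκ htc, zero_mul]
    rw [map_mul, AlgHom.commutes, hwτ, mul_smul_comm, mul_sub]
    congr 2
    · rw [← Algebra.smul_def, TensorProduct.smul_tmul', Algebra.smul_def, mul_inv_cancel₀ htK]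
    · rw [map_one, mul_one]
  rw [LinearMap.coprod_apply, LinearMap.toSpanSingleton_apply, LinearMap.prod_apply,
    Function.prod_apply] at hx1 hx2
  simp only [Prod.fst_add, Prod.snd_add, Prod.smul_fst, Prod.smul_snd] at hx1 hx2
  rw [hx1, ← algebraMap_smul K a] at hω
  obtain ⟨h1, h2⟩ := map_eq_zero_of_mem_filOmega hξ hξB ht l
    (fun a ha q => smul_residueField_eq_zero hκ ha _) hlt hω
  rw [hx2, h1, smul_residueField_eq_zero hκ h2, add_zero]

end Values


/-! ### The two projections of the dilatation -/

section Projections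

variable {k R : Type*} {K : Type*} {B : Type*} [Field k] [CommRing R] [IsDomain R]
  [IsDiscreteValuationRing R] [Algebra k R] [Field K] [Algebra R K] [IsFractionRing R K]
  [Algebra k K] [IsScalarTower k R K] [CommRing B] [Algebra k B] {ξ : B →ₐ[k] R}
  {C : Subalgebra R (K ⊗[k] B)} {r : ℕ} (κ : PrimeSpectrum (DilRing ξ C r))

/-- The homomorphism from the coordinate ring of the dilatation to its completed local ring. -/
def toRKK : DilRing ξ C r →+* RKK κ :=
  (algebraMap (DilLocRing κ) (RKK κ)).comp (algebraMap (DilRing ξ C r) (DilLocRing κ))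

lemma toRKK_algebraMap (a : R) : toRKK κ (algebraMap R _ a) = uHom κ a := rfl

lemma resHom_toRKK (z : DilRing ξ C r) : resHom κ (toRKK κ z) = resDil κ z :=
  resHom_algebraMap κ _

lemma resHom_uHom_mul (a : R) (e : IsLocalRing.ResidueField (DilLocRing κ)) :
    resHom κ (uHom κ a) * e = a • e := by
  rw [← toRKK_algebraMap, resHom_toRKK, Algebra.smul_def,
    IsScalarTower.algebraMap_apply R (DilRing ξ C r) (IsLocalRing.ResidueField (DilLocRing κ))]

variable {κ}

lemma resHom_uHom_eq_zero (hκ : κ ∈ fibreOverD ξ C r) {a : R}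
    (ha : a ∈ IsLocalRing.maximalIdeal R) : resHom κ (uHom κ a) = 0 := by
  rw [← toRKK_algebraMap, resHom_toRKK, resDil_algebraMap_eq_zero hκ ha]

lemma vHom_apply (hξ : InducesIsoOnCompletions ξ) (hC : prodAlg K ξ ≤ C)
    (hκ : κ ∈ fibreOverD ξ C r) (b : B) :
    vHom κ hξ hC hκ (ξ b) = toRKK κ (prDil r hC b) := by
  refine AdicCompletion.ext_evalₐ fun n => ?_
  rw [vHom, AdicCompletion.evalₐ_liftRingHom]
  have h1 : (RingEquiv.ofBijective _ (hξ n)).symm (Ideal.Quotient.mk _ (ξ b)) =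
      Ideal.Quotient.mk _ (algebraMap B (LocRing ξ) b) := by
    rw [RingEquiv.symm_apply_eq]
    show _ = Ideal.Quotient.mk _ (locHom ξ (algebraMap B (LocRing ξ) b))
    rw [locHom_algebraMap]
  simp only [vLevel, RingHom.comp_apply, RingHom.coe_coe]
  rw [h1, Ideal.quotientMap_mk, prLocHom, IsLocalization.lift_eq]
  exact (AdicCompletion.evalₐ_of _ n _).symm

lemma vHom_eq_add (hξ : InducesIsoOnCompletions ξ) (hC : prodAlg K ξ ≤ C)
    (hκ : κ ∈ fibreOverD ξ C r) {ϖ : R} (hϖ : Irreducible ϖ) {b : B} {w : DilRing ξ C r}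
    (hw : DilRing.incl ξ C r w =
      (algebraMap R K ϖ ^ r)⁻¹ • ((1 : K) ⊗ₜ[k] b - algebraMap R (K ⊗[k] B) (ξ b))) :
    vHom κ hξ hC hκ (ξ b) = uHom κ (ξ b) + uHom κ ϖ ^ r * toRKK κ w := by
  rw [vHom_apply, eq_add_of_incl_eq (y := prDil r hC b) (g := ξ b) hϖ (by rw [hw, incl_prDil]),
    map_add, map_mul, toRKK_algebraMap, toRKK_algebraMap, map_pow]

variable (κ) in
/-- The pairs of a differential form and a value at `κ` which are attached, modulo `N`, to an
element of `𝔪^{-r} I`: the graph of `tMap κ N`, when this is well defined. -/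
def residueRel (N : Submodule R Ω[K⁄k]) :
    Submodule R (Ω[K⁄k] × IsLocalRing.ResidueField (DilLocRing κ)) where
  carrier := {x | ∃ z : DilRing ξ C r, DilRing.incl ξ C r z ∈ conormalTwist ξ C r ∧
    conormalToOmega ξ (DilRing.incl ξ C r z) - x.1 ∈ N ∧ x.2 = resDil κ z}
  zero_mem' := ⟨0, ⟨0, by simp, 0, C.zero_mem, by simp, by simp⟩, by simp, by simp⟩
  add_mem' := by
    rintro x x' ⟨z, hz, hN, he⟩ ⟨z', hz', hN', he'⟩
    obtain ⟨ϖ, hϖ⟩ := IsDiscreteValuationRing.exists_irreducible R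
    obtain ⟨y, hy, hy0, hzy⟩ := (mem_conormalTwist_iff hϖ).1 hz
    obtain ⟨y', hy', hy0', hzy'⟩ := (mem_conormalTwist_iff hϖ).1 hz'
    refine ⟨z + z', (mem_conormalTwist_iff hϖ).2 ⟨y + y', add_mem hy hy', ?_, ?_⟩, ?_, ?_⟩
    · rw [map_add, hy0, hy0', add_zero]
    · rw [map_add, hzy, hzy', smul_add]
    · rw [map_add, map_add, Prod.fst_add, add_sub_add_comm]
      exact N.add_mem hN hN'
    · rw [Prod.snd_add, he, he', map_add]
  smul_mem' := by
    rintro a x ⟨z, hz, hN, he⟩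
    obtain ⟨ϖ, hϖ⟩ := IsDiscreteValuationRing.exists_irreducible R
    obtain ⟨y, hy, hy0, hzy⟩ := (mem_conormalTwist_iff hϖ).1 hz
    refine ⟨a • z, (mem_conormalTwist_iff hϖ).2 ⟨a • y, C.smul_mem hy a, ?_, ?_⟩, ?_, ?_⟩
    · rw [Algebra.smul_def, map_mul, hy0, mul_zero]
    · rw [map_smul, hzy, smul_comm]
    · rw [map_smul, ← algebraMap_smul K a (DilRing.incl ξ C r z), map_smul, algebraMap_smul,
        Prod.smul_fst, ← smul_sub]
      exact N.smul_mem a hN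
    · rw [Prod.smul_snd, he, resDil_smul]

variable {N : Submodule R Ω[K⁄k]}

lemma mem_residueRel_of_mem {ω : Ω[K⁄k]} (hω : ω ∈ N) : (ω, 0) ∈ residueRel κ N :=
  ⟨0, ⟨0, by simp, 0, C.zero_mem, by simp, by simp⟩, by simpa using hω, by simp⟩

lemma tMap_eq_of_mem_residueRel
    (hN : ∀ z : DilRing ξ C r, DilRing.incl ξ C r z ∈ conormalTwist ξ C r →
      conormalToOmega ξ (DilRing.incl ξ C r z) ∈ N → resDil κ z = 0)
    {ω : Ω[K⁄k]} {e : IsLocalRing.ResidueField (DilLocRing κ)} (h : (ω, e) ∈ residueRel κ N) :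
    tMap κ N (Submodule.Quotient.mk ω) = e := by
  have hex : ∃ e : IsLocalRing.ResidueField (DilLocRing κ), ∃ z : DilRing ξ C r,
      DilRing.incl ξ C r z ∈ conormalTwist ξ C r ∧
      Submodule.Quotient.mk (conormalToOmega ξ (DilRing.incl ξ C r z)) =
        (Submodule.Quotient.mk ω : Ω[K⁄k] ⧸ N) ∧
      e = IsLocalRing.residue _ (algebraMap (DilRing ξ C r) (DilLocRing κ) z) := by
    obtain ⟨z, hz, hzN, he⟩ := h
    exact ⟨e, z, hz, (Submodule.Quotient.eq N).2 hzN, he⟩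
  obtain ⟨z, hz, hzω, hze⟩ := Classical.epsilon_spec hex
  have hmem : (ω, tMap κ N (Submodule.Quotient.mk ω)) ∈ residueRel κ N :=
    ⟨z, hz, (Submodule.Quotient.eq N).1 hzω, hze⟩
  obtain ⟨z', hz', hzN', he'⟩ := (residueRel κ N).sub_mem hmem h
  rw [Prod.mk_sub_mk, sub_self, sub_zero] at hzN'
  rw [← sub_eq_zero]
  exact he'.trans (hN z' hz' hzN')

/-- The differential of an element `g` of `R` corresponds to `π^{-r} (v(g) - u(g))`. -/
lemma exists_vHom_eq_add (hξ : InducesIsoOnCompletions ξ) (hC : prodAlg K ξ ≤ C)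
    (hκ : κ ∈ fibreOverD ξ C r) {t : B} (ht : Irreducible (ξ t))
    (hN : ∀ (c : K) (η : Ω[R⁄k]), val R K c ≤ WithZero.exp (r - 1 : ℤ) →
      c • KaehlerDifferential.map k k R K η ∈ N) (g : R) : ∃ w : RKK κ,
    vHom κ hξ hC hκ g = uHom κ g + uHom κ (ξ t) ^ r * w ∧
    ((algebraMap R K (ξ t) ^ r)⁻¹ • KaehlerDifferential.D k K (algebraMap R K g),
      resHom κ w) ∈ residueRel κ N := by
  have htK : algebraMap R K (ξ t) ≠ 0 := by simpa using ht.ne_zero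
  have htm : ξ t ∈ IsLocalRing.maximalIdeal R := (IsLocalRing.mem_maximalIdeal _).2 ht.not_isUnit
  have hr := fibreOverD_pos hκ
  have hCb : ∀ b : B, (1 : K) ⊗ₜ[k] b ∈ C := fun b => hC (Algebra.subset_adjoin ⟨b, rfl⟩)
  choose W hW hWc using fun b : B => exists_incl_eq_inv_pow_smul_sub (C := C) (ξ := ξ) (r := r) ht
    (hCb b) (g := ξ b) (by rw [graphHom_tmul, one_mul])
  have hvW := fun b => vHom_eq_add hξ hC hκ ht (hW b)
  obtain ⟨b, s, hs, h, hb⟩ := hξ.exists_mul_eq_add ht (r + 1) g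
  obtain ⟨a, ha⟩ := hs.exists_left_inv
  set V := vHom κ hξ hC hκ
  set U := uHom κ
  set ϖ := ξ t
  -- `v(π)` is divisible by `u(π)`
  obtain ⟨m, hm⟩ : ∃ m, V ϖ = U ϖ * m := by
    obtain ⟨r', rfl⟩ := Nat.exists_eq_succ_of_ne_zero hr
    exact ⟨1 + U ϖ ^ r' * toRKK κ (W t), by rw [hvW t, mul_add, mul_one, pow_succ']; ring⟩
  have hVa : V a * V (ξ s) = 1 := by rw [← map_mul, ha, map_one]
  have hUb : U (ξ s) * U g = U (ξ b) + U ϖ ^ (r + 1) * U h := by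
    rw [← map_mul, hb, map_add, map_mul, map_pow]
  have hVb : V (ξ s) * V g = V (ξ b) + V ϖ ^ (r + 1) * V h := by
    rw [← map_mul, hb, map_add, map_mul, map_pow]
  have hres0 : resHom κ (U ϖ) = 0 := resHom_uHom_eq_zero hκ htm
  refine ⟨V a * (toRKK κ (W b) - toRKK κ (W s) * U g + U ϖ * (m ^ (r + 1) * V h - U h)), ?_,
    a • (W b - g • W s), ?_, ?_, ?_⟩
  · have h1 : V g = V a * (V (ξ b) + V ϖ ^ (r + 1) * V h) := by
      rw [← hVb, ← mul_assoc, hVa, one_mul]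
    have h2 : U g = V a * V (ξ s) * U g := by rw [hVa, one_mul]
    rw [h1, hvW b, hm]
    rw [hvW s] at h2
    linear_combination -h2 - V a * hUb
  · rw [mem_conormalTwist_iff ht]
    refine ⟨a • (((1 : K) ⊗ₜ[k] b - algebraMap R (K ⊗[k] B) (ξ b)) -
      g • ((1 : K) ⊗ₜ[k] s - algebraMap R (K ⊗[k] B) (ξ s))), ?_, ?_, ?_⟩
    · refine C.smul_mem (sub_mem (sub_mem (hCb b) (C.algebraMap_mem _)) (C.smul_mem (sub_mem
        (hCb s) (C.algebraMap_mem _)) _)) _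
    · simp only [Algebra.smul_def, map_mul, map_sub, graphHom_tmul, graphHom_algebraMap, one_mul,
        sub_self, mul_zero]
    · rw [map_smul, map_sub, map_smul, hW, hW, smul_comm g, ← smul_sub, smul_comm a]
  · have h1 : conormalToOmega ξ (DilRing.incl ξ C r (a • (W b - g • W s))) =
        (algebraMap R K ϖ ^ r)⁻¹ • algebraMap R K a •
          (KaehlerDifferential.D k K (algebraMap R K (ξ b)) -
          algebraMap R K g • KaehlerDifferential.D k K (algebraMap R K (ξ s))) := by
      rw [map_smul (DilRing.incl ξ C r), map_sub, map_smul (DilRing.incl ξ C r), hW, hW,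
        ← algebraMap_smul K a, ← algebraMap_smul K g]
      simp only [map_smul, map_sub, conormalToOmega_tmul, conormalToOmega_algebraMap, one_smul,
        sub_zero]
      rw [smul_comm (algebraMap R K g), ← smul_sub, smul_comm (algebraMap R K a)]
    have h2 : KaehlerDifferential.D k K (algebraMap R K (ξ b)) =
        algebraMap R K (ξ s) • KaehlerDifferential.D k K (algebraMap R K g) +
        algebraMap R K g • KaehlerDifferential.D k K (algebraMap R K (ξ s)) -
        (algebraMap R K ϖ ^ (r + 1) • KaehlerDifferential.D k K (algebraMap R K h) +
          algebraMap R K h • (r + 1) • algebraMap R K ϖ ^ r •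
            KaehlerDifferential.D k K (algebraMap R K ϖ)) := by
      have h3 := congrArg (fun x => KaehlerDifferential.D k K (algebraMap R K x)) hb
      simp only [map_mul, map_add, map_pow, Derivation.leibniz, Derivation.leibniz_pow,
        Nat.add_sub_cancel] at h3
      rw [h3]
      abel
    have h4 : conormalToOmega ξ (DilRing.incl ξ C r (a • (W b - g • W s))) -
        (algebraMap R K ϖ ^ r)⁻¹ • KaehlerDifferential.D k K (algebraMap R K g) =
        (1 : K) • KaehlerDifferential.map k k R K (-(a • (ϖ • KaehlerDifferential.D k R h +
          h • (r + 1) • KaehlerDifferential.D k R ϖ))) := by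
      have ha' : algebraMap R K a * algebraMap R K (ξ s) = 1 := by rw [← map_mul, ha, map_one]
      have hϖ' : (algebraMap R K ϖ ^ r)⁻¹ * algebraMap R K ϖ ^ r = 1 :=
        inv_mul_cancel₀ (pow_ne_zero _ htK)
      rw [h1, h2, one_smul, map_neg, map_smul, map_add, map_smul, map_smul, map_nsmul,
        KaehlerDifferential.map_D, KaehlerDifferential.map_D]
      simp only [← algebraMap_smul K a, ← algebraMap_smul K ϖ, ← algebraMap_smul K h]
      linear_combination (norm := module)
        ha' • ((algebraMap R K ϖ ^ r)⁻¹ • KaehlerDifferential.D k K (algebraMap R K g)) -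
        hϖ' • (algebraMap R K a • (algebraMap R K ϖ • KaehlerDifferential.D k K (algebraMap R K h) +
          algebraMap R K h • (r + 1) • KaehlerDifferential.D k K (algebraMap R K ϖ)))
    rw [h4]
    refine hN _ _ ?_
    rw [map_one, ← WithZero.exp_zero, WithZero.exp_le_exp]
    omega
  · have h1 : resHom κ (V a) = resHom κ (U a) := by
      have h2 : resHom κ (V (ξ s)) = resHom κ (U (ξ s)) := by
        rw [hvW, map_add, map_mul, map_pow, hres0, zero_pow hr, zero_mul, add_zero]
      have h3 := congrArg (resHom κ) hVa
      rw [map_mul, h2, map_one] at h3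
      have h4 : resHom κ (U a) * resHom κ (U (ξ s)) = 1 := by
        rw [← map_mul, ← map_mul, ha, map_one, map_one]
      exact mul_right_cancel₀ (right_ne_zero_of_mul_eq_one h3) (h3.trans h4.symm)
    rw [map_mul, map_add, map_sub, map_mul, map_mul, hres0, zero_mul, add_zero, h1, resHom_toRKK,
      resHom_toRKK, mul_comm _ (resHom κ (U g)), resHom_uHom_mul, resHom_uHom_mul, resDil_smul,
      map_sub, resDil_smul]

/-- In the logarithmic case, `d log π` corresponds to `π^{-r} (v(π) / u(π) - 1)`. -/
lemma exists_vHom_uniformizer_eq_add (hξ : InducesIsoOnCompletions ξ)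
    {κ : PrimeSpectrum (DilRing ξ (logProdAlg K ξ) r)} (hκ : κ ∈ fibreOverD ξ (logProdAlg K ξ) r)
    {t : B} (ht : Irreducible (ξ t)) : ∃ w : RKK κ,
    vHom κ hξ (prodAlg_le_logProdAlg K ξ) hκ (ξ t) = uHom κ (ξ t) * (1 + uHom κ (ξ t) ^ r * w) ∧
    ((algebraMap R K (ξ t) ^ r)⁻¹ • (algebraMap R K (ξ t))⁻¹ •
      KaehlerDifferential.D k K (algebraMap R K (ξ t)), resHom κ w) ∈ residueRel κ N := by
  have htK : algebraMap R K (ξ t) ≠ 0 := by simpa using ht.ne_zero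
  have hval : val R K (algebraMap R K (ξ t))⁻¹ ≤ WithZero.exp (1 : ℤ) := by
    simpa using val_inv_pow_le (K := K) ht 1
  have htc : t ∈ centre ξ := (IsLocalRing.mem_maximalIdeal _).2 ht.not_isUnit
  obtain ⟨w, hw, hwc⟩ := exists_incl_eq_inv_pow_smul_sub (C := logProdAlg K ξ) (ξ := ξ) (r := r) ht
    (y := (algebraMap R K (ξ t))⁻¹ ⊗ₜ[k] t) (g := 1)
    (le_sup_right (a := prodAlg K ξ) (Algebra.subset_adjoin ⟨_, hval, t, htc, rfl⟩))
    (by rw [graphHom_tmul, inv_mul_cancel₀ htK, map_one])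
  refine ⟨toRKK κ w, ?_, w, hwc, ?_, (resHom_toRKK κ w)⟩
  · rw [vHom_eq_add hξ _ hκ ht (w := algebraMap R _ (ξ t) * w), map_mul, toRKK_algebraMap]
    · ring
    · rw [map_mul, AlgHom.commutes, hw, mul_smul_comm, mul_sub]
      congr 2
      · rw [← Algebra.smul_def, TensorProduct.smul_tmul', Algebra.smul_def, mul_inv_cancel₀ htK]
      · rw [map_one, mul_one]
  · rw [hw, map_smul, map_sub, conormalToOmega_tmul, conormalToOmega_algebraMap, sub_zero,
      sub_self]
    exact N.zero_mem

end Projections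


/-! ### Logarithmic differentials and quotients of the two projections -/

section LogCompatible

variable {k R : Type*} {K : Type*} {B : Type*} [Field k] [CommRing R] [IsDomain R]
  [IsDiscreteValuationRing R] [Algebra k R] [Field K] [Algebra R K] [IsFractionRing R K]
  [Algebra k K] [IsScalarTower k R K] [CommRing B] [Algebra k B] {ξ : B →ₐ[k] R}
  {C : Subalgebra R (K ⊗[k] B)} {r : ℕ} {κ : PrimeSpectrum (DilRing ξ C r)}
  {𝕂 : Type*} [Field 𝕂] [Algebra (RKK κ) 𝕂]

/-- The quotient `v(x) / u(x)` is of the form `1 + u(π)^b ε`, where the residue `e` of `ε`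
corresponds to `π^{-b} d log x`. -/
def LogCompatible (N : Submodule R Ω[K⁄k]) (uK vK : K →+* 𝕂) (ϖ : R) (b : ℕ) (x : K)
    (e : IsLocalRing.ResidueField (DilLocRing κ)) : Prop :=
  IsOneUnit (algebraMap (RKK κ) 𝕂) (resHom κ) (uHom κ ϖ ^ b) (vK x / uK x) e ∧
    ((algebraMap R K ϖ ^ b)⁻¹ • x⁻¹ • KaehlerDifferential.D k K x, e) ∈ residueRel κ N

variable {N : Submodule R Ω[K⁄k]} {uK vK : K →+* 𝕂} {ϖ : R} {b : ℕ}

lemma resHom_uHom_pow (hϖ : Irreducible ϖ) (hκ : κ ∈ fibreOverD ξ C r) (hb : 1 ≤ b) :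
    resHom κ (uHom κ ϖ ^ b) = 0 := by
  rw [map_pow, resHom_uHom_eq_zero hκ ((IsLocalRing.mem_maximalIdeal _).2 hϖ.not_isUnit),
    zero_pow (by omega)]

lemma LogCompatible.mul (hϖ : Irreducible ϖ) (hκ : κ ∈ fibreOverD ξ C r) (hb : 1 ≤ b) {x y : K}
    (hx0 : x ≠ 0) (hy0 : y ≠ 0) {e e' : IsLocalRing.ResidueField (DilLocRing κ)}
    (hx : LogCompatible N uK vK ϖ b x e) (hy : LogCompatible N uK vK ϖ b y e') :
    LogCompatible N uK vK ϖ b (x * y) (e + e') := by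
  refine ⟨?_, ?_⟩
  · rw [map_mul, map_mul, mul_div_mul_comm]
    exact hx.1.mul (resHom_uHom_pow hϖ hκ hb) hy.1
  · have h : (x * y)⁻¹ • KaehlerDifferential.D k K (x * y) =
        x⁻¹ • KaehlerDifferential.D k K x + y⁻¹ • KaehlerDifferential.D k K y := by
      rw [Derivation.leibniz, smul_add, smul_smul, smul_smul, add_comm]
      congr 2 <;> field_simp
    rw [h, smul_add, ← Prod.mk_add_mk]
    exact add_mem hx.2 hy.2

lemma LogCompatible.zpow [IsLocalRing (RKK κ)] (hϖ : Irreducible ϖ) (hκ : κ ∈ fibreOverD ξ C r)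
    (hb : 1 ≤ b) {x : K} (hx0 : x ≠ 0) {e : IsLocalRing.ResidueField (DilLocRing κ)}
    (hx : LogCompatible N uK vK ϖ b x e) (j : ℤ) :
    LogCompatible N uK vK ϖ b (x ^ j)
      ((j : IsLocalRing.ResidueField (DilLocRing κ)) * e) := by
  refine ⟨?_, ?_⟩
  · rw [map_zpow₀, map_zpow₀, ← div_zpow]
    exact hx.1.zpow (fun _ => isUnit_of_res_ne_zero (resHom_surjective κ))
      (resHom_uHom_pow hϖ hκ hb) j
  · have h : (x ^ j)⁻¹ • KaehlerDifferential.D k K (x ^ j) =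
        j • x⁻¹ • KaehlerDifferential.D k K x := by
      rw [Derivation.leibniz_zpow, smul_comm, smul_smul, zpow_sub_one₀ hx0]
      congr 2
      field_simp
    rw [h, smul_comm, ← zsmul_eq_mul]
    exact zsmul_mem hx.2 j

/-- The contribution to `v(x) - u(x)` of a component of a Witt vector. -/
lemma LogCompatible.hasTopResidue {p : ℕ} [Fact p.Prime] [CharP 𝕂 p] (hϖ : Irreducible ϖ)
    (hκ : κ ∈ fibreOverD ξ C r) (hb : 1 ≤ b)
    (hu : ∀ a : R, uK (algebraMap R K a) = algebraMap (RKK κ) 𝕂 (uHom κ a)) {x : K} (hx0 : x ≠ 0)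
    {e : IsLocalRing.ResidueField (DilLocRing κ)} (hx : LogCompatible N uK vK ϖ b x e) {l : ℕ}
    (hval : val R K x ^ p ^ l ≤ WithZero.exp (b : ℤ)) :
    ∃ e' : IsLocalRing.ResidueField (DilLocRing κ),
      HasTopResidue (algebraMap (RKK κ) 𝕂) (resHom κ) l
        (WittVector.teichmuller p (vK x) - WittVector.teichmuller p (uK x)) e' ∧
      (x ^ (p ^ l - 1) • KaehlerDifferential.D k K x, e') ∈ residueRel κ N := by
  have hϖK : algebraMap R K ϖ ≠ 0 := by simpa using hϖ.ne_zero
  obtain ⟨G, hG⟩ : ∃ G, algebraMap R K G = algebraMap R K ϖ ^ b * x ^ p ^ l := by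
    refine val_le_one_iff.1 ?_
    rw [map_mul, map_pow, map_pow, val_uniformizer hϖ]
    refine (mul_le_mul' le_rfl hval).trans_eq ?_
    rw [← WithZero.exp_nsmul, ← WithZero.exp_add, ← WithZero.exp_zero]
    congr 1
    simp
  refine ⟨resHom κ (uHom κ G) * e, hasTopResidue_of_isOneUnit hϖ hu
    (fun a ha => resHom_uHom_eq_zero hκ ha) hx0 hb hval hx.1 hG, ?_⟩
  have h : x ^ (p ^ l - 1) • KaehlerDifferential.D k K x =
      G • (algebraMap R K ϖ ^ b)⁻¹ • x⁻¹ • KaehlerDifferential.D k K x := by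
    rw [← algebraMap_smul K G, hG, smul_smul, smul_smul]
    congr 1
    rw [← pow_sub_one_mul (pow_pos (Fact.out : p.Prime).pos l).ne' x]
    field_simp
  rw [h, resHom_uHom_mul, ← Prod.smul_mk]
  exact Submodule.smul_mem _ G hx.2

lemma isOneUnit_div {x : R} {y : RKK κ} (hx : x ≠ 0) {c : RKK κ}
    (hu : ∀ a : R, uK (algebraMap R K a) = algebraMap (RKK κ) 𝕂 (uHom κ a))
    (hv : vK (algebraMap R K x) = algebraMap (RKK κ) 𝕂 (uHom κ x * (1 + c * y))) :
    IsOneUnit (algebraMap (RKK κ) 𝕂) (resHom κ) c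
      (vK (algebraMap R K x) / uK (algebraMap R K x)) (resHom κ y) := by
  have : uK (algebraMap R K x) ≠ 0 := by simpa using hx
  refine ⟨y, rfl, ?_⟩
  rw [hv, map_mul, ← hu, mul_div_cancel_left₀ _ this]

/-- The case of units, with the thickness `r` of the dilatation. -/
lemma exists_logCompatible_unit (hξ : InducesIsoOnCompletions ξ) (hC : prodAlg K ξ ≤ C)
    (hκ : κ ∈ fibreOverD ξ C r) {t : B} (ht : Irreducible (ξ t))
    (hN : ∀ (c : K) (η : Ω[R⁄k]), val R K c ≤ WithZero.exp (r - 1 : ℤ) →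
      c • KaehlerDifferential.map k k R K η ∈ N)
    (hu : ∀ a : R, uK (algebraMap R K a) = algebraMap (RKK κ) 𝕂 (uHom κ a))
    (hv : ∀ a : R, vK (algebraMap R K a) = algebraMap (RKK κ) 𝕂 (vHom κ hξ hC hκ a)) (g : Rˣ) :
    ∃ e : IsLocalRing.ResidueField (DilLocRing κ),
      LogCompatible N uK vK (ξ t) r (algebraMap R K g) e := by
  obtain ⟨w, hw, hwN⟩ := exists_vHom_eq_add hξ hC hκ ht hN g
  have hg : (g : R) * ↑g⁻¹ = 1 := g.mul_inv
  have hUg : uHom κ (g : R) * uHom κ ↑g⁻¹ = 1 := by rw [← map_mul, hg, map_one]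
  refine ⟨resHom κ (uHom κ ↑g⁻¹ * w), isOneUnit_div g.ne_zero hu ?_, ?_⟩
  · rw [hv, hw]
    congr 1
    linear_combination -(uHom κ (ξ t) ^ r * w) * hUg
  · have h : (algebraMap R K g)⁻¹ = algebraMap R K ↑g⁻¹ :=
      inv_eq_of_mul_eq_one_right (by rw [← map_mul, hg, map_one])
    rw [map_mul, resHom_uHom_mul, h, smul_comm, algebraMap_smul, ← Prod.smul_mk]
    exact Submodule.smul_mem _ _ hwN

/-- In the logarithmic case, all `d log x` are compatible with the thickness `r`. -/
lemma exists_logCompatible {κ : PrimeSpectrum (DilRing ξ (logProdAlg K ξ) r)} [Algebra (RKK κ) 𝕂]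
    [IsLocalRing (RKK κ)] (hξ : InducesIsoOnCompletions ξ)
    (hκ : κ ∈ fibreOverD ξ (logProdAlg K ξ) r) {t : B} (ht : Irreducible (ξ t))
    (hN : ∀ (c : K) (η : Ω[R⁄k]), val R K c ≤ WithZero.exp (r - 1 : ℤ) →
      c • KaehlerDifferential.map k k R K η ∈ N)
    (hu : ∀ a : R, uK (algebraMap R K a) = algebraMap (RKK κ) 𝕂 (uHom κ a))
    (hv : ∀ a : R, vK (algebraMap R K a) =
      algebraMap (RKK κ) 𝕂 (vHom κ hξ (prodAlg_le_logProdAlg K ξ) hκ a)) {x : K} (hx : x ≠ 0) :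
    ∃ e : IsLocalRing.ResidueField (DilLocRing κ), LogCompatible N uK vK (ξ t) r x e := by
  have hr : 1 ≤ r := Nat.one_le_iff_ne_zero.2 (fibreOverD_pos hκ)
  have htK : algebraMap R K (ξ t) ≠ 0 := by simpa using ht.ne_zero
  obtain ⟨j, g, rfl⟩ := exists_eq_zpow_mul_unit ht hx
  obtain ⟨e, he⟩ := exists_logCompatible_unit hξ _ hκ ht hN hu hv g
  obtain ⟨w, hw, hwN⟩ := exists_vHom_uniformizer_eq_add (N := N) hξ hκ ht
  have h : LogCompatible N uK vK (ξ t) r (algebraMap R K (ξ t)) (resHom κ w) :=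
    ⟨isOneUnit_div ht.ne_zero hu (by rw [hv, hw]), hwN⟩
  exact ⟨_, (h.zpow ht hκ hr htK j).mul ht hκ hr (zpow_ne_zero _ htK) (by simp) he⟩

/-- In the non-logarithmic case, all `d log x` are compatible with the thickness `r - 1`. -/
lemma exists_logCompatible_sub_one {κ : PrimeSpectrum (DilRing ξ C (r + 1))} [Algebra (RKK κ) 𝕂]
    [IsLocalRing (RKK κ)] (hr : 1 ≤ r) (hξ : InducesIsoOnCompletions ξ) (hC : prodAlg K ξ ≤ C)
    (hκ : κ ∈ fibreOverD ξ C (r + 1)) {t : B} (ht : Irreducible (ξ t))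
    (hN : ∀ (c : K) (η : Ω[R⁄k]), val R K c ≤ WithZero.exp (r : ℤ) →
      c • KaehlerDifferential.map k k R K η ∈ N)
    (hu : ∀ a : R, uK (algebraMap R K a) = algebraMap (RKK κ) 𝕂 (uHom κ a))
    (hv : ∀ a : R, vK (algebraMap R K a) = algebraMap (RKK κ) 𝕂 (vHom κ hξ hC hκ a)) {x : K}
    (hx : x ≠ 0) :
    ∃ e : IsLocalRing.ResidueField (DilLocRing κ), LogCompatible N uK vK (ξ t) r x e := by
  have hN' : ∀ (c : K) (η : Ω[R⁄k]), val R K c ≤ WithZero.exp ((r + 1 : ℕ) - 1 : ℤ) →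
      c • KaehlerDifferential.map k k R K η ∈ N := fun c η hc => hN c η (by simpa using hc)
  have htK : algebraMap R K (ξ t) ≠ 0 := by simpa using ht.ne_zero
  obtain ⟨j, g, rfl⟩ := exists_eq_zpow_mul_unit ht hx
  obtain ⟨e, ⟨ε, hε, hεg⟩, -⟩ := exists_logCompatible_unit hξ hC hκ ht hN' hu hv g
  obtain ⟨w, hw, hwN⟩ := exists_vHom_eq_add hξ hC hκ ht hN' (ξ t)
  have h : LogCompatible N uK vK (ξ t) r (algebraMap R K (ξ t)) (resHom κ w) := by
    refine ⟨isOneUnit_div ht.ne_zero hu ?_, ?_⟩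
    · rw [hv, hw]
      congr 1
      ring
    · rwa [smul_smul, ← mul_inv, ← pow_succ]
  have h' : LogCompatible N uK vK (ξ t) r (algebraMap R K g)
      (0 : IsLocalRing.ResidueField (DilLocRing κ)) := by
    refine ⟨⟨uHom κ (ξ t) * ε, ?_, ?_⟩, mem_residueRel_of_mem ?_⟩
    · rw [map_mul, ← pow_one (uHom κ (ξ t)), resHom_uHom_pow ht hκ le_rfl, zero_mul]
    · rw [hεg]
      congr 1
      ring
    · have hg : (algebraMap R K g)⁻¹ = algebraMap R K ↑g⁻¹ :=
        inv_eq_of_mul_eq_one_right (by rw [← map_mul, g.mul_inv, map_one])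
      have := hN (algebraMap R K (ξ t) ^ r)⁻¹ ((g⁻¹ : Rˣ) • KaehlerDifferential.D k R g)
        (val_inv_pow_le ht r)
      rw [hg, algebraMap_smul]
      rwa [Units.smul_def, map_smul, KaehlerDifferential.map_D] at this
  exact ⟨_, (h.zpow ht hκ hr htK j).mul ht hκ hr (zpow_ne_zero _ htK) (by simp) h'⟩

/-- In the non-logarithmic case, `d log x` is compatible with the thickness `r + 1` of the
dilatation if the characteristic divides the valuation of `x`: by additivity of the `p`-th power,
the contribution of the uniformizer is then of higher order. -/
lemma exists_logCompatible_of_dvd {κ : PrimeSpectrum (DilRing ξ C (r + 1))} [Algebra (RKK κ) 𝕂]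
    [IsLocalRing (RKK κ)] {p : ℕ} [Fact p.Prime] [CharP (RKK κ) p] [CharP K p] (hr : 2 ≤ r)
    (hξ : InducesIsoOnCompletions ξ)
    (hC : prodAlg K ξ ≤ C) (hκ : κ ∈ fibreOverD ξ C (r + 1)) {t : B} (ht : Irreducible (ξ t))
    (hN : ∀ (c : K) (η : Ω[R⁄k]), val R K c ≤ WithZero.exp (r : ℤ) →
      c • KaehlerDifferential.map k k R K η ∈ N)
    (hu : ∀ a : R, uK (algebraMap R K a) = algebraMap (RKK κ) 𝕂 (uHom κ a))
    (hv : ∀ a : R, vK (algebraMap R K a) = algebraMap (RKK κ) 𝕂 (vHom κ hξ hC hκ a)) {x : K}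
    {j : ℤ} {g : Rˣ} (hx : x = algebraMap R K (ξ t) ^ (p * j) * algebraMap R K g) :
    ∃ e : IsLocalRing.ResidueField (DilLocRing κ), LogCompatible N uK vK (ξ t) (r + 1) x e := by
  have hN' : ∀ (c : K) (η : Ω[R⁄k]), val R K c ≤ WithZero.exp ((r + 1 : ℕ) - 1 : ℤ) →
      c • KaehlerDifferential.map k k R K η ∈ N := fun c η hc => hN c η (by simpa using hc)
  have htK : algebraMap R K (ξ t) ≠ 0 := by simpa using ht.ne_zero
  have h2p := (Fact.out : p.Prime).two_le
  obtain ⟨e, he⟩ := exists_logCompatible_unit hξ hC hκ ht hN' hu hv g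
  obtain ⟨w, hw, -⟩ := exists_vHom_eq_add hξ hC hκ ht hN' (ξ t)
  have h : LogCompatible N uK vK (ξ t) (r + 1) (algebraMap R K (ξ t) ^ p)
      (0 : IsLocalRing.ResidueField (DilLocRing κ)) := by
    refine ⟨?_, ?_⟩
    · have h0 : resHom κ (uHom κ (ξ t ^ (p * r - (r + 1))) * w ^ p) = 0 := by
        have : r + 2 ≤ p * r := by nlinarith
        rw [map_mul, map_pow (uHom κ), resHom_uHom_pow ht hκ (by omega), zero_mul]
      rw [← h0, ← map_pow (algebraMap R K)]
      refine isOneUnit_div (pow_ne_zero _ ht.ne_zero) hu ?_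
      have hpow : (1 + uHom κ (ξ t) ^ r * w) ^ p = 1 + uHom κ (ξ t) ^ (r + 1) *
          (uHom κ (ξ t ^ (p * r - (r + 1))) * w ^ p) := by
        have : p * r = (r + 1) + (p * r - (r + 1)) := by
          have : r + 2 ≤ p * r := by nlinarith
          omega
        rw [add_pow_char, one_pow, mul_pow, ← pow_mul, mul_comm r p, ← mul_assoc, map_pow,
          ← pow_add, ← this]
      rw [hv, map_pow, hw, map_pow (uHom κ), ← hpow, ← mul_pow]
      congr 2
      ring
    · have : KaehlerDifferential.D k K (algebraMap R K (ξ t) ^ p) = 0 := by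
        rw [Derivation.leibniz_pow, ← Nat.cast_smul_eq_nsmul K, CharP.cast_eq_zero, zero_smul]
      rw [this, smul_zero, smul_zero]
      exact mem_residueRel_of_mem N.zero_mem
  have h' := h.zpow ht hκ (by omega) (pow_ne_zero _ htK) j
  rw [← zpow_natCast, ← zpow_mul] at h'
  rw [hx]
  exact ⟨_, h'.mul ht hκ (by omega) (zpow_ne_zero _ htK) (by simp) he⟩

end LogCompatible


/-! ### The refined conductors -/

section Conductors

variable {k R K : Type*} [Field k] [CommRing R] [IsDomain R] [IsDiscreteValuationRing R]
  [Algebra k R] [Field K] [Algebra R K] [IsFractionRing R K] [Algebra k K] [IsScalarTower k R K]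
  {p : ℕ} [Fact p.Prime]

lemma isWittClass_zero (m : ℕ) : IsWittClass (0 : TruncatedWittVector p (m + 1) K) 0 := by
  have hp : p ≠ 0 := (Fact.out : p.Prime).ne_zero
  refine ⟨0, ?_, fun σ => ?_⟩
  · rw [sub_zero]
    congr 1
    ext i
    simp [hp]
  · rw [sub_zero]
    have : (0 : H1 K (ZMod (p ^ (m + 1)))).1 (Additive.ofMul σ) = 0 := rfl
    rw [this, ZMod.val_zero, Nat.cast_zero]
    ext i
    simp

lemma zero_mem_filW (m : ℕ) {n : ℤ} : (0 : TruncatedWittVector p (m + 1) K) ∈ filW R K p m n := by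
  intro i
  have : p ^ (m - (i : ℕ)) ≠ 0 := pow_ne_zero _ (Fact.out : p.Prime).ne_zero
  rw [TruncatedWittVector.coeff_zero, map_zero, zero_pow this]
  exact zero_le

lemma zero_mem_filWMod (m n : ℕ) :
    (0 : TruncatedWittVector p (m + 1) K) ∈ filWMod R K p m n :=
  ⟨0, 0, zero_mem_filW m, zero_mem_filW m, by simp, by simp⟩

lemma sw_eq_zero_of_mem_primeToP {χ : H1 K QZ} (h : χ ∈ primeToP K p) : sw R p χ = 0 :=
  Nat.sInf_eq_zero.2 (Or.inl ⟨χ, h, 0, 0, 0, zero_mem_filW 0, isWittClass_zero 0, by simp⟩)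

lemma swMod_eq_zero_of_mem_primeToP {χ : H1 K QZ} (h : χ ∈ primeToP K p) : swMod R p χ = 0 :=
  Nat.sInf_eq_zero.2 (Or.inl ⟨χ, h, 0, 0, 0, zero_mem_filWMod 0 0, isWittClass_zero 0, by simp⟩)

lemma mapCoeff_mem_primeToP {n : ℕ} (hn : ¬ p ∣ n) (χ : H1 K (ZMod n)) :
    H1.mapCoeff (zmodToQZ n) χ ∈ primeToP K p :=
  ⟨n, ((Nat.Prime.coprime_iff_not_dvd Fact.out).2 hn).symm, χ, rfl⟩

lemma mem_filH_sw {χ : H1 K QZ} (h : sw R p χ ≠ 0) : χ ∈ filH R K p (sw R p χ) :=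
  Nat.sInf_mem (s := {n | χ ∈ filH R K p n}) (by
    by_contra hne
    rw [Set.not_nonempty_iff_eq_empty] at hne
    exact h (Nat.sInf_eq_zero.2 (Or.inr hne)))

lemma mem_filHMod_swMod {χ : H1 K QZ} (h : swMod R p χ ≠ 0) :
    χ ∈ filHMod R K p (swMod R p χ) :=
  Nat.sInf_mem (s := {n | χ ∈ filHMod R K p n}) (by
    by_contra hne
    rw [Set.not_nonempty_iff_eq_empty] at hne
    exact h (Nat.sInf_eq_zero.2 (Or.inr hne)))

variable (k) in
lemma exists_rsw_eq {χ : H1 K QZ} (h : sw R p χ ≠ 0) : ∃ ψ ∈ primeToP K p, ∃ (m : ℕ)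
    (x : TruncatedWittVector p (m + 1) K) (θ : H1 K (ZMod (p ^ (m + 1)))),
    x ∈ filW R K p m (sw R p χ) ∧ IsWittClass x θ ∧ χ = ψ + H1.mapCoeff (zmodToQZ _) θ ∧
    rsw k R p χ = Submodule.Quotient.mk (-wittD k x) := by
  obtain ⟨ψ, hψ, m, x, θ, hx, hθ, hχ⟩ := mem_filH_sw h
  exact Classical.epsilon_spec (p := fun c => ∃ ψ ∈ primeToP K p, ∃ (m : ℕ)
    (x : TruncatedWittVector p (m + 1) K) (θ : H1 K (ZMod (p ^ (m + 1)))),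
    x ∈ filW R K p m (sw R p χ) ∧ IsWittClass x θ ∧ χ = ψ + H1.mapCoeff (zmodToQZ _) θ ∧
    c = Submodule.Quotient.mk (-wittD k x)) ⟨_, ψ, hψ, m, x, θ, hx, hθ, hχ, rfl⟩

variable (k) in
lemma exists_rswMod_eq {χ : H1 K QZ} (h : swMod R p χ ≠ 0) : ∃ ψ ∈ primeToP K p, ∃ (m : ℕ)
    (x : TruncatedWittVector p (m + 1) K) (θ : H1 K (ZMod (p ^ (m + 1)))),
    x ∈ filWMod R K p m (swMod R p χ) ∧ IsWittClass x θ ∧ χ = ψ + H1.mapCoeff (zmodToQZ _) θ ∧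
    rswMod k R p χ = Submodule.Quotient.mk (-wittD k x) := by
  obtain ⟨ψ, hψ, m, x, θ, hx, hθ, hχ⟩ := mem_filHMod_swMod h
  exact Classical.epsilon_spec (p := fun c => ∃ ψ ∈ primeToP K p, ∃ (m : ℕ)
    (x : TruncatedWittVector p (m + 1) K) (θ : H1 K (ZMod (p ^ (m + 1)))),
    x ∈ filWMod R K p m (swMod R p χ) ∧ IsWittClass x θ ∧ χ = ψ + H1.mapCoeff (zmodToQZ _) θ ∧
    c = Submodule.Quotient.mk (-wittD k x)) ⟨_, ψ, hψ, m, x, θ, hx, hθ, hχ, rfl⟩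

end Conductors

/-! ### The difference of the two pull-backs -/

section Difference

variable {k R : Type*} {K : Type*} {B : Type*} [Field k] [CommRing R] [IsDomain R]
  [IsDiscreteValuationRing R] [Algebra k R] [Field K] [Algebra R K] [IsFractionRing R K]
  [Algebra k K] [IsScalarTower k R K] [CommRing B] [Algebra k B] {ξ : B →ₐ[k] R}
  {C : Subalgebra R (K ⊗[k] B)} {r : ℕ} {κ : PrimeSpectrum (DilRing ξ C r)}
  {𝕂 : Type*} [Field 𝕂] [Algebra (RKK κ) 𝕂]
  {N : Submodule R Ω[K⁄k]} {uK vK : K →+* 𝕂} {p : ℕ} [Fact p.Prime]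

lemma exists_hasTopResidue_wittD [CharP (IsLocalRing.ResidueField (DilLocRing κ)) p] {m : ℕ}
    (x : TruncatedWittVector p (m + 1) K)
    (h : ∀ i : Fin (m + 1), x.coeff i ≠ 0 → ∃ e : IsLocalRing.ResidueField (DilLocRing κ),
      HasTopResidue (algebraMap (RKK κ) 𝕂) (resHom κ) (m - i)
        (WittVector.teichmuller p (vK (x.coeff i)) - WittVector.teichmuller p (uK (x.coeff i))) e ∧
      (x.coeff i ^ (p ^ (m - (i : ℕ)) - 1) • KaehlerDifferential.D k K (x.coeff i), e) ∈
        residueRel κ N) :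
    ∃ e : IsLocalRing.ResidueField (DilLocRing κ),
      HasTopResidue (algebraMap (RKK κ) 𝕂) (resHom κ) m
        (WittVector.map vK x.out - WittVector.map uK x.out) e ∧
      (wittD k x, e) ∈ residueRel κ N := by
  have h' : ∀ i : Fin (m + 1), ∃ e : IsLocalRing.ResidueField (DilLocRing κ),
      HasTopResidue (algebraMap (RKK κ) 𝕂) (resHom κ) (m - i)
        (WittVector.teichmuller p (vK (x.coeff i)) - WittVector.teichmuller p (uK (x.coeff i))) e ∧
      (x.coeff i ^ (p ^ (m - (i : ℕ)) - 1) • KaehlerDifferential.D k K (x.coeff i), e) ∈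
        residueRel κ N := by
    intro i
    by_cases hi : x.coeff i = 0
    · refine ⟨0, ⟨0, fun j _ => ?_, fun j _ => ?_, ?_⟩, ?_⟩
      · simp [hi]
      · simp
      · simp
      · rw [hi, map_zero, smul_zero]
        exact Submodule.zero_mem _
    · exact h i hi
  choose e he heN using h'
  let e' : ℕ → IsLocalRing.ResidueField (DilLocRing κ) := fun i =>
    if hi : i < m + 1 then e ⟨i, hi⟩ else 0
  refine ⟨∑ i ∈ Finset.range (m + 1), e' i, hasTopResidue_map_sub_map uK vK m x.out e' ?_, ?_⟩
  · intro i hi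
    have hi' : i < m + 1 := by omega
    have hc : x.out.coeff i = x.coeff ⟨i, hi'⟩ := TruncatedWittVector.coeff_out x ⟨i, hi'⟩
    simp only [e', dif_pos hi', hc]
    exact he ⟨i, hi'⟩
  · have h1 : ∑ i ∈ Finset.range (m + 1), e' i = ∑ i : Fin (m + 1), e i := by
      rw [← Fin.sum_univ_eq_sum_range]
      refine Finset.sum_congr rfl fun i _ => ?_
      simp only [e', dif_pos i.2]
    have h2 : (wittD k x, ∑ i ∈ Finset.range (m + 1), e' i) = ∑ i : Fin (m + 1),
        (x.coeff i ^ (p ^ (m - (i : ℕ)) - 1) • KaehlerDifferential.D k K (x.coeff i), e i) := by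
      rw [h1]
      ext
      · simp [wittD, Prod.fst_sum]
      · simp [Prod.snd_sum]
    rw [h2]
    exact Submodule.sum_mem _ fun i _ => heN i

variable [CharP k p]

/-- The comparison of the two pull-backs, from the compatibility of the components of a Witt vector
defining the character. -/
lemma exists_artinSchreier_of_components [IsNoetherianRing (DilLocRing κ)]
    [IsFractionRing (RKK κ) 𝕂] (hκ : κ ∈ fibreOverD ξ C r)
    (hu : ∀ a : R, uK (algebraMap R K a) = algebraMap (RKK κ) 𝕂 (uHom κ a)) {v : R →+* RKK κ}
    (hv : ∀ a : R, vK (algebraMap R K a) = algebraMap (RKK κ) 𝕂 (v a))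
    (hsep : ∀ z : DilRing ξ C r, DilRing.incl ξ C r z ∈ conormalTwist ξ C r →
      conormalToOmega ξ (DilRing.incl ξ C r z) ∈ N → resDil κ z = 0)
    {ϖ : R} (hϖ : Irreducible ϖ) {b : ℕ} (hb : 1 ≤ b)
    (hlog : ∀ x : K, x ≠ 0 → ∃ e : IsLocalRing.ResidueField (DilLocRing κ),
      LogCompatible N uK vK ϖ b x e)
    {n : ℕ} (hn : n ≠ 0) (hp : p ∣ n) {ζ : K} (hζ : IsPrimitiveRoot ζ (n / p ^ padicValNat p n))
    {χ : H1 K (ZMod n)} {ψ : H1 K QZ} (hψ : ψ ∈ primeToP K p) {m : ℕ}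
    {x : TruncatedWittVector p (m + 1) K} {θ : H1 K (ZMod (p ^ (m + 1)))} (hθ : IsWittClass x θ)
    (hχ : H1.mapCoeff (zmodToQZ n) χ = ψ + H1.mapCoeff (zmodToQZ _) θ)
    (h : ∀ i : Fin (m + 1), x.coeff i ≠ 0 → ∃ (b : ℕ)
      (e : IsLocalRing.ResidueField (DilLocRing κ)), 1 ≤ b ∧
      val R K (x.coeff i) ^ p ^ (m - (i : ℕ)) ≤ WithZero.exp (b : ℤ) ∧
      LogCompatible N uK vK ϖ b (x.coeff i) e)
    {a : RKK κ} (ha : resHom κ a = -tMap κ N (Submodule.Quotient.mk (-wittD k x))) :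
    ∃ η : H1 𝕂 (ZMod p), IsArtinSchreierClass (algebraMap (RKK κ) 𝕂 a) η ∧
      H1.pullback vK χ - H1.pullback uK χ = H1.mapCoeff (mulCoeff hp) η := by
  have hinj : Function.Injective (algebraMap (RKK κ) 𝕂) := IsFractionRing.injective _ _
  have hres := resHom_surjective κ
  have : CharP (RKK κ) p := charP_of_injective_ringHom
    (f := (uHom κ).comp (algebraMap k R)) (RingHom.injective _) p
  have : CharP (IsLocalRing.ResidueField (DilLocRing κ)) p := charP_of_injective_ringHom
    (f := (resHom κ).comp ((uHom κ).comp (algebraMap k R))) (RingHom.injective _) p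
  have : CharP 𝕂 p := charP_of_injective_ringHom hinj p
  obtain ⟨e, he, heN⟩ := exists_hasTopResidue_wittD (N := N) (uK := uK) (vK := vK) x fun i hi => by
    obtain ⟨b, e, hb, hval, he⟩ := h i hi
    exact he.hasTopResidue hϖ hκ hb hu hi hval
  have hae : resHom κ a = e := by
    have h1 : (-wittD k x, -e) ∈ residueRel κ N := by
      rw [← Prod.neg_mk]
      exact Submodule.neg_mem _ heN
    rw [ha, tMap_eq_of_mem_residueRel hsep h1, neg_neg]
  rw [← hae] at he
  obtain ⟨Y, hY⟩ := he.exists_frobenius_sub fun w hw =>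
    exists_pow_sub_self_eq hres (Fact.out : p.Prime).two_le hw
  have hn' : ((n / p ^ padicValNat p n : ℕ) : IsLocalRing.ResidueField (DilLocRing κ)) ≠ 0 := by
    rw [Ne, CharP.cast_eq_zero_iff _ p, ← Nat.factorization_def n Fact.out]
    exact Nat.not_dvd_ordCompl Fact.out hn
  have huv : ∀ y : K, y ≠ 0 → ∃ c : RKK κ, resHom κ c = 1 ∧
      vK y = uK y * algebraMap (RKK κ) 𝕂 c := by
    intro y hy
    obtain ⟨e, ⟨ε, -, hε⟩, -⟩ := hlog y hy
    refine ⟨1 + uHom κ ϖ ^ b * ε, ?_, ?_⟩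
    · rw [map_add, map_mul, resHom_uHom_pow hϖ hκ hb, zero_mul, map_one, add_zero]
    · rw [← hε, mul_div_cancel₀ _ (by simpa using hy)]
  have hn0 : n / p ^ padicValNat p n ≠ 0 := by
    intro h0
    rw [h0, Nat.cast_zero] at hn'
    exact hn' rfl
  have hζuv : vK ζ = uK ζ := by
    have hζ1 : val R K ζ ≤ 1 := by
      rw [← pow_le_one_iff hn0, ← map_pow, hζ.pow_eq_one, map_one]
    obtain ⟨z, rfl⟩ := val_le_one_iff.1 hζ1
    have hz : z ^ (n / p ^ padicValNat p n) = 1 := by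
      apply IsFractionRing.injective R K
      rw [map_pow, hζ.pow_eq_one, map_one]
    rw [hu, hv]
    congr 1
    refine eq_of_pow_eq_one_of_res_eq hres hn' (by rw [← map_pow, hz, map_one])
      (by rw [← map_pow, hz, map_one]) ?_
    obtain ⟨c, hc, hcz⟩ := huv _ (hζ.ne_zero hn0)
    rw [hu, hv, ← map_mul] at hcz
    rw [hinj hcz, map_mul, hc, mul_one]
  refine exists_artinSchreier_pullback_sub hn hp hζ hψ hθ hχ uK vK (fun y hy => ?_) hζuv _ _ hY
  obtain ⟨c, hc, hcy⟩ := huv y hy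
  obtain ⟨d, rfl⟩ := exists_pow_eq_of_res_eq_one hres hn' hc
  exact ⟨algebraMap (RKK κ) 𝕂 d, by rw [hcy, map_pow]⟩

end Difference

end Ramif

end

/-- The first conjunct is the non-logarithmic statement, the second one its logarithmic analogue.
In both, `κ` is the generic point of `T_D` (resp. `Θ_D`), `𝕂` is the fraction field of the completed
local ring `R_𝕂` at `κ`, and `uK`, `vK : K → 𝕂` extend `u`, `v : R → R_𝕂`. The Artin-Schreier class
in `H¹(𝕂, ℤ/p)` of an element `e` of `R_𝕂 / 𝔪_𝕂`, obtained through
`H¹_ét(R_𝕂 / 𝔪_𝕂, ℤ/p) ≅ H¹_ét(R_𝕂, ℤ/p) → H¹(𝕂, ℤ/p)`, is the Artin-Schreier class of any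
lift `a ∈ R_𝕂` of `e`. -/
theorem mainTheorem7 {k R K B : Type*} [Field k] [PerfectField k] (p : ℕ) [Fact p.Prime]
    [CharP k p]
    [CommRing R] [IsDomain R] [IsDiscreteValuationRing R] [Algebra k R]
    [IsAdicComplete (IsLocalRing.maximalIdeal R) R]
    [Algebra.EssFiniteType k (IsLocalRing.ResidueField R)]
    [Field K] [Algebra R K] [IsFractionRing R K] [Algebra k K] [IsScalarTower k R K]
    [CommRing B] [Algebra k B] [Algebra.Smooth k B]
    (ξ : B →ₐ[k] R) (hξ : Ramif.InducesIsoOnCompletions ξ)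
    (n : ℕ) (hn : 1 ≤ n) (hζ : ∃ ζ : K, IsPrimitiveRoot ζ (n / p ^ padicValNat p n))
    (χ : Ramif.H1 K (ZMod n)) (χ' : Ramif.H1 K Ramif.QZ)
    (hχ' : χ' = Ramif.H1.mapCoeff (Ramif.zmodToQZ n) χ) :
    (2 ≤ Ramif.swMod R p χ' → ∃ hp : p ∣ n, ∀ r : ℕ, r = Ramif.swMod R p χ' + 1 →
      ∀ (κ : PrimeSpectrum (Ramif.DilRing ξ (Ramif.prodAlg K ξ) r))
        (hκ : IsGenericPoint κ (Ramif.fibreOverD ξ (Ramif.prodAlg K ξ) r))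
        (𝕂 : Type*) [Field 𝕂] [Algebra (Ramif.RKK κ) 𝕂] [IsFractionRing (Ramif.RKK κ) 𝕂]
        (uK vK : K →+* 𝕂),
        (∀ a : R, uK (algebraMap R K a) = algebraMap (Ramif.RKK κ) 𝕂 (Ramif.uHom κ a)) →
        (∀ a : R, vK (algebraMap R K a) =
          algebraMap (Ramif.RKK κ) 𝕂 (Ramif.vHom κ hξ le_rfl hκ.mem a)) →
        ∀ a : Ramif.RKK κ, Ramif.resHom κ a = -Ramif.tMap κ _ (Ramif.rswMod k R p χ') →
          ∃ θ : Ramif.H1 𝕂 (ZMod p),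
            Ramif.IsArtinSchreierClass (algebraMap (Ramif.RKK κ) 𝕂 a) θ ∧
            Ramif.H1.pullback vK χ - Ramif.H1.pullback uK χ =
              Ramif.H1.mapCoeff (Ramif.mulCoeff hp) θ) ∧
    (1 ≤ Ramif.sw R p χ' → ∃ hp : p ∣ n, ∀ r : ℕ, r = Ramif.sw R p χ' →
      ∀ (κ : PrimeSpectrum (Ramif.DilRing ξ (Ramif.logProdAlg K ξ) r))
        (hκ : IsGenericPoint κ (Ramif.logFibreOverD (K := K) ξ r))
        (𝕂 : Type*) [Field 𝕂] [Algebra (Ramif.RKK κ) 𝕂] [IsFractionRing (Ramif.RKK κ) 𝕂]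
        (uK vK : K →+* 𝕂),
        (∀ a : R, uK (algebraMap R K a) = algebraMap (Ramif.RKK κ) 𝕂 (Ramif.uHom κ a)) →
        (∀ a : R, vK (algebraMap R K a) = algebraMap (Ramif.RKK κ) 𝕂
          (Ramif.vHom κ hξ (Ramif.prodAlg_le_logProdAlg K ξ) hκ.mem.1 a)) →
        ∀ a : Ramif.RKK κ, Ramif.resHom κ a = -Ramif.tMap κ _ (Ramif.rsw k R p χ') →
          ∃ θ : Ramif.H1 𝕂 (ZMod p),
            Ramif.IsArtinSchreierClass (algebraMap (Ramif.RKK κ) 𝕂 a) θ ∧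
            Ramif.H1.pullback vK χ - Ramif.H1.pullback uK χ =
              Ramif.H1.mapCoeff (Ramif.mulCoeff hp) θ) := by
  have hp0 : p.Prime := Fact.out
  have hn0 : n ≠ 0 := by omega
  obtain ⟨ζ, hζ⟩ := hζ
  subst hχ'
  have : CharP K p := charP_of_injective_ringHom (algebraMap k K).injective p
  obtain ⟨t, ht⟩ := hξ.exists_irreducible
  refine ⟨fun hsw => ?_, fun hsw => ?_⟩
  · have hp : p ∣ n := by
      by_contra hpn
      rw [Ramif.swMod_eq_zero_of_mem_primeToP (Ramif.mapCoeff_mem_primeToP hpn χ)] at hsw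
      omega
    refine ⟨hp, ?_⟩
    obtain ⟨ψ, hψ, m, x, θ, hx, hθ, hχ, hrsw⟩ := Ramif.exists_rswMod_eq k (R := R) (p := p)
      (χ := Ramif.H1.mapCoeff (Ramif.zmodToQZ n) χ) (by omega)
    rw [hrsw]
    generalize Ramif.swMod R p (Ramif.H1.mapCoeff (Ramif.zmodToQZ n) χ) = s at hsw hx
    rintro r rfl κ hκ 𝕂 _ _ _ uK vK hu hv a ha
    have := Ramif.isNoetherianRing_dilLocRing (Ramif.prodAlg_fg ξ) κ
    have : CharP (Ramif.RKK κ) p := charP_of_injective_ringHom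
      (f := (Ramif.uHom κ).comp (algebraMap k R)) (RingHom.injective _) p
    have hN : ∀ (c : K) (η : Ω[R⁄k]), Ramif.val R K c ≤ WithZero.exp (s : ℤ) →
        c • KaehlerDifferential.map k k R K η ∈ Ramif.filOmegaMod k R K (s - 1) :=
      fun c η hc => Submodule.subset_span ⟨c, by rwa [sub_add_cancel], η, rfl⟩
    have hlog : ∀ y : K, y ≠ 0 → ∃ e : IsLocalRing.ResidueField (Ramif.DilLocRing κ),
        Ramif.LogCompatible (Ramif.filOmegaMod k R K (s - 1)) uK vK (ξ t) s y e := fun y hy =>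
      Ramif.exists_logCompatible_sub_one (by omega) hξ le_rfl hκ.mem ht hN hu hv hy
    refine Ramif.exists_artinSchreier_of_components hκ.mem hu hv (fun z hz hzN => ?_) ht (b := s)
      (by omega) hlog hn0 hp hζ hψ hθ hχ (fun i hi => ?_) ha
    · refine Ramif.resDil_eq_zero_of_mem_filOmegaMod hξ hκ.mem hz ?_
      rwa [show (((s + 1 : ℕ) : ℤ) - 2) = s - 1 by push_cast; ring]
    · rcases Ramif.val_coeff_of_mem_filWMod hx i with hi1 | ⟨hi1, hi2⟩
      · obtain ⟨e, he⟩ := hlog _ hi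
        exact ⟨s, e, by omega, hi1, he⟩
      · rcases le_or_gt (Ramif.val R K (x.coeff i) ^ p ^ (m - (i : ℕ)))
          (WithZero.exp (s : ℤ)) with hi3 | hi3
        · obtain ⟨e, he⟩ := hlog _ hi
          exact ⟨s, e, by omega, hi3, he⟩
        · -- here `p ^ (m - i) v(x_i) = -(s + 1)`, so `p` divides the valuation of `x_i`
          obtain ⟨j, g, hj⟩ := Ramif.exists_eq_zpow_mul_unit ht hi
          rw [hj, Ramif.val_zpow_mul_unit ht, ← WithZero.exp_nsmul] at hi1 hi3
          rw [WithZero.exp_le_exp] at hi1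
          rw [WithZero.exp_lt_exp] at hi3
          have hpj : (p : ℤ) ∣ j := by
            obtain ⟨c, hc⟩ := hi2
            have h1 : ((p : ℤ) ^ (m - (i : ℕ))) * -j = p ^ (m - (i : ℕ)) * (p * c) := by
              simp only [nsmul_eq_mul, Nat.cast_pow] at hi1 hi3
              have h2 : ((s + 1 : ℕ) : ℤ) = (p ^ (m - (i : ℕ) + 1) * c : ℕ) := by rw [hc]
              push_cast at h2
              rw [← mul_assoc, ← pow_succ, ← h2]
              omega
            have h3 := mul_left_cancel₀ (pow_ne_zero _ (by exact_mod_cast hp0.ne_zero)) h1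
            exact ⟨-c, by linear_combination -h3⟩
          obtain ⟨j', rfl⟩ := hpj
          obtain ⟨e, he⟩ := Ramif.exists_logCompatible_of_dvd hsw hξ le_rfl hκ.mem ht hN hu hv hj
          refine ⟨s + 1, e, by omega, ?_, he⟩
          rw [hj, Ramif.val_zpow_mul_unit ht, ← WithZero.exp_nsmul, WithZero.exp_le_exp]
          exact_mod_cast hi1
  · have hp : p ∣ n := by
      by_contra hpn
      rw [Ramif.sw_eq_zero_of_mem_primeToP (Ramif.mapCoeff_mem_primeToP hpn χ)] at hsw
      omega
    refine ⟨hp, ?_⟩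
    obtain ⟨ψ, hψ, m, x, θ, hx, hθ, hχ, hrsw⟩ := Ramif.exists_rsw_eq k (R := R) (p := p)
      (χ := Ramif.H1.mapCoeff (Ramif.zmodToQZ n) χ) (by omega)
    rw [hrsw]
    generalize Ramif.sw R p (Ramif.H1.mapCoeff (Ramif.zmodToQZ n) χ) = s at hsw hx
    rintro r rfl κ hκ 𝕂 _ _ _ uK vK hu hv a ha
    have := Ramif.isNoetherianRing_dilLocRing (Ramif.logProdAlg_fg ξ) κ
    have hN : ∀ (c : K) (η : Ω[R⁄k]), Ramif.val R K c ≤ WithZero.exp (r - 1 : ℤ) →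
        c • KaehlerDifferential.map k k R K η ∈ Ramif.filOmega k R K (r - 1) :=
      fun c η hc => Submodule.subset_span ⟨c, hc, Or.inl ⟨η, rfl⟩⟩
    have hlog : ∀ y : K, y ≠ 0 → ∃ e : IsLocalRing.ResidueField (Ramif.DilLocRing κ),
        Ramif.LogCompatible (Ramif.filOmega k R K (r - 1)) uK vK (ξ t) r y e := fun y hy =>
      Ramif.exists_logCompatible hξ hκ.mem.1 ht hN hu hv hy
    refine Ramif.exists_artinSchreier_of_components hκ.mem.1 hu hv (fun z hz hzN =>
      Ramif.resDil_eq_zero_of_mem_filOmega hξ hκ.mem.1 hz hzN) ht hsw hlog hn0 hp hζ hψ hθ hχ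
      (fun i hi => ?_) ha
    obtain ⟨e, he⟩ := hlog _ hi
    exact ⟨r, e, hsw, hx i, he⟩
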